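/- Let $E$ be the figure-eight knot (the closure of the braid $\sigma_1\sigma_2^{-1}\sigma_1\sigma_2^{-1}$) and, for $N\ge 1$, let $J_N(E;t)$ be its colored Jones polynomial associated with the $N$-dimensional irreducible representation of $\mathfrak{sl}(2;\mathbb{C})$, normalized so that $J_N(\text{unknot};t)=1$. For real $r$ put $$G(r):=\limsup_{N\to\infty}\frac{\log\left|J_N\left(E;\exp(2\pi r\sqrt{-1}/N)\right)\right|}{N}\in[-\infty,\infty]\qquad(\log 0:=-\infty).$$ Then $G(1)$ is finite and $$\lim_{r\to1}\limsup_{N\to\infty}\frac{\log\left|J_N\left(E;\exp(2\pi r\sqrt{-1}/N)\right)\right|}{N}=\limsup_{N\to\infty}\frac{\log\left|J_N\left(E;\exp(2\pi\sqrt{-1}/N)\right)\right|}{N},$$ where $r\to1$ through real numbers $r\ne1$. That is, $G$ is continuous at $r=1$. -/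

import Mathlib

open Filter Topology

noncomputable section

namespace ColoredJones

/-- The symbol `{m} = t^(m/2) - t^(-m/2)`.  All powers of `t` with fractional exponents are
principal powers, so they are powers of one and the same fourth root of `t`. -/
def brace (t : ℂ) (m : ℕ) : ℂ :=
  t ^ ((m : ℂ) / 2) - t ^ (-(m : ℂ) / 2)

/-- The symmetric quantum binomial coefficient `{n}! / ({k}! {n - k}!)`, given by its Pascal
recursion so that it is a Laurent polynomial in `t^(1/2)` and makes sense at roots of unity. -/
def qbinom (t : ℂ) : ℕ → ℕ → ℂ
  | _, 0 => 1
  | 0, _ + 1 => 0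
  | n + 1, k + 1 =>
      t ^ (((k : ℂ) + 1) / 2) * qbinom t n (k + 1) +
        t ^ (-((n : ℂ) - (k : ℂ)) / 2) * qbinom t n k

/-- The quotient `{a + m}! / {a}! = {a + 1} {a + 2} ⋯ {a + m}`. -/
def braceRising (t : ℂ) (a m : ℕ) : ℂ :=
  ∏ s ∈ Finset.range m, brace t (a + s + 1)

/-- The weight `i - (N - 1) / 2` of the `i`-th basis vector of the `N`-dimensional irreducible
representation of quantum `sl(2)`, where `0 ≤ i < N`. -/
def weight (N i : ℕ) : ℂ :=
  (i : ℂ) - ((N : ℂ) - 1) / 2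

/-- The `R`-matrix of the `N`-dimensional irreducible representation `V` of quantum `sl(2)`,
as a matrix on the basis `e_i ⊗ e_j` of `V ⊗ V`.  Its entry at `((i, j), (k, l))` is, for
`l = i + m` and `k = j - m` with `m ≥ 0`,
`{l}! {N-1-k}! / ({i}! {m}! {N-1-j}!) * t ^ (wt(i) wt(j) - m (i - j) / 2 - m (m + 1) / 4)`,
and it is `0` otherwise. -/
def rMatrix (N : ℕ) (t : ℂ) : Matrix (Fin N × Fin N) (Fin N × Fin N) ℂ :=
  fun x y =>
    let i : ℕ := x.1
    let j : ℕ := x.2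
    let k : ℕ := y.1
    let l : ℕ := y.2
    let m : ℕ := l - i
    if i + j = k + l ∧ i ≤ l then
      qbinom t l m * braceRising t (N - 1 - j) m *
        t ^ (weight N i * weight N j - (m : ℂ) * ((i : ℂ) - (j : ℂ)) / 2
              - (m : ℂ) * ((m : ℂ) + 1) / 4)
    else 0

/-- The inverse of the `R`-matrix.  Its entry at `((i, j), (k, l))` is, for
`l = i - m` and `k = j + m` with `m ≥ 0`,
`(-1)^m {k}! {N-1-l}! / ({j}! {m}! {N-1-i}!)
  * t ^ (- wt(i) wt(j) - m (i - j) / 2 + m (m + 1) / 4)`,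
and it is `0` otherwise. -/
def rMatrixInv (N : ℕ) (t : ℂ) : Matrix (Fin N × Fin N) (Fin N × Fin N) ℂ :=
  fun x y =>
    let i : ℕ := x.1
    let j : ℕ := x.2
    let k : ℕ := y.1
    let l : ℕ := y.2
    let m : ℕ := i - l
    if i + j = k + l ∧ l ≤ i then
      (-1) ^ m * qbinom t k m * braceRising t (N - 1 - i) m *
        t ^ (-(weight N i * weight N j) - (m : ℂ) * ((i : ℂ) - (j : ℂ)) / 2
              + (m : ℂ) * ((m : ℂ) + 1) / 4)
    else 0

/-- A braid word on `n + 1` strands: the letter `(i, true)` is the Artin generator crossing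
the strands `i` and `i + 1` (counted from `0`), and `(i, false)` is its inverse. -/
abbrev BraidWord (n : ℕ) : Type := List (Fin n × Bool)

/-- The exponent sum (writhe) of a braid word. -/
def writhe {n : ℕ} (β : BraidWord n) : ℤ :=
  (β.map fun g => if g.2 then (1 : ℤ) else -1).sum

/-- The matrix on `V^{⊗(n+1)}` that acts by `A` on the tensor factors `i` and `i + 1` and by
the identity on all other factors. -/
def actAt {n N : ℕ} (A : Matrix (Fin N × Fin N) (Fin N × Fin N) ℂ) (i : Fin n) :
    Matrix (Fin (n + 1) → Fin N) (Fin (n + 1) → Fin N) ℂ :=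
  fun x y =>
    if ∀ p : Fin (n + 1), p ≠ i.castSucc → p ≠ i.succ → x p = y p then
      A (x i.castSucc, x i.succ) (y i.castSucc, y i.succ)
    else 0

/-- The representation of a braid word on `V^{⊗(n+1)}` given by the `R`-matrix. -/
def braidMatrix {n : ℕ} (N : ℕ) (t : ℂ) (β : BraidWord n) :
    Matrix (Fin (n + 1) → Fin N) (Fin (n + 1) → Fin N) ℂ :=
  (β.map fun g => actAt (if g.2 then rMatrix N t else rMatrixInv N t) g.1).prod

/-- The operator on `V` of the long knot obtained from a braid word by closing all strands but
the first: the partial quantum trace, with weights `t^{wt(i)}` on each closed strand, corrected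
by the framing factor `t^{-w (N^2 - 1) / 4}`, where `w` is the writhe. -/
def longKnotMatrix {n : ℕ} (N : ℕ) (t : ℂ) (β : BraidWord n) : Matrix (Fin N) (Fin N) ℂ :=
  fun a b =>
    t ^ (-(writhe β : ℂ) * ((N : ℂ) ^ 2 - 1) / 4) *
      ∑ c : Fin n → Fin N,
        braidMatrix N t β (Fin.cons a c) (Fin.cons b c) *
          ∏ p : Fin n, t ^ weight N (c p)

/-- The value at `t ≠ 0` of the `N`-colored Jones polynomial, normalized to be `1` for the
unknot, of the knot that is the closure of the braid word `β`.  The operator of the long knot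
is a scalar (it is an endomorphism of an irreducible representation), and the invariant is that
scalar, read off on the basis vector `e_0`.  The value for `N = 0` is irrelevant. -/
def coloredJones {n : ℕ} (N : ℕ) (β : BraidWord n) (t : ℂ) : ℂ :=
  if h : 0 < N then longKnotMatrix N t β ⟨0, h⟩ ⟨0, h⟩ else 0

/-- The figure-eight knot, as the closure of the three-strand braid
`σ₁ σ₂⁻¹ σ₁ σ₂⁻¹`. -/
def figureEight : BraidWord 2 :=
  [(0, true), (1, false), (0, true), (1, false)]

/-- The upper growth rate `limsup_N log |J_N(E; exp(2 π r √-1 / N))| / N` for the figure-eight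
knot `E`, as an extended real number, with `log 0 = -∞`. -/
def growthRate (r : ℝ) : EReal :=
  limsup
    (fun N : ℕ =>
      ENNReal.log ‖coloredJones N figureEight
          (Complex.exp (2 * (Real.pi : ℂ) * (r : ℂ) * Complex.I / (N : ℂ)))‖ₑ / (N : EReal))
    atTop

end ColoredJones

end

/-! For `t = exp(2πir/N)` with `N > 2|r|`, the invariant has the cyclotomic form `J_N(r) = Σ_{m<N}
P_m(r)`, where `P_m(r) = f_r(1) ⋯ f_r(m)` and `f_r(k) = {N+k}{N-k} = 4(sin²(πrk/N) - sin²(πr))`. One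
half of the proof derives this from the R-matrix definition, the other compares `r` with `1`.

Algebra. For generic `t` both R-matrices commute with the coproduct of the raising operator, so the
operator of the long knot commutes with the raising operator and has constant diagonal
(`longKnotMatrix_figureEight_apply`). It may therefore be read off on the last basis vector, where
the triangularity of `R` leaves only a double sum. Expanding by the `q`-binomial theorem, resumming
by it in another order and applying `sum_qbinom_mul_braceRising` gives the cyclotomic sum. Roots of
unity are not generic, but generic values are dense and both sides are continuous on the slit plane.

Analysis. At `r = 1` every factor is `4 sin²(πk/N) ≥ 0`, so nothing cancels, and `J_N(1) ≥
2^(N/12)`. For `r` near `1` the indices are cut at `K ≈ ηN` and `L ≈ (1-η)N`. In the bulk between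
them `f_1 ≥ 16η²`, so `f_r / f_1 = 1 + O(|r-1|/η²)` and replacing `r` by `1` costs at most
`e^{±δN}`. Near both ends `|f_r| ≤ 1/2`: the terms before `K` sum to at most `N`, and those after
`L` are a small fraction of the bulk terms (`abs_cycSum_sub_le`). Hence `J_N(r)` is essentially
`P_K(r)` times a bulk sum. Since `|P_K(r)| ≤ 1` and `P_K(1) ≥ e^{-δN}`, the upper bound
`eventually_abs_cycSum_le` holds for all large `N`.

For the lower bound `P_K(r)` must not be too small. Its factors change sign at `k = aN` with `a =
|r-1|/r`, so the danger is that `aN` lies close to an integer. When `N` increases by one this number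
moves by `a`, so for one of `N`, `N+1` it keeps distance `a/4` from the integers; then `|P_K(r)| ≥
(a/4)² e^{-δN}` (`abs_cycProd_ge`, `eventually_le_abs_cycSum`). A limsup needs only infinitely many
`N`, and `J_{N+1}(1) ≥ e^{-2} J_N(1)` makes the shift by one harmless. -/

noncomputable section

namespace ColoredJones

open scoped Kronecker

/-! ### Quantum integers, factorials and binomials -/

/-- The quantum factorial `{n}!`. -/
def braceFac (t : ℂ) (n : ℕ) : ℂ := braceRising t 0 n

theorem brace_zero (t : ℂ) : brace t 0 = 0 := by simp [brace]

theorem braceFac_zero (t : ℂ) : braceFac t 0 = 1 := by simp [braceFac, braceRising]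

theorem braceFac_succ (t : ℂ) (n : ℕ) : braceFac t (n + 1) = braceFac t n * brace t (n + 1) := by
  simp [braceFac, braceRising, Finset.prod_range_succ]

theorem braceRising_zero (t : ℂ) (a : ℕ) : braceRising t a 0 = 1 := by simp [braceRising]

theorem braceRising_succ (t : ℂ) (a m : ℕ) :
    braceRising t a (m + 1) = braceRising t a m * brace t (a + m + 1) := by
  simp [braceRising, Finset.prod_range_succ]

theorem braceRising_succ_left (t : ℂ) (a m : ℕ) :
    braceRising t a (m + 1) = brace t (a + 1) * braceRising t (a + 1) m := by
  simp only [braceRising, Finset.prod_range_succ']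
  rw [mul_comm]
  congr 1
  refine Finset.prod_congr rfl fun s _ => ?_
  congr 1
  ring

theorem braceFac_mul_braceRising (t : ℂ) (a m : ℕ) :
    braceFac t a * braceRising t a m = braceFac t (a + m) := by
  induction m with
  | zero => simp [braceRising_zero]
  | succ m ih => rw [braceRising_succ, ← mul_assoc, ih, ← add_assoc, braceFac_succ]

theorem qbinom_zero_right (t : ℂ) (n : ℕ) : qbinom t n 0 = 1 := by cases n <;> rfl

theorem qbinom_succ_succ (t : ℂ) (n k : ℕ) : qbinom t (n + 1) (k + 1) =
    t ^ (((k : ℂ) + 1) / 2) * qbinom t n (k + 1) +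
        t ^ (-((n : ℂ) - (k : ℂ)) / 2) * qbinom t n k := rfl

theorem qbinom_of_lt (t : ℂ) {n k : ℕ} (h : n < k) : qbinom t n k = 0 := by
  induction n generalizing k with
  | zero => cases k with
    | zero => omega
    | succ k => rfl
  | succ n ih => cases k with
    | zero => omega
    | succ k => rw [qbinom_succ_succ, ih (by omega), ih (by omega)]; simp

theorem qbinom_self (t : ℂ) (n : ℕ) : qbinom t n n = 1 := by
  induction n with
  | zero => rfl
  | succ n ih => rw [qbinom_succ_succ, ih, qbinom_of_lt t (Nat.lt_succ_self n)]; simp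

theorem brace_add {t : ℂ} (ht : t ≠ 0) (a b : ℕ) :
    t ^ ((b : ℂ) / 2) * brace t a + t ^ (-(a : ℂ) / 2) * brace t b = brace t (a + b) := by
  simp only [brace, mul_sub, ← Complex.cpow_add _ _ ht]
  push_cast
  ring_nf

/-- The division-free form follows from the Pascal recursion and `brace_add`, and so needs no
genericity; the induction runs on `n + k`. -/
theorem qbinom_mul_braceFac {t : ℂ} (ht : t ≠ 0) (n k : ℕ) :
    qbinom t (n + k) k * (braceFac t n * braceFac t k) = braceFac t (n + k) := by
  obtain ⟨s, hs⟩ : ∃ s, s = n + k := ⟨_, rfl⟩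
  induction s generalizing n k with
  | zero =>
    obtain rfl : n = 0 := by omega
    obtain rfl : k = 0 := by omega
    simp [braceFac_zero, qbinom_zero_right]
  | succ s ih =>
    rcases n with _ | n
    · simp [braceFac_zero, qbinom_self]
    rcases k with _ | k
    · simp [braceFac_zero, qbinom_zero_right]
    have h1 := ih n (k + 1) (by omega)
    have h2 := ih (n + 1) k (by omega)
    have e : n + 1 + (k + 1) = (n + (k + 1)) + 1 := by ring
    have e2 : n + 1 + k = n + (k + 1) := by ring
    rw [e2] at h2
    rw [e, qbinom_succ_succ, braceFac_succ t (n + (k + 1)), braceFac_succ t n, braceFac_succ t k]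
    rw [braceFac_succ t k] at h1
    rw [braceFac_succ t n] at h2
    have h3 := brace_add ht (n + 1) (k + 1)
    have e3 : n + 1 + (k + 1) = n + (k + 1) + 1 := by ring
    rw [e3] at h3
    rw [← h3]
    have e4 : t ^ (-(((n + (k + 1) : ℕ) : ℂ) - (k : ℂ)) / 2) = t ^ (-((n + 1 : ℕ) : ℂ) / 2) := by
      congr 1; push_cast; ring
    have e5 : t ^ (((k : ℂ) + 1) / 2) = t ^ (((k + 1 : ℕ) : ℂ) / 2) := by push_cast; rfl
    rw [e4, e5]
    linear_combination (t ^ (((k + 1 : ℕ) : ℂ) / 2) * brace t (n + 1)) * h1 +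
      (t ^ (-((n + 1 : ℕ) : ℂ) / 2) * brace t (k + 1)) * h2

/-- The value `t` is generic: no quantum integer `{k}` with `k ≥ 1` vanishes. -/
structure Generic (t : ℂ) : Prop where
  ne_zero : t ≠ 0
  brace_ne_zero : ∀ k : ℕ, brace t (k + 1) ≠ 0

theorem Generic.braceFac_ne_zero {t : ℂ} (h : Generic t) (n : ℕ) : braceFac t n ≠ 0 := by
  induction n with
  | zero => simp [braceFac_zero]
  | succ n ih => rw [braceFac_succ]; exact mul_ne_zero ih (h.brace_ne_zero n)

theorem Generic.qbinom_add {t : ℂ} (h : Generic t) (n k : ℕ) :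
    qbinom t (n + k) k = braceFac t (n + k) / (braceFac t n * braceFac t k) := by
  rw [eq_div_iff (mul_ne_zero (h.braceFac_ne_zero n) (h.braceFac_ne_zero k))]
  exact qbinom_mul_braceFac h.ne_zero n k

theorem Generic.qbinom_add' {t : ℂ} (h : Generic t) (n k : ℕ) :
    qbinom t (n + k) n = braceFac t (n + k) / (braceFac t n * braceFac t k) := by
  rw [add_comm n k, h.qbinom_add, mul_comm (braceFac t k)]

theorem Generic.braceRising_eq {t : ℂ} (h : Generic t) (a m : ℕ) :
    braceRising t a m = braceFac t (a + m) / braceFac t a := by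
  rw [eq_div_iff (h.braceFac_ne_zero a), mul_comm]
  exact braceFac_mul_braceRising t a m

theorem brace_mul_qbinom_succ {t : ℂ} (h : Generic t) (i m : ℕ) :
    brace t (m + 1) * qbinom t (i + (m + 1)) (m + 1) =
      brace t (i + m + 1) * qbinom t (i + m) m := by
  rw [h.qbinom_add, h.qbinom_add, ← add_assoc, braceFac_succ, braceFac_succ t m]
  have := h.braceFac_ne_zero
  have h1 := h.brace_ne_zero m
  field_simp

theorem brace_mul_qbinom_succ' {t : ℂ} (h : Generic t) (i m : ℕ) :
    brace t (m + 1) * qbinom t (i + (m + 1)) (m + 1) =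
      brace t (i + 1) * qbinom t (i + 1 + m) m := by
  rw [h.qbinom_add, h.qbinom_add, braceFac_succ t m, braceFac_succ t i,
    show i + 1 + m = i + (m + 1) by ring]
  have := h.braceFac_ne_zero
  have h1 := h.brace_ne_zero m
  have h2 := h.brace_ne_zero i
  field_simp

/-- The symmetric form of the `q`-binomial theorem. -/
theorem prod_eq_sum_qbinom {t : ℂ} (ht : t ≠ 0) (A B : ℂ) (n : ℕ) :
    ∏ g ∈ Finset.range n, (A * t ^ (((g : ℂ) + 1) / 2) + B * t ^ (-((g : ℂ) + 1) / 2)) =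
      ∑ j ∈ Finset.range (n + 1), qbinom t n j * A ^ j * B ^ (n - j) *
        t ^ (((n : ℂ) + 1) * (2 * j - n) / 4) := by
  induction n generalizing A B with
  | zero => simp [qbinom_zero_right]
  | succ n ih =>
    have hA (i : ℕ) : (A * t ^ (1 / 2 : ℂ)) ^ i = A ^ i * t ^ ((i : ℂ) / 2) := by
      rw [mul_pow, ← Complex.cpow_nat_mul]; congr 2; ring
    have hB (i : ℕ) : (B * t ^ (-1 / 2 : ℂ)) ^ i = B ^ i * t ^ (-(i : ℂ) / 2) := by
      rw [mul_pow, ← Complex.cpow_nat_mul]; congr 2; ring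
    have h0 : ∏ g ∈ Finset.range n, (A * t ^ ((((g + 1 : ℕ) : ℂ) + 1) / 2) +
          B * t ^ (-(((g + 1 : ℕ) : ℂ) + 1) / 2)) =
        ∏ g ∈ Finset.range n, (A * t ^ (1 / 2 : ℂ) * t ^ (((g : ℂ) + 1) / 2) +
          B * t ^ (-1 / 2 : ℂ) * t ^ (-((g : ℂ) + 1) / 2)) := by
      refine Finset.prod_congr rfl fun g _ => ?_
      rw [mul_assoc, mul_assoc, ← Complex.cpow_add _ _ ht, ← Complex.cpow_add _ _ ht]
      congr 3 <;> push_cast <;> ring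
    -- The first factor is split off rather than the last. The remaining product is again of the
    -- same form, with `A` and `B` rescaled by `t^(1/2)` and `t^(-1/2)`, which is why the induction
    -- generalizes them.
    rw [Finset.prod_range_succ', h0, ih, Finset.sum_range_succ' _ (n + 1), mul_add,
      Finset.sum_mul, Finset.sum_mul]
    have e1 : ∑ i ∈ Finset.range (n + 1), qbinom t n i * (A * t ^ (1 / 2 : ℂ)) ^ i *
          (B * t ^ (-1 / 2 : ℂ)) ^ (n - i) *
        t ^ (((n : ℂ) + 1) * (2 * i - n) / 4) * (A * t ^ ((((0 : ℕ) : ℂ) + 1) / 2)) =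
        ∑ x ∈ Finset.range (n + 1), t ^ (-((n : ℂ) - (x : ℂ)) / 2) * qbinom t n x * A ^ (x + 1) *
          B ^ (n + 1 - (x + 1)) *
          t ^ ((((n + 1 : ℕ) : ℂ) + 1) * (2 * ((x + 1 : ℕ) : ℂ) - ((n + 1 : ℕ) : ℂ)) / 4) := by
      refine Finset.sum_congr rfl fun i hi => ?_
      have hin : i ≤ n := by simpa [Nat.lt_succ_iff] using hi
      have : t ^ ((i : ℂ) / 2) * t ^ (-((n - i : ℕ) : ℂ) / 2) *
          t ^ (((n : ℂ) + 1) * (2 * i - n) / 4) * t ^ ((((0 : ℕ) : ℂ) + 1) / 2) =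
          t ^ (-((n : ℂ) - (i : ℂ)) / 2) *
          t ^ ((((n + 1 : ℕ) : ℂ) + 1) * (2 * ((i + 1 : ℕ) : ℂ) - ((n + 1 : ℕ) : ℂ)) / 4) := by
        simp only [← Complex.cpow_add _ _ ht]
        congr 1; push_cast [hin]; ring
      rw [Nat.add_sub_add_right, pow_succ, hA, hB]
      linear_combination (qbinom t n i * A ^ i * A * B ^ (n - i)) * this
    have e2 : ∑ i ∈ Finset.range (n + 1), qbinom t n i * (A * t ^ (1 / 2 : ℂ)) ^ i *
          (B * t ^ (-1 / 2 : ℂ)) ^ (n - i) *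
        t ^ (((n : ℂ) + 1) * (2 * i - n) / 4) * (B * t ^ (-(((0 : ℕ) : ℂ) + 1) / 2)) =
        ∑ x ∈ Finset.range (n + 1 + 1), t ^ ((x : ℂ) / 2) * qbinom t n x * A ^ x *
          B ^ (n + 1 - x) *
          t ^ ((((n + 1 : ℕ) : ℂ) + 1) * (2 * (x : ℂ) - ((n + 1 : ℕ) : ℂ)) / 4) := by
      rw [Finset.sum_range_succ _ (n + 1), qbinom_of_lt t (Nat.lt_succ_self n)]
      simp only [mul_zero, zero_mul, add_zero]
      refine Finset.sum_congr rfl fun i hi => ?_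
      have hin : i ≤ n := by simpa [Nat.lt_succ_iff] using hi
      have : t ^ ((i : ℂ) / 2) * t ^ (-((n - i : ℕ) : ℂ) / 2) *
          t ^ (((n : ℂ) + 1) * (2 * i - n) / 4) * t ^ (-(((0 : ℕ) : ℂ) + 1) / 2) =
          t ^ ((i : ℂ) / 2) *
          t ^ ((((n + 1 : ℕ) : ℂ) + 1) * (2 * (i : ℂ) - ((n + 1 : ℕ) : ℂ)) / 4) := by
        simp only [← Complex.cpow_add _ _ ht]
        congr 1; push_cast [hin]; ring
      rw [Nat.succ_sub hin, pow_succ, hA, hB]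
      linear_combination (qbinom t n i * A ^ i * B * B ^ (n - i)) * this
    rw [e1, e2, Finset.sum_range_succ' _ (n + 1)]
    simp only [qbinom_zero_right, qbinom_succ_succ, add_mul, Finset.sum_add_distrib]
    push_cast
    simp
    ring

/-! ### The R-matrices commute with the raising operator -/

/-- The raising operator of the `N`-dimensional representation, acting on rows. -/
def raiseMatrix (N : ℕ) (t : ℂ) : Matrix (Fin N) (Fin N) ℂ :=
  fun i j => if (j : ℕ) = i + 1 then brace t (i + 1) else 0

/-- The diagonal matrix `t^{wt/2}`. -/
def cartan (N : ℕ) (t : ℂ) : Matrix (Fin N) (Fin N) ℂ :=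
  Matrix.diagonal fun i => t ^ (weight N i / 2)

/-- The diagonal matrix `t^{-wt/2}`. -/
def cartanInv (N : ℕ) (t : ℂ) : Matrix (Fin N) (Fin N) ℂ :=
  Matrix.diagonal fun i => t ^ (-weight N i / 2)

/-- The coproduct of the raising operator. -/
def raiseCoprod (N : ℕ) (t : ℂ) : Matrix (Fin N × Fin N) (Fin N × Fin N) ℂ :=
  raiseMatrix N t ⊗ₖ cartan N t + cartanInv N t ⊗ₖ raiseMatrix N t

/-- The truncated `y - 1` is harmless at `y = 0`, since `{0} = 0` kills the term. -/
theorem sum_mul_raiseMatrix (N : ℕ) (t : ℂ) (g : ℕ → ℂ) (y : Fin N) :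
    ∑ z : Fin N, g z * raiseMatrix N t z y = g (y - 1) * brace t y := by
  obtain ⟨y, hy⟩ := y
  rcases y with _ | y
  · simp [raiseMatrix, brace_zero]
  · rw [Finset.sum_eq_single (⟨y, by omega⟩ : Fin N)]
    · simp [raiseMatrix]
    · intro b _ hb
      have : ¬ (y + 1 = (b : ℕ) + 1) := fun h => hb (Fin.ext (by simp; omega))
      simp [raiseMatrix]
      intro h; omega
    · simp

theorem sum_raiseMatrix_mul (N : ℕ) (t : ℂ) (g : ℕ → ℂ) (x : Fin N) :
    ∑ z : Fin N, raiseMatrix N t x z * g z =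
      if (x : ℕ) + 1 < N then brace t (x + 1) * g (x + 1) else 0 := by
  obtain ⟨x, hx⟩ := x
  split_ifs with h
  · rw [Finset.sum_eq_single (⟨x + 1, h⟩ : Fin N)]
    · simp [raiseMatrix]
    · intro b _ hb
      simp only [raiseMatrix]
      rw [if_neg (fun h => hb (Fin.ext h)), zero_mul]
    · simp
  · refine Finset.sum_eq_zero fun b _ => ?_
    have := b.2
    simp only [raiseMatrix] at *
    rw [if_neg (by omega), zero_mul]

theorem mul_raiseCoprod_apply {N : ℕ} (t : ℂ) {A : Matrix (Fin N × Fin N) (Fin N × Fin N) ℂ}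
    {r : ℕ → ℕ → ℕ → ℕ → ℂ} (hA : ∀ x y, A x y = r x.1 x.2 y.1 y.2) (i j k l : Fin N) :
    (A * raiseCoprod N t) (i, j) (k, l) =
      r i j (k - 1) l * brace t k * t ^ (weight N l / 2) +
      r i j k (l - 1) * brace t l * t ^ (-weight N k / 2) := by
  simp only [Matrix.mul_apply, raiseCoprod, Matrix.add_apply, Matrix.kroneckerMap_apply, mul_add,
    Finset.sum_add_distrib, Fintype.sum_prod_type, hA]
  congr 1
  · rw [← sum_mul_raiseMatrix N t (fun z => r i j z l) k, Finset.sum_mul]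
    refine Finset.sum_congr rfl fun z _ => ?_
    rw [Finset.sum_eq_single l]
    · simp [cartan, mul_assoc]
    · intro b _ hb; simp [cartan, hb]
    · simp
  · rw [← sum_mul_raiseMatrix N t (fun z => r i j k z) l, Finset.sum_mul, Finset.sum_eq_single k]
    · refine Finset.sum_congr rfl fun z _ => ?_
      simp [cartanInv]; ring
    · intro b _ hb; simp [cartanInv, hb]
    · simp

theorem raiseCoprod_mul_apply {N : ℕ} (t : ℂ) {A : Matrix (Fin N × Fin N) (Fin N × Fin N) ℂ}
    {r : ℕ → ℕ → ℕ → ℕ → ℂ} (hA : ∀ x y, A x y = r x.1 x.2 y.1 y.2) (i j k l : Fin N) :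
    (raiseCoprod N t * A) (i, j) (k, l) =
      (if (i : ℕ) + 1 < N then brace t (i + 1) * r (i + 1) j k l else 0) * t ^ (weight N j / 2) +
      (if (j : ℕ) + 1 < N then brace t (j + 1) * r i (j + 1) k l else 0) *
        t ^ (-weight N i / 2) := by
  simp only [Matrix.mul_apply, raiseCoprod, Matrix.add_apply, Matrix.kroneckerMap_apply, add_mul,
    Finset.sum_add_distrib, Fintype.sum_prod_type, hA]
  congr 1
  · rw [← sum_raiseMatrix_mul N t (fun z => r z j k l) i, Finset.sum_mul]
    refine Finset.sum_congr rfl fun z _ => ?_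
    rw [Finset.sum_eq_single j]
    · simp [cartan]; ring
    · intro b _ hb; simp [cartan, hb.symm]
    · simp
  · rw [← sum_raiseMatrix_mul N t (fun z => r i z k l) j, Finset.sum_mul, Finset.sum_eq_single i]
    · refine Finset.sum_congr rfl fun z _ => ?_
      simp [cartanInv]; ring
    · intro b _ hb; simp [cartanInv, hb.symm]
    · simp

/-- The entries of the `R`-matrix, as a function of natural numbers. -/
def rEntry (N : ℕ) (t : ℂ) (i j k l : ℕ) : ℂ :=
  if i + j = k + l ∧ i ≤ l then
    qbinom t l (l - i) * braceRising t (N - 1 - j) (l - i) *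
      t ^ (weight N i * weight N j - ((l - i : ℕ) : ℂ) * ((i : ℂ) - (j : ℂ)) / 2
            - ((l - i : ℕ) : ℂ) * (((l - i : ℕ) : ℂ) + 1) / 4)
  else 0

/-- The entries of the inverse `R`-matrix, as a function of natural numbers. -/
def rInvEntry (N : ℕ) (t : ℂ) (i j k l : ℕ) : ℂ :=
  if i + j = k + l ∧ l ≤ i then
    (-1) ^ (i - l) * qbinom t k (i - l) * braceRising t (N - 1 - i) (i - l) *
      t ^ (-(weight N i * weight N j) - ((i - l : ℕ) : ℂ) * ((i : ℂ) - (j : ℂ)) / 2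
            + ((i - l : ℕ) : ℂ) * (((i - l : ℕ) : ℂ) + 1) / 4)
  else 0

theorem rMatrix_apply (N : ℕ) (t : ℂ) (x y : Fin N × Fin N) :
    rMatrix N t x y = rEntry N t x.1 x.2 y.1 y.2 := rfl

theorem rMatrixInv_apply (N : ℕ) (t : ℂ) (x y : Fin N × Fin N) :
    rMatrixInv N t x y = rInvEntry N t x.1 x.2 y.1 y.2 := rfl

theorem rEntry_eq_zero {N : ℕ} {t : ℂ} {i j k l : ℕ} (h : ¬ (i + j = k + l ∧ i ≤ l)) :
    rEntry N t i j k l = 0 := if_neg h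

theorem rInvEntry_eq_zero {N : ℕ} {t : ℂ} {i j k l : ℕ} (h : ¬ (i + j = k + l ∧ l ≤ i)) :
    rInvEntry N t i j k l = 0 := if_neg h

theorem rEntry_add (N : ℕ) (t : ℂ) (i k m : ℕ) :
    rEntry N t i (k + m) k (i + m) = qbinom t (i + m) m * braceRising t (N - 1 - (k + m)) m *
      t ^ (weight N i * weight N (k + m : ℕ) - (m : ℂ) * ((i : ℂ) - ((k + m : ℕ) : ℂ)) / 2
            - (m : ℂ) * ((m : ℂ) + 1) / 4) := by
  rw [rEntry, if_pos ⟨by ring, by omega⟩, Nat.add_sub_cancel_left]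

theorem rInvEntry_add (N : ℕ) (t : ℂ) (j l m : ℕ) :
    rInvEntry N t (l + m) j (j + m) l =
      (-1) ^ m * qbinom t (j + m) m * braceRising t (N - 1 - (l + m)) m *
      t ^ (-(weight N (l + m : ℕ) * weight N j) - (m : ℂ) * (((l + m : ℕ) : ℂ) - (j : ℂ)) / 2
            + (m : ℂ) * ((m : ℂ) + 1) / 4) := by
  rw [rInvEntry, if_pos ⟨by ring, by omega⟩, Nat.add_sub_cancel_left]

/-- Both sides live on entries with `i + j + 1 = k + l` and `i ≤ l`. There each side is a sum of two
terms, and all four share a binomial and a rising product up to ratios of quantum integers. -/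
theorem rMatrix_mul_raiseCoprod {t : ℂ} (ht : Generic t) (N : ℕ) :
    rMatrix N t * raiseCoprod N t = raiseCoprod N t * rMatrix N t := by
  ext ⟨i, j⟩ ⟨k, l⟩
  rw [mul_raiseCoprod_apply t (rMatrix_apply N t), raiseCoprod_mul_apply t (rMatrix_apply N t)]
  obtain ⟨i, hi⟩ := i
  obtain ⟨j, hj⟩ := j
  obtain ⟨k, hk⟩ := k
  obtain ⟨l, hl⟩ := l
  dsimp only
  by_cases hsum : i + j + 1 = k + l ∧ i ≤ l
  · obtain ⟨hs, hil⟩ := hsum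
    obtain ⟨m, rfl⟩ := Nat.exists_eq_add_of_le hil
    rcases m with _ | m
    · obtain rfl : k = j + 1 := by omega
      have h2 : rEntry N t i j (j + 1) (i + 0 - 1) * brace t (i + 0) = 0 := by
        rcases i with _ | i
        · simp [brace_zero]
        · rw [rEntry_eq_zero (by omega), zero_mul]
      have h1 := rEntry_add N t i j 0
      have h4 := rEntry_add N t i (j + 1) 0
      simp only [add_zero] at h1 h2 h4 ⊢
      rw [h2, if_pos hk, Nat.add_sub_cancel, h1, h4, rEntry_eq_zero (i := i + 1) (by omega)]
      simp only [qbinom_zero_right, braceRising_zero, mul_zero, zero_mul, ite_self, zero_add,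
        add_zero, one_mul]
      rw [mul_right_comm, mul_comm _ (brace t (j + 1)), ← Complex.cpow_add _ _ ht.ne_zero,
        mul_assoc, ← Complex.cpow_add _ _ ht.ne_zero]
      simp only [weight]
      push_cast
      ring_nf
    -- Here `l - i` is `m + 1`, and `n` stands for `N - 1 - j`, the number of basis vectors above
    -- `e_j`.
    · obtain rfl : j = k + m := by omega
      obtain ⟨n, rfl⟩ : ∃ n, N = n + 1 + (k + m) := ⟨N - 1 - (k + m), by omega⟩
      set N := n + 1 + (k + m) with hN
      have hn : N - 1 - (k + m) = n := by omega
      have h1 : rEntry N t i (k + m) (k - 1) (i + (m + 1)) * brace t k =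
          qbinom t (i + (m + 1)) (m + 1) * braceRising t n (m + 1) *
          t ^ (weight N i * weight N (k + m : ℕ) -
            ((m + 1 : ℕ) : ℂ) * ((i : ℂ) - ((k + m : ℕ) : ℂ)) / 2
            - ((m + 1 : ℕ) : ℂ) * (((m + 1 : ℕ) : ℂ) + 1) / 4) * brace t k := by
        rcases k with _ | k
        · simp [brace_zero]
        · have := rEntry_add N t i k (m + 1)
          rw [show k + (m + 1) = k + 1 + m by ring, hn] at this
          rw [Nat.add_sub_cancel, this]
      have h2 := rEntry_add N t i k m
      have h3 := rEntry_add N t (i + 1) k m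
      have h4 : (if k + m + 1 < N then brace t (k + m + 1) *
          rEntry N t i (k + m + 1) k (i + (m + 1)) else 0) = brace t (k + m + 1) *
          (qbinom t (i + (m + 1)) (m + 1) * (brace t n * braceRising t n m) *
          t ^ (weight N i * weight N (k + m + 1 : ℕ) -
            ((m + 1 : ℕ) : ℂ) * ((i : ℂ) - ((k + m + 1 : ℕ) : ℂ)) / 2
            - ((m + 1 : ℕ) : ℂ) * (((m + 1 : ℕ) : ℂ) + 1) / 4)) := by
        rcases n with _ | n
        · rw [if_neg (by omega)]; simp [brace_zero]
        · have := rEntry_add N t i k (m + 1)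
          rw [show N - 1 - (k + (m + 1)) = n by omega, ← add_assoc] at this
          rw [if_pos (by omega), this, braceRising_succ_left]
      rw [hn] at h2 h3
      rw [h1, h4, if_pos (by omega), show i + (m + 1) - 1 = i + m by omega, h2,
        show i + (m + 1) = i + 1 + m by ring, h3, braceRising_succ,
        show i + 1 + m = i + (m + 1) by ring]
      have a1 := brace_mul_qbinom_succ ht i m
      have a2 := brace_mul_qbinom_succ' ht i m
      rw [show i + 1 + m = i + (m + 1) by ring] at a2
      rw [show i + m + 1 = i + (m + 1) by ring] at a1
      -- With the common binomial and rising product removed, an identity between sums of powers of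
      -- `t` remains. The relations `a1` and `a2` bring the neighbouring binomials to the common
      -- one.
      have key : t ^ (weight N i * weight N (k + m : ℕ) -
            ((m + 1 : ℕ) : ℂ) * ((i : ℂ) - ((k + m : ℕ) : ℂ)) / 2
            - ((m + 1 : ℕ) : ℂ) * (((m + 1 : ℕ) : ℂ) + 1) / 4) * brace t (n + m + 1) * brace t k *
            t ^ (weight N (i + (m + 1) : ℕ) / 2) +
          brace t (m + 1) * t ^ (weight N i * weight N (k + m : ℕ) -
            (m : ℂ) * ((i : ℂ) - ((k + m : ℕ) : ℂ)) / 2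
            - (m : ℂ) * ((m : ℂ) + 1) / 4) * t ^ (-weight N k / 2) =
          brace t (m + 1) * t ^ (weight N (i + 1 : ℕ) * weight N (k + m : ℕ) -
            (m : ℂ) * (((i + 1 : ℕ) : ℂ) - ((k + m : ℕ) : ℂ)) / 2
            - (m : ℂ) * ((m : ℂ) + 1) / 4) * t ^ (weight N (k + m : ℕ) / 2) +
          brace t (k + m + 1) * brace t n * t ^ (weight N i * weight N (k + m + 1 : ℕ) -
            ((m + 1 : ℕ) : ℂ) * ((i : ℂ) - ((k + m + 1 : ℕ) : ℂ)) / 2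
            - ((m + 1 : ℕ) : ℂ) * (((m + 1 : ℕ) : ℂ) + 1) / 4) * t ^ (-weight N i / 2) := by
        simp only [brace, mul_sub, sub_mul, ← Complex.cpow_add _ _ ht.ne_zero]
        simp only [weight, hN]
        push_cast
        ring_nf
      linear_combination qbinom t (i + (m + 1)) (m + 1) * braceRising t n m * key -
        braceRising t n m * t ^ (weight N i * weight N (k + m : ℕ) -
            (m : ℂ) * ((i : ℂ) - ((k + m : ℕ) : ℂ)) / 2
            - (m : ℂ) * ((m : ℂ) + 1) / 4) * t ^ (-weight N k / 2) * a1 +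
        braceRising t n m * t ^ (weight N (i + 1 : ℕ) * weight N (k + m : ℕ) -
            (m : ℂ) * (((i + 1 : ℕ) : ℂ) - ((k + m : ℕ) : ℂ)) / 2
            - (m : ℂ) * ((m : ℂ) + 1) / 4) * t ^ (weight N (k + m : ℕ) / 2) * a2
  · have h1 : rEntry N t i j (k - 1) l * brace t k = 0 := by
      rcases k with _ | k
      · simp [brace_zero]
      · rw [rEntry_eq_zero (by omega), zero_mul]
    have h2 : rEntry N t i j k (l - 1) * brace t l = 0 := by
      rcases l with _ | l
      · simp [brace_zero]
      · rw [rEntry_eq_zero (by omega), zero_mul]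
    rw [h1, h2, rEntry_eq_zero (i := i + 1) (by omega), rEntry_eq_zero (j := j + 1) (by omega)]
    simp

/-- The same computation as for `R`, with the roles of the two factors exchanged and signs `(-1)^m`.
Proving it directly avoids having to show that this matrix inverts `R`. -/
theorem rMatrixInv_mul_raiseCoprod {t : ℂ} (ht : Generic t) (N : ℕ) :
    rMatrixInv N t * raiseCoprod N t = raiseCoprod N t * rMatrixInv N t := by
  ext ⟨i, j⟩ ⟨k, l⟩
  rw [mul_raiseCoprod_apply t (rMatrixInv_apply N t),
    raiseCoprod_mul_apply t (rMatrixInv_apply N t)]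
  obtain ⟨i, hi⟩ := i
  obtain ⟨j, hj⟩ := j
  obtain ⟨k, hk⟩ := k
  obtain ⟨l, hl⟩ := l
  dsimp only
  by_cases hsum : i + j + 1 = k + l ∧ j ≤ k
  · obtain ⟨hs, hjk⟩ := hsum
    obtain ⟨m, rfl⟩ := Nat.exists_eq_add_of_le hjk
    rcases m with _ | m
    · obtain rfl : l = i + 1 := by omega
      have h2 : rInvEntry N t i j (j + 0 - 1) (i + 1) * brace t (j + 0) = 0 := by
        rcases j with _ | j
        · simp [brace_zero]
        · rw [rInvEntry_eq_zero (by omega), zero_mul]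
      have h1 := rInvEntry_add N t j i 0
      have h4 := rInvEntry_add N t j (i + 1) 0
      simp only [add_zero] at h1 h2 h4 ⊢
      rw [h2, if_pos hl, Nat.add_sub_cancel, h1, h4, rInvEntry_eq_zero (j := j + 1) (by omega)]
      simp only [qbinom_zero_right, braceRising_zero, mul_zero, zero_mul, ite_self, zero_add,
        add_zero, one_mul, pow_zero]
      rw [mul_right_comm, mul_comm _ (brace t (i + 1)), ← Complex.cpow_add _ _ ht.ne_zero,
        mul_assoc, ← Complex.cpow_add _ _ ht.ne_zero]
      simp only [weight]
      push_cast
      ring_nf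
    · obtain rfl : i = l + m := by omega
      obtain ⟨n, rfl⟩ : ∃ n, N = n + 1 + (l + m) := ⟨N - 1 - (l + m), by omega⟩
      set N := n + 1 + (l + m) with hN
      have hn : N - 1 - (l + m) = n := by omega
      have h1 : rInvEntry N t (l + m) j (j + (m + 1)) (l - 1) * brace t l =
          (-1) ^ (m + 1) * qbinom t (j + (m + 1)) (m + 1) * braceRising t n (m + 1) *
          t ^ (-(weight N (l + m : ℕ) * weight N j) -
            ((m + 1 : ℕ) : ℂ) * (((l + m : ℕ) : ℂ) - (j : ℂ)) / 2
            + ((m + 1 : ℕ) : ℂ) * (((m + 1 : ℕ) : ℂ) + 1) / 4) * brace t l := by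
        rcases l with _ | l
        · simp [brace_zero]
        · have := rInvEntry_add N t j l (m + 1)
          rw [show l + (m + 1) = l + 1 + m by ring, hn] at this
          rw [Nat.add_sub_cancel, this]
      have h2 := rInvEntry_add N t j l m
      have h3 := rInvEntry_add N t (j + 1) l m
      have h4 : (if l + m + 1 < N then brace t (l + m + 1) *
          rInvEntry N t (l + m + 1) j (j + (m + 1)) l else 0) = brace t (l + m + 1) *
          ((-1) ^ (m + 1) * qbinom t (j + (m + 1)) (m + 1) * (brace t n * braceRising t n m) *
          t ^ (-(weight N (l + m + 1 : ℕ) * weight N j) -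
            ((m + 1 : ℕ) : ℂ) * (((l + m + 1 : ℕ) : ℂ) - (j : ℂ)) / 2
            + ((m + 1 : ℕ) : ℂ) * (((m + 1 : ℕ) : ℂ) + 1) / 4)) := by
        rcases n with _ | n
        · rw [if_neg (by omega)]; simp [brace_zero]
        · have := rInvEntry_add N t j l (m + 1)
          rw [show N - 1 - (l + (m + 1)) = n by omega, ← add_assoc] at this
          rw [if_pos (by omega), this, braceRising_succ_left]
      rw [hn] at h2 h3
      rw [h1, h4, if_pos (by omega), show j + (m + 1) - 1 = j + m by omega, h2,
        show j + (m + 1) = j + 1 + m by ring, h3, braceRising_succ,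
        show j + 1 + m = j + (m + 1) by ring]
      have a1 := brace_mul_qbinom_succ ht j m
      have a2 := brace_mul_qbinom_succ' ht j m
      rw [show j + 1 + m = j + (m + 1) by ring] at a2
      rw [show j + m + 1 = j + (m + 1) by ring] at a1
      have key : -(t ^ (-(weight N (l + m : ℕ) * weight N j) -
            ((m + 1 : ℕ) : ℂ) * (((l + m : ℕ) : ℂ) - (j : ℂ)) / 2
            + ((m + 1 : ℕ) : ℂ) * (((m + 1 : ℕ) : ℂ) + 1) / 4) * brace t (n + m + 1) *
            brace t l * t ^ (-weight N (j + (m + 1) : ℕ) / 2)) +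
          brace t (m + 1) * t ^ (-(weight N (l + m : ℕ) * weight N j) -
            (m : ℂ) * (((l + m : ℕ) : ℂ) - (j : ℂ)) / 2
            + (m : ℂ) * ((m : ℂ) + 1) / 4) * t ^ (weight N l / 2) =
          brace t (m + 1) * t ^ (-(weight N (l + m : ℕ) * weight N (j + 1 : ℕ)) -
            (m : ℂ) * (((l + m : ℕ) : ℂ) - ((j + 1 : ℕ) : ℂ)) / 2
            + (m : ℂ) * ((m : ℂ) + 1) / 4) * t ^ (-weight N (l + m : ℕ) / 2) -
          brace t (l + m + 1) * brace t n * t ^ (-(weight N (l + m + 1 : ℕ) * weight N j) -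
            ((m + 1 : ℕ) : ℂ) * (((l + m + 1 : ℕ) : ℂ) - (j : ℂ)) / 2
            + ((m + 1 : ℕ) : ℂ) * (((m + 1 : ℕ) : ℂ) + 1) / 4) * t ^ (weight N j / 2) := by
        simp only [brace, mul_sub, sub_mul, ← Complex.cpow_add _ _ ht.ne_zero]
        simp only [weight, hN]
        push_cast
        ring_nf
      linear_combination (-1) ^ m * qbinom t (j + (m + 1)) (m + 1) * braceRising t n m * key -
        (-1) ^ m * braceRising t n m * t ^ (-(weight N (l + m : ℕ) * weight N j) -
            (m : ℂ) * (((l + m : ℕ) : ℂ) - (j : ℂ)) / 2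
            + (m : ℂ) * ((m : ℂ) + 1) / 4) * t ^ (weight N l / 2) * a1 +
        (-1) ^ m * braceRising t n m * t ^ (-(weight N (l + m : ℕ) * weight N (j + 1 : ℕ)) -
            (m : ℂ) * (((l + m : ℕ) : ℂ) - ((j + 1 : ℕ) : ℂ)) / 2
            + (m : ℂ) * ((m : ℂ) + 1) / 4) * t ^ (-weight N (l + m : ℕ) / 2) * a2
  · have h1 : rInvEntry N t i j (k - 1) l * brace t k = 0 := by
      rcases k with _ | k
      · simp [brace_zero]
      · rw [rInvEntry_eq_zero (by omega), zero_mul]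
    have h2 : rInvEntry N t i j k (l - 1) * brace t l = 0 := by
      rcases l with _ | l
      · simp [brace_zero]
      · rw [rInvEntry_eq_zero (by omega), zero_mul]
    rw [h1, h2, rInvEntry_eq_zero (i := i + 1) (by omega),
      rInvEntry_eq_zero (j := j + 1) (by omega)]
    simp

/-! ### Partial quantum traces of intertwiners -/

/-- The partial trace over the second factor, with weights `u`. -/
def partialTrace {m n : Type*} [Fintype n] (u : n → ℂ) (B : Matrix (m × n) (m × n) ℂ) :
    Matrix m m ℂ :=
  fun a b => ∑ c, B (a, c) (b, c) * u c

/-- If `B` preserves the grading and commutes with the coproduct of the raising operator, then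
its partial quantum trace commutes with the raising operator on the remaining factor. -/
theorem partialTrace_mul_comm {m n : Type*} [Fintype m] [DecidableEq m] [Fintype n] [DecidableEq n]
    {B : Matrix (m × n) (m × n) ℂ} {E₁ : Matrix m m ℂ} {E : Matrix n n ℂ}
    {L : m → ℂ} {K W u : n → ℂ}
    (hB : B * (E₁ ⊗ₖ Matrix.diagonal K + Matrix.diagonal L ⊗ₖ E) =
      (E₁ ⊗ₖ Matrix.diagonal K + Matrix.diagonal L ⊗ₖ E) * B)
    (hu : ∀ c, u c = K c * W c)
    (hw : ∀ a b c c', E c' c ≠ 0 → B (a, c) (b, c') ≠ 0 → L b * W c = L a * W c') :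
    partialTrace u B * E₁ = E₁ * partialTrace u B := by
  ext a b
  have h1 : ∀ c, (B * (E₁ ⊗ₖ Matrix.diagonal K + Matrix.diagonal L ⊗ₖ E)) (a, c) (b, c) =
      (∑ a', B (a, c) (a', c) * E₁ a' b) * K c + ∑ c', B (a, c) (b, c') * L b * E c' c := by
    intro c
    rw [mul_add, Matrix.add_apply]
    simp only [Matrix.mul_apply, Matrix.kroneckerMap_apply, Fintype.sum_prod_type]
    congr 1
    · rw [Finset.sum_mul]
      refine Finset.sum_congr rfl fun a' _ => ?_
      rw [Finset.sum_eq_single c]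
      · simp [mul_assoc]
      · intro x _ hx; simp [hx]
      · simp
    · rw [Finset.sum_eq_single b]
      · simp [mul_assoc]
      · intro x _ hx; simp [hx]
      · simp
  have h2 : ∀ c, ((E₁ ⊗ₖ Matrix.diagonal K + Matrix.diagonal L ⊗ₖ E) * B) (a, c) (b, c) =
      (∑ a', E₁ a a' * B (a', c) (b, c)) * K c + ∑ c', L a * E c c' * B (a, c') (b, c) := by
    intro c
    rw [add_mul, Matrix.add_apply]
    simp only [Matrix.mul_apply, Matrix.kroneckerMap_apply, Fintype.sum_prod_type]
    congr 1
    · rw [Finset.sum_mul]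
      refine Finset.sum_congr rfl fun a' _ => ?_
      rw [Finset.sum_eq_single c]
      · simp; ring
      · intro x _ hx; simp [hx.symm]
      · simp
    · rw [Finset.sum_eq_single a]
      · simp
      · intro x _ hx; simp [hx.symm]
      · simp
  -- Cyclicity of the trace: interchanging `c` and `c'` matches the terms in which `E` acts on the
  -- traced factor, the weights agreeing by `hw`. These terms therefore cancel, and only those with
  -- `E₁` remain.
  have h3 : ∑ c, (∑ c', B (a, c) (b, c') * L b * E c' c) * W c =
      ∑ c, (∑ c', L a * E c c' * B (a, c') (b, c)) * W c := by
    simp only [Finset.sum_mul]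
    rw [Finset.sum_comm]
    refine Finset.sum_congr rfl fun c' _ => Finset.sum_congr rfl fun c _ => ?_
    by_cases hE : E c' c = 0
    · simp [hE]
    by_cases hb : B (a, c) (b, c') = 0
    · simp [hb]
    linear_combination (B (a, c) (b, c') * E c' c) * hw a b c c' hE hb
  have h4 : ∑ c, ((∑ a', B (a, c) (a', c) * E₁ a' b) * K c) * W c =
      ∑ c, ((∑ a', E₁ a a' * B (a', c) (b, c)) * K c) * W c := by
    have : ∑ c, ((∑ a', B (a, c) (a', c) * E₁ a' b) * K c +
          ∑ c', B (a, c) (b, c') * L b * E c' c) * W c =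
        ∑ c, ((∑ a', E₁ a a' * B (a', c) (b, c)) * K c +
          ∑ c', L a * E c c' * B (a, c') (b, c)) * W c :=
      Finset.sum_congr rfl fun c _ => by rw [← h1, ← h2, hB]
    simp only [add_mul _ _ (W _), Finset.sum_add_distrib] at this
    rw [h3] at this
    exact add_right_cancel this
  simp only [Matrix.mul_apply, partialTrace, Finset.sum_mul, Finset.mul_sum, hu] at h4 ⊢
  rw [Finset.sum_comm, Finset.sum_comm (f := fun a' c => E₁ a a' * _)]
  calc _ = ∑ c, ∑ a', B (a, c) (a', c) * E₁ a' b * K c * W c :=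
        Finset.sum_congr rfl fun c _ => Finset.sum_congr rfl fun a' _ => by ring
    _ = ∑ c, ∑ a', E₁ a a' * B (a', c) (b, c) * K c * W c := h4
    _ = _ := Finset.sum_congr rfl fun c _ => Finset.sum_congr rfl fun a' _ => by ring

/-- `B` preserves the total grading. -/
def Graded {m : Type*} (w : m → ℕ) (B : Matrix m m ℂ) : Prop :=
  ∀ x y, B x y ≠ 0 → w x = w y

theorem Graded.mul {m : Type*} [Fintype m] {w : m → ℕ} {A B : Matrix m m ℂ} (hA : Graded w A)
    (hB : Graded w B) : Graded w (A * B) := by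
  intro x y h
  obtain ⟨z, -, hz⟩ := Finset.exists_ne_zero_of_sum_ne_zero h
  exact (hA x z (left_ne_zero_of_mul hz)).trans (hB z y (right_ne_zero_of_mul hz))

theorem Graded.partialTrace {m n : Type*} [Fintype n] {w : m → ℕ} {v : n → ℕ}
    {B : Matrix (m × n) (m × n) ℂ} (hB : Graded (fun x => w x.1 + v x.2) B) (u : n → ℂ) :
    Graded w (partialTrace u B) := by
  intro x y h
  obtain ⟨z, -, hz⟩ := Finset.exists_ne_zero_of_sum_ne_zero h
  have := hB _ _ (left_ne_zero_of_mul hz)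
  simpa using this

theorem Graded.mul_diagonal {m : Type*} [Fintype m] [DecidableEq m] {w : m → ℕ}
    {B : Matrix m m ℂ} (hB : Graded w B) {f : m → ℂ} (hf : ∀ x y, w x = w y → f x = f y) :
    B * Matrix.diagonal f = Matrix.diagonal f * B := by
  ext x y
  rw [Matrix.mul_diagonal, Matrix.diagonal_mul]
  by_cases h : B x y = 0
  · simp [h]
  · rw [hf x y (hB x y h), mul_comm]

/-- The total grading on `V ⊗ V`. -/
def grade₂ (N : ℕ) (x : Fin N × Fin N) : ℕ := x.1 + x.2

/-- The total grading on `V ⊗ V ⊗ V`. -/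
def grade₃ (N : ℕ) (x : (Fin N × Fin N) × Fin N) : ℕ := grade₂ N x.1 + x.2

theorem graded_rMatrix (N : ℕ) (t : ℂ) : Graded (grade₂ N) (rMatrix N t) := by
  intro x y h
  by_contra h'
  exact h (by rw [rMatrix_apply]; exact rEntry_eq_zero fun h => h' h.1)

theorem graded_rMatrixInv (N : ℕ) (t : ℂ) : Graded (grade₂ N) (rMatrixInv N t) := by
  intro x y h
  by_contra h'
  exact h (by rw [rMatrixInv_apply]; exact rInvEntry_eq_zero fun h => h' h.1)

/-- The `3`-fold coproduct of the raising operator. -/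
def raiseCoprod₃ (N : ℕ) (t : ℂ) :
    Matrix ((Fin N × Fin N) × Fin N) ((Fin N × Fin N) × Fin N) ℂ :=
  raiseCoprod N t ⊗ₖ cartan N t + (cartanInv N t ⊗ₖ cartanInv N t) ⊗ₖ raiseMatrix N t

/-- The action of `A` on the first two factors of `V ⊗ V ⊗ V`. -/
def actLeft {N : ℕ} (A : Matrix (Fin N × Fin N) (Fin N × Fin N) ℂ) :
    Matrix ((Fin N × Fin N) × Fin N) ((Fin N × Fin N) × Fin N) ℂ :=
  A ⊗ₖ (1 : Matrix (Fin N) (Fin N) ℂ)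

/-- The action of `A` on the last two factors of `V ⊗ V ⊗ V`. -/
def actRight {N : ℕ} (A : Matrix (Fin N × Fin N) (Fin N × Fin N) ℂ) :
    Matrix ((Fin N × Fin N) × Fin N) ((Fin N × Fin N) × Fin N) ℂ :=
  ((1 : Matrix (Fin N) (Fin N) ℂ) ⊗ₖ A).submatrix (Equiv.prodAssoc _ _ _) (Equiv.prodAssoc _ _ _)

theorem Graded.actLeft {N : ℕ} {A : Matrix (Fin N × Fin N) (Fin N × Fin N) ℂ}
    (hA : Graded (grade₂ N) A) : Graded (grade₃ N) (actLeft A) := by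
  rintro ⟨x, c⟩ ⟨y, d⟩ h
  simp only [ColoredJones.actLeft, Matrix.kroneckerMap_apply] at h
  have h1 := hA _ _ (left_ne_zero_of_mul h)
  have h2 : c = d := by
    by_contra hcd
    exact right_ne_zero_of_mul h (Matrix.one_apply_ne hcd)
  simp [grade₃, h1, h2]

theorem Graded.actRight {N : ℕ} {A : Matrix (Fin N × Fin N) (Fin N × Fin N) ℂ}
    (hA : Graded (grade₂ N) A) : Graded (grade₃ N) (actRight A) := by
  rintro ⟨⟨a, b⟩, c⟩ ⟨⟨a', b'⟩, c'⟩ h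
  simp only [ColoredJones.actRight, Matrix.submatrix_apply, Equiv.prodAssoc_apply,
    Matrix.kroneckerMap_apply] at h
  have h1 := hA _ _ (right_ne_zero_of_mul h)
  have h2 : a = a' := by
    by_contra hcd
    exact left_ne_zero_of_mul h (Matrix.one_apply_ne hcd)
  simp only [grade₂] at h1
  simp only [grade₃, grade₂, h2]
  omega

theorem weight_add_congr {N : ℕ} {x y : Fin N × Fin N} (h : grade₂ N x = grade₂ N y) :
    weight N x.1 + weight N x.2 = weight N y.1 + weight N y.2 := by
  have : ((x.1 : ℕ) : ℂ) + ((x.2 : ℕ) : ℂ) = ((y.1 : ℕ) : ℂ) + ((y.2 : ℕ) : ℂ) := by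
    exact_mod_cast h
  simp only [weight]
  linear_combination this

/-- The grading supplies commutation with the diagonal part `K⁻¹ ⊗ K⁻¹` of the threefold coproduct,
where `K = t^{wt/2}`. -/
theorem actLeft_mul_raiseCoprod₃ {N : ℕ} {t : ℂ} (ht : t ≠ 0)
    {A : Matrix (Fin N × Fin N) (Fin N × Fin N) ℂ} (hA : Graded (grade₂ N) A)
    (h : A * raiseCoprod N t = raiseCoprod N t * A) :
    actLeft A * raiseCoprod₃ N t = raiseCoprod₃ N t * actLeft A := by
  have hK : A * (cartanInv N t ⊗ₖ cartanInv N t) = (cartanInv N t ⊗ₖ cartanInv N t) * A := by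
    rw [cartanInv, Matrix.diagonal_kronecker_diagonal]
    refine hA.mul_diagonal fun x y hxy => ?_
    rw [← Complex.cpow_add _ _ ht, ← Complex.cpow_add _ _ ht]
    congr 1
    linear_combination (-1 / 2 : ℂ) * weight_add_congr hxy
  rw [actLeft, raiseCoprod₃, mul_add, add_mul]
  simp only [← Matrix.mul_kronecker_mul, h, hK, Matrix.one_mul, Matrix.mul_one]

/-- Coassociativity: the other bracketing is the one adapted to operators on the last two strands.
-/
theorem raiseCoprod₃_eq (N : ℕ) (t : ℂ) : raiseCoprod₃ N t =
    (raiseMatrix N t ⊗ₖ (cartan N t ⊗ₖ cartan N t) + cartanInv N t ⊗ₖ raiseCoprod N t).submatrix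
      (Equiv.prodAssoc _ _ _) (Equiv.prodAssoc _ _ _) := by
  ext ⟨⟨a, b⟩, c⟩ ⟨⟨a', b'⟩, c'⟩
  simp only [raiseCoprod₃, raiseCoprod, Matrix.add_apply, Matrix.kroneckerMap_apply,
    Matrix.submatrix_apply, Equiv.prodAssoc_apply]
  ring

theorem actRight_mul_raiseCoprod₃ {N : ℕ} {t : ℂ} (ht : t ≠ 0)
    {A : Matrix (Fin N × Fin N) (Fin N × Fin N) ℂ} (hA : Graded (grade₂ N) A)
    (h : A * raiseCoprod N t = raiseCoprod N t * A) :
    actRight A * raiseCoprod₃ N t = raiseCoprod₃ N t * actRight A := by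
  have hK : A * (cartan N t ⊗ₖ cartan N t) = (cartan N t ⊗ₖ cartan N t) * A := by
    rw [cartan, Matrix.diagonal_kronecker_diagonal]
    refine hA.mul_diagonal fun x y hxy => ?_
    rw [← Complex.cpow_add _ _ ht, ← Complex.cpow_add _ _ ht]
    congr 1
    linear_combination (1 / 2 : ℂ) * weight_add_congr hxy
  rw [actRight, raiseCoprod₃_eq, Matrix.submatrix_mul_equiv, Matrix.submatrix_mul_equiv,
    mul_add, add_mul]
  simp only [← Matrix.mul_kronecker_mul, h, hK, Matrix.one_mul, Matrix.mul_one]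

theorem eq_add_one_of_raiseMatrix_ne_zero {N : ℕ} {t : ℂ} {c d : Fin N}
    (h : raiseMatrix N t c d ≠ 0) : (d : ℕ) = c + 1 := by
  by_contra h'
  exact h (if_neg h')

/-- The partial quantum trace over the last two factors commutes with the raising operator. -/
theorem partialTrace_partialTrace_mul_raiseMatrix {N : ℕ} {t : ℂ} (ht : t ≠ 0)
    {B : Matrix ((Fin N × Fin N) × Fin N) ((Fin N × Fin N) × Fin N) ℂ}
    (hB : Graded (grade₃ N) B) (h : B * raiseCoprod₃ N t = raiseCoprod₃ N t * B) :
    partialTrace (fun c : Fin N => t ^ weight N c) (partialTrace (fun c : Fin N => t ^ weight N c) B) *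
        raiseMatrix N t =
      raiseMatrix N t *
        partialTrace (fun c : Fin N => t ^ weight N c) (partialTrace (fun c : Fin N => t ^ weight N c) B) := by
  have hu : ∀ c : Fin N, t ^ weight N c = t ^ (weight N c / 2) * t ^ (weight N c / 2) := by
    intro c
    rw [← Complex.cpow_add _ _ ht, add_halves]
  have h₂ : partialTrace (fun c : Fin N => t ^ weight N c) B * raiseCoprod N t =
      raiseCoprod N t * partialTrace (fun c : Fin N => t ^ weight N c) B := by
    rw [raiseCoprod₃, cartanInv, Matrix.diagonal_kronecker_diagonal] at h
    refine partialTrace_mul_comm h hu fun a b c c' hE hb => ?_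
    have h1 : ((c : ℕ) : ℂ) = (c' : ℕ) + 1 := by
      exact_mod_cast eq_add_one_of_raiseMatrix_ne_zero hE
    have h2 : ((a.1 : ℕ) : ℂ) + ((a.2 : ℕ) : ℂ) + ((c : ℕ) : ℂ) =
        ((b.1 : ℕ) : ℂ) + ((b.2 : ℕ) : ℂ) + ((c' : ℕ) : ℂ) := by
      exact_mod_cast hB _ _ hb
    simp only [← Complex.cpow_add _ _ ht]
    congr 1
    simp only [weight]
    linear_combination (1 / 2 : ℂ) * h2
  have hG : Graded (grade₂ N) (partialTrace (fun c : Fin N => t ^ weight N c) B) :=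
    Graded.partialTrace (v := fun c : Fin N => (c : ℕ)) hB _
  rw [raiseCoprod, cartanInv] at h₂
  refine partialTrace_mul_comm h₂ hu fun a b c c' hE hb => ?_
  have h2 : ((a : ℕ) : ℂ) + ((c : ℕ) : ℂ) = ((b : ℕ) : ℂ) + ((c' : ℕ) : ℂ) := by
    exact_mod_cast hG _ _ hb
  simp only [← Complex.cpow_add _ _ ht]
  congr 1
  simp only [weight]
  linear_combination (1 / 2 : ℂ) * h2

/-- Comparing the entries at `(a, a + 1)` gives `X_{aa} {a+1} = {a+1} X_{a+1,a+1}`, and genericity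
allows `{a+1}` to be cancelled. Only the constancy of the diagonal is needed, not that `X` is
scalar. -/
theorem apply_eq_of_mul_raiseMatrix_comm {N : ℕ} {t : ℂ} (ht : Generic t)
    {X : Matrix (Fin N) (Fin N) ℂ} (h : X * raiseMatrix N t = raiseMatrix N t * X)
    (a : ℕ) (h0 : 0 < N) (ha : a < N) : X ⟨a, ha⟩ ⟨a, ha⟩ = X ⟨0, h0⟩ ⟨0, h0⟩ := by
  induction a with
  | zero => rfl
  | succ a ih =>
    rw [← ih (by omega)]
    have h1 := congrFun (congrFun h ⟨a, by omega⟩) ⟨a + 1, ha⟩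
    rw [Matrix.mul_apply, Matrix.mul_apply, Finset.sum_eq_single (⟨a, by omega⟩ : Fin N),
      Finset.sum_eq_single (⟨a + 1, ha⟩ : Fin N)] at h1
    · simp only [raiseMatrix, if_true] at h1
      exact (mul_left_cancel₀ (ht.brace_ne_zero a) ((mul_comm _ _).trans h1)).symm
    · intro b _ hb
      simp only [raiseMatrix]
      rw [if_neg fun h => hb (Fin.ext h), zero_mul]
    · simp
    · intro b _ hb
      simp only [raiseMatrix]
      rw [if_neg fun h => hb (Fin.ext (by simp at h ⊢; omega)), mul_zero]
    · simp

/-! ### The state sum of the figure-eight knot -/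

/-- The identification of colorings of three strands with triples. -/
def tripleEquiv (N : ℕ) : (Fin N × Fin N) × Fin N ≃ (Fin (2 + 1) → Fin N) where
  toFun x := ![x.1.1, x.1.2, x.2]
  invFun f := ((f 0, f 1), f 2)
  left_inv _ := rfl
  right_inv f := by ext i; fin_cases i <;> rfl

theorem actAt_zero {N : ℕ} (A : Matrix (Fin N × Fin N) (Fin N × Fin N) ℂ) :
    (actAt A (0 : Fin 2)).submatrix (tripleEquiv N) (tripleEquiv N) = actLeft A := by
  ext ⟨⟨a, b⟩, c⟩ ⟨⟨a', b'⟩, c'⟩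
  simp only [Matrix.submatrix_apply, actAt, actLeft, Matrix.kroneckerMap_apply, Matrix.one_apply,
    Fin.forall_fin_succ]
  simp
  rfl

theorem actAt_one {N : ℕ} (A : Matrix (Fin N × Fin N) (Fin N × Fin N) ℂ) :
    (actAt A (1 : Fin 2)).submatrix (tripleEquiv N) (tripleEquiv N) = actRight A := by
  ext ⟨⟨a, b⟩, c⟩ ⟨⟨a', b'⟩, c'⟩
  simp only [Matrix.submatrix_apply, actAt, actRight, Matrix.kroneckerMap_apply, Matrix.one_apply,
    Fin.forall_fin_succ]
  simp
  rfl

/-- The matrix of the braid `σ₁ σ₂⁻¹ σ₁ σ₂⁻¹` on triples. -/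
def figureEightMatrix (N : ℕ) (t : ℂ) :
    Matrix ((Fin N × Fin N) × Fin N) ((Fin N × Fin N) × Fin N) ℂ :=
  actLeft (rMatrix N t) * actRight (rMatrixInv N t) *
    (actLeft (rMatrix N t) * actRight (rMatrixInv N t))

theorem braidMatrix_figureEight (N : ℕ) (t : ℂ) :
    (braidMatrix N t figureEight).submatrix (tripleEquiv N) (tripleEquiv N) =
      figureEightMatrix N t := by
  rw [figureEightMatrix, ← actAt_zero, ← actAt_one, Matrix.submatrix_mul_equiv,
    Matrix.submatrix_mul_equiv]
  simp [braidMatrix, figureEight, mul_assoc]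

theorem longKnotMatrix_figureEight (N : ℕ) (t : ℂ) :
    longKnotMatrix N t figureEight = partialTrace (fun c : Fin N => t ^ weight N c)
      (partialTrace (fun c : Fin N => t ^ weight N c) (figureEightMatrix N t)) := by
  ext a b
  rw [← braidMatrix_figureEight]
  simp only [longKnotMatrix, partialTrace, writhe, figureEight]
  -- The writhe is `0`, so the framing factor is `1`.
  simp only [List.map_cons, List.map_nil, List.sum_cons, List.sum_nil]
  norm_num
  rw [← (finTwoArrowEquiv (Fin N)).symm.sum_comp, Fintype.sum_prod_type]
  refine Finset.sum_congr rfl fun c _ => ?_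
  rw [Finset.sum_mul]
  refine Finset.sum_congr rfl fun d _ => ?_
  have : ∀ a : Fin N, (Fin.cons a ((finTwoArrowEquiv (Fin N)).symm (c, d)) : Fin 3 → Fin N) =
      tripleEquiv N ((a, c), d) := by
    intro a
    ext i; fin_cases i <;> rfl
  rw [this a, this b]
  simp [finTwoArrowEquiv]
  ring

theorem longKnotMatrix_figureEight_apply {N : ℕ} {t : ℂ} (ht : Generic t) (a : ℕ) (h0 : 0 < N)
    (ha : a < N) : longKnotMatrix N t figureEight ⟨a, ha⟩ ⟨a, ha⟩ =
      longKnotMatrix N t figureEight ⟨0, h0⟩ ⟨0, h0⟩ := by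
  refine apply_eq_of_mul_raiseMatrix_comm ht ?_ a h0 ha
  rw [longKnotMatrix_figureEight]
  have gL := (graded_rMatrix N t).actLeft
  have gR := (graded_rMatrixInv N t).actRight
  have cL := actLeft_mul_raiseCoprod₃ ht.ne_zero (graded_rMatrix N t) (rMatrix_mul_raiseCoprod ht N)
  have cR := actRight_mul_raiseCoprod₃ ht.ne_zero (graded_rMatrixInv N t)
    (rMatrixInv_mul_raiseCoprod ht N)
  refine partialTrace_partialTrace_mul_raiseMatrix ht.ne_zero ((gL.mul gR).mul (gL.mul gR)) ?_
  exact ((show Commute _ _ from cL).mul_left (show Commute _ _ from cR)).mul_left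
    ((show Commute _ _ from cL).mul_left (show Commute _ _ from cR))

theorem rMatrix_support {N : ℕ} {t : ℂ} {x y : Fin N × Fin N} (h : rMatrix N t x y ≠ 0) :
    (x.1 : ℕ) + x.2 = y.1 + y.2 ∧ (x.1 : ℕ) ≤ y.2 := by
  by_contra h'
  exact h (by rw [rMatrix_apply]; exact rEntry_eq_zero h')

theorem rMatrixInv_support {N : ℕ} {t : ℂ} {x y : Fin N × Fin N} (h : rMatrixInv N t x y ≠ 0) :
    (x.1 : ℕ) + x.2 = y.1 + y.2 ∧ (y.2 : ℕ) ≤ x.1 := by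
  by_contra h'
  exact h (by rw [rMatrixInv_apply]; exact rInvEntry_eq_zero h')

theorem actLeft_support {N : ℕ} {A : Matrix (Fin N × Fin N) (Fin N × Fin N) ℂ} {a b c a' b' c'}
    (h : actLeft A ((a, b), c) ((a', b'), c') ≠ 0) : A (a, b) (a', b') ≠ 0 ∧ c = c' := by
  simp only [actLeft, Matrix.kroneckerMap_apply] at h
  refine ⟨left_ne_zero_of_mul h, ?_⟩
  by_contra hcd
  exact right_ne_zero_of_mul h (Matrix.one_apply_ne hcd)

theorem actRight_support {N : ℕ} {A : Matrix (Fin N × Fin N) (Fin N × Fin N) ℂ} {a b c a' b' c'}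
    (h : actRight A ((a, b), c) ((a', b'), c') ≠ 0) : A (b, c) (b', c') ≠ 0 ∧ a = a' := by
  simp only [actRight, Matrix.kroneckerMap_apply, Matrix.submatrix_apply,
    Equiv.prodAssoc_apply] at h
  refine ⟨right_ne_zero_of_mul h, ?_⟩
  by_contra hcd
  exact left_ne_zero_of_mul h (Matrix.one_apply_ne hcd)

/-- `R` can only raise a color as it passes from the first position to the second. A strand already
at the top color must keep it, so the first `R` forces `(n, c) → (c, n)`; read backwards, the final
state forces the intermediate one to be `(c, n, d)`. A single path of states survives. -/
theorem figureEightMatrix_last (n : ℕ) (t : ℂ) (c d : Fin (n + 1)) :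
    figureEightMatrix (n + 1) t ((Fin.last n, c), d) ((Fin.last n, c), d) =
      rEntry (n + 1) t n c c n * rInvEntry (n + 1) t n d n d *
        (rEntry (n + 1) t c n n c * rInvEntry (n + 1) t c d c d) := by
  have hlast : ∀ x : Fin (n + 1), n ≤ (x : ℕ) → x = Fin.last n := fun x hx =>
    Fin.ext (le_antisymm (Nat.lt_succ_iff.mp x.2) hx)
  have h1 : ∀ v, (actLeft (rMatrix (n + 1) t) * actRight (rMatrixInv (n + 1) t))
      ((Fin.last n, c), d) v = rEntry (n + 1) t n c c n *
        actRight (rMatrixInv (n + 1) t) ((c, Fin.last n), d) v := by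
    intro v
    rw [Matrix.mul_apply, Finset.sum_eq_single ((c, Fin.last n), d)]
    · congr 1
      simp [actLeft, rMatrix_apply]
    · rintro ⟨⟨u, w⟩, z⟩ - hb
      by_contra h
      obtain ⟨h3, h4⟩ := actLeft_support (left_ne_zero_of_mul h)
      obtain ⟨h5, h6⟩ := rMatrix_support h3
      simp only [Fin.val_last] at h5 h6
      have h7 := hlast w h6
      subst h7
      refine hb ?_
      rw [h4, show u = c from Fin.ext (by simp at h5; omega)]
    · simp
  have h2 : (actLeft (rMatrix (n + 1) t) * actRight (rMatrixInv (n + 1) t))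
      ((c, Fin.last n), d) ((Fin.last n, c), d) =
        rEntry (n + 1) t c n n c * rInvEntry (n + 1) t c d c d := by
    rw [Matrix.mul_apply, Finset.sum_eq_single ((Fin.last n, c), d)]
    · simp [actLeft, actRight, rMatrix_apply, rMatrixInv_apply]
    · rintro ⟨⟨u, w⟩, z⟩ - hb
      by_contra h
      obtain ⟨h3, h4⟩ := actLeft_support (left_ne_zero_of_mul h)
      obtain ⟨h5, h6⟩ := actRight_support (right_ne_zero_of_mul h)
      obtain ⟨h7, h8⟩ := rMatrix_support h3
      subst h6
      refine hb ?_
      rw [h4, show w = c from Fin.ext (by simp at h7; omega)]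
    · simp
  rw [figureEightMatrix, Matrix.mul_apply, Finset.sum_eq_single ((c, Fin.last n), d)]
  · rw [h1, h2]
    congr 2
    simp [actRight, rMatrixInv_apply]
  · rintro ⟨⟨u, w⟩, z⟩ - hb
    rw [h1]
    by_contra h
    obtain ⟨h3, h4⟩ := actRight_support (right_ne_zero_of_mul (left_ne_zero_of_mul h))
    obtain ⟨⟨⟨u', w'⟩, z'⟩, -, h5⟩ := Finset.exists_ne_zero_of_sum_ne_zero (right_ne_zero_of_mul h)
    obtain ⟨h6, h7⟩ := actLeft_support (left_ne_zero_of_mul h5)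
    obtain ⟨h8, h9⟩ := actRight_support (right_ne_zero_of_mul h5)
    obtain ⟨h10, h11⟩ := rMatrix_support h6
    subst h9 h4
    have h12 := hlast w (by simp at h10 h11; omega)
    subst h12
    have h13 := (rMatrixInv_support h3).1
    refine hb ?_
    rw [show z = d from Fin.ext (by simp at h13; omega)]
  · simp

/-- The surviving states satisfy `d ≤ c ≤ n`, and are parametrized by `j = c - d` and `i = n - c`,
so that `d + i + j = n = N - 1`. -/
theorem figureEight_state {t : ℂ} (ht : Generic t) (d i j : ℕ) :
    rEntry (d + (i + j + 1)) t (d + (i + j)) (d + j) (d + j) (d + (i + j)) *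
      rInvEntry (d + (i + j + 1)) t (d + (i + j)) d (d + (i + j)) d *
      (rEntry (d + (i + j + 1)) t (d + j) (d + (i + j)) (d + (i + j)) (d + j) *
      rInvEntry (d + (i + j + 1)) t (d + j) d (d + j) d) *
      t ^ weight (d + (i + j + 1)) d * t ^ weight (d + (i + j + 1)) (d + j : ℕ) =
      (-1) ^ i * (braceFac t (d + (i + j)) / braceFac t d) *
        (braceFac t (i + j) / (braceFac t i * braceFac t j)) * braceRising t d j *
        t ^ (((d + (i + j) : ℕ) : ℂ) - ((d + (i + j) : ℕ) : ℂ) * i / 2 +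
          ((d + (i + j) : ℕ) : ℂ) * (i + j) - i * (i + j) / 2 -
            ((i : ℂ) + j) ^ 2 / 2 - (i : ℂ) ^ 2 / 4 - ((i : ℂ) + j) / 2 - 5 * i / 4) := by
  have e1 := rEntry_add (d + (i + j + 1)) t (d + (i + j)) (d + j) 0
  have e2 := rInvEntry_add (d + (i + j + 1)) t d d (i + j)
  have e3 := rEntry_add (d + (i + j + 1)) t (d + j) (d + (i + j)) 0
  have e4 := rInvEntry_add (d + (i + j + 1)) t d d j
  rw [show d + (i + j + 1) - 1 - (d + (i + j)) = 0 by omega] at e2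
  rw [show d + (i + j + 1) - 1 - (d + j) = i by omega] at e4
  simp only [add_zero, qbinom_zero_right, braceRising_zero, one_mul] at e1 e3
  rw [e1, e2, e3, e4, ht.qbinom_add, ht.qbinom_add, ht.braceRising_eq 0, ht.braceRising_eq i,
    ht.braceRising_eq d]
  have hf := ht.braceFac_ne_zero
  have hexp : t ^ (((d + (i + j) : ℕ) : ℂ) - ((d + (i + j) : ℕ) : ℂ) * i / 2 +
      ((d + (i + j) : ℕ) : ℂ) * (i + j) - i * (i + j) / 2 -
          ((i : ℂ) + j) ^ 2 / 2 - (i : ℂ) ^ 2 / 4 - ((i : ℂ) + j) / 2 - 5 * i / 4) =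
      t ^ (weight (d + (i + j + 1)) (d + (i + j) : ℕ) * weight (d + (i + j + 1)) (d + j : ℕ) -
        ((0 : ℕ) : ℂ) * (((d + (i + j) : ℕ) : ℂ) - ((d + j : ℕ) : ℂ)) / 2 -
        ((0 : ℕ) : ℂ) * (((0 : ℕ) : ℂ) + 1) / 4) *
      t ^ (-(weight (d + (i + j + 1)) (d + (i + j) : ℕ) * weight (d + (i + j + 1)) d) -
        ((i + j : ℕ) : ℂ) * (((d + (i + j) : ℕ) : ℂ) - (d : ℂ)) / 2 +
        ((i + j : ℕ) : ℂ) * (((i + j : ℕ) : ℂ) + 1) / 4) *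
      t ^ (weight (d + (i + j + 1)) (d + j : ℕ) * weight (d + (i + j + 1)) (d + (i + j) : ℕ) -
        ((0 : ℕ) : ℂ) * (((d + j : ℕ) : ℂ) - ((d + (i + j) : ℕ) : ℂ)) / 2 -
        ((0 : ℕ) : ℂ) * (((0 : ℕ) : ℂ) + 1) / 4) *
      t ^ (-(weight (d + (i + j + 1)) (d + j : ℕ) * weight (d + (i + j + 1)) d) -
        (j : ℂ) * (((d + j : ℕ) : ℂ) - (d : ℂ)) / 2 + (j : ℂ) * ((j : ℂ) + 1) / 4) *
      t ^ weight (d + (i + j + 1)) d * t ^ weight (d + (i + j + 1)) (d + j : ℕ) := by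
    simp only [← Complex.cpow_add _ _ ht.ne_zero]
    congr 1
    simp only [weight]
    push_cast
    ring
  rw [hexp]
  have hsign : (-1 : ℂ) ^ (i + j) * (-1) ^ j = (-1) ^ i := by
    rw [pow_add, mul_assoc, ← mul_pow]; simp
  have aux : ∀ s₁ s₂ f fd fp fij fi fj fdj z₁ z₂ z₃ z₄ z₅ z₆ : ℂ, fd ≠ 0 → fp ≠ 0 → fi ≠ 0 →
      fj ≠ 0 → z₁ * (s₁ * (f / (fd * fp)) * (fp / 1) * z₂) *
        (z₃ * (s₂ * (fdj / (fd * fj)) * (fij / fi) * z₄)) * z₅ * z₆ =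
      s₁ * s₂ * (f / fd) * (fij / (fi * fj)) * (fdj / fd) * (z₁ * z₂ * z₃ * z₄ * z₅ * z₆) := by
    intros
    field_simp
  rw [← hsign, braceFac_zero, zero_add]
  exact aux _ _ _ _ _ _ _ _ _ _ _ _ _ _ _ (hf _) (hf _) (hf _) (hf _)

/-- The state sum of the figure-eight knot with the cut strand colored by the last basis vector. -/
theorem longKnotMatrix_figureEight_last {n : ℕ} {t : ℂ} (ht : Generic t) :
    longKnotMatrix (n + 1) t figureEight (Fin.last n) (Fin.last n) =
      ∑ x ∈ Finset.HasAntidiagonal.antidiagonal n, ∑ y ∈ Finset.HasAntidiagonal.antidiagonal x.2,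
        (-1) ^ y.1 * (braceFac t n / braceFac t x.1) *
          (braceFac t (y.1 + y.2) / (braceFac t y.1 * braceFac t y.2)) * braceRising t x.1 y.2 *
          t ^ ((n : ℂ) - n * y.1 / 2 + n * (y.1 + y.2) - y.1 * (y.1 + y.2) / 2 -
            ((y.1 : ℂ) + y.2) ^ 2 / 2 - (y.1 : ℂ) ^ 2 / 4 - ((y.1 : ℂ) + y.2) / 2 -
            5 * y.1 / 4) := by
  rw [longKnotMatrix_figureEight]
  simp only [partialTrace, figureEightMatrix_last, Finset.sum_mul]
  rw [Finset.sum_comm]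
  rw [Fin.sum_univ_eq_sum_range (fun d => ∑ c : Fin (n + 1), rEntry (n + 1) t n c c n *
    rInvEntry (n + 1) t n d n d * (rEntry (n + 1) t c n n c * rInvEntry (n + 1) t c d c d) *
    t ^ weight (n + 1) d * t ^ weight (n + 1) c) (n + 1)]
  rw [← Finset.Nat.sum_antidiagonal_eq_sum_range_succ (fun d _ =>
    ∑ c : Fin (n + 1), rEntry (n + 1) t n c c n *
    rInvEntry (n + 1) t n d n d * (rEntry (n + 1) t c n n c * rInvEntry (n + 1) t c d c d) *
    t ^ weight (n + 1) d * t ^ weight (n + 1) c) n]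
  refine Finset.sum_congr rfl fun x hx => ?_
  obtain ⟨d, p⟩ := x
  obtain rfl : d + p = n := by simpa using hx
  dsimp only
  rw [Fin.sum_univ_eq_sum_range (fun c => rEntry (d + p + 1) t (d + p) c c (d + p) *
    rInvEntry (d + p + 1) t (d + p) d (d + p) d * (rEntry (d + p + 1) t c (d + p) (d + p) c *
    rInvEntry (d + p + 1) t c d c d) *
    t ^ weight (d + p + 1) d * t ^ weight (d + p + 1) c) (d + p + 1), add_assoc d p 1,
    Finset.sum_range_add, Finset.sum_eq_zero, zero_add]
  · rw [← Finset.Nat.sum_antidiagonal_eq_sum_range_succ (fun j _ =>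
      rEntry (d + (p + 1)) t (d + p) (d + j) (d + j) (d + p) *
      rInvEntry (d + (p + 1)) t (d + p) d (d + p) d * (rEntry (d + (p + 1)) t (d + j) (d + p) (d + p) (d + j) *
      rInvEntry (d + (p + 1)) t (d + j) d (d + j) d) *
      t ^ weight (d + (p + 1)) d * t ^ weight (d + (p + 1)) ((d + j : ℕ))) p,
      ← Finset.Nat.sum_antidiagonal_swap]
    refine Finset.sum_congr rfl fun y hy => ?_
    obtain ⟨i, j⟩ := y
    obtain rfl : i + j = p := by simpa using hy
    simp only [Prod.swap]
    exact figureEight_state ht d i j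
  -- Colors `c < d` do not contribute: the entry of the inverse R-matrix at `((c, d), (c, d))`
  -- vanishes.
  · intro c hc
    rw [rInvEntry_eq_zero (i := c) (l := d)]
    · simp
    · have := Finset.mem_range.mp hc
      omega

/-! ### From the state sum to the cyclotomic expansion -/

theorem sum_antidiagonal_antidiagonal_comm (n : ℕ) (f : ℕ → ℕ → ℕ → ℂ) :
    ∑ x ∈ Finset.HasAntidiagonal.antidiagonal n, ∑ y ∈ Finset.HasAntidiagonal.antidiagonal x.2, f x.1 y.1 y.2 =
      ∑ x ∈ Finset.HasAntidiagonal.antidiagonal n, ∑ y ∈ Finset.HasAntidiagonal.antidiagonal x.2, f y.1 x.1 y.2 := by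
  rw [Finset.sum_sigma', Finset.sum_sigma']
  refine Finset.sum_nbij' (fun z => ⟨(z.2.1, z.1.1 + z.2.2), (z.1.1, z.2.2)⟩)
    (fun z => ⟨(z.2.1, z.1.1 + z.2.2), (z.1.1, z.2.2)⟩) ?_ ?_ ?_ ?_ ?_
  · rintro ⟨⟨a, b⟩, ⟨c, d⟩⟩ h
    simp at h ⊢
    omega
  · rintro ⟨⟨a, b⟩, ⟨c, d⟩⟩ h
    simp at h ⊢
    omega
  · rintro ⟨⟨a, b⟩, ⟨c, d⟩⟩ h
    simp at h ⊢
    omega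
  · rintro ⟨⟨a, b⟩, ⟨c, d⟩⟩ h
    simp at h ⊢
    omega
  · rintro ⟨⟨a, b⟩, ⟨c, d⟩⟩ h
    rfl

/-- The `q`-binomial theorem for the rising products of quantum integers. -/
theorem braceRising_eq_sum {t : ℂ} (ht : Generic t) (c j : ℕ) :
    braceRising t c j = ∑ y ∈ Finset.HasAntidiagonal.antidiagonal j,
      (-1) ^ y.1 * (braceFac t j / (braceFac t y.1 * braceFac t y.2)) *
        t ^ ((c : ℂ) * ((y.2 : ℂ) - y.1) / 2 + ((j : ℂ) + 1) * ((y.2 : ℂ) - y.1) / 4) := by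
  have h := prod_eq_sum_qbinom ht.ne_zero (t ^ ((c : ℂ) / 2)) (-t ^ (-(c : ℂ) / 2)) j
  have h1 : braceRising t c j = ∏ g ∈ Finset.range j,
      (t ^ ((c : ℂ) / 2) * t ^ (((g : ℂ) + 1) / 2) +
        -t ^ (-(c : ℂ) / 2) * t ^ (-((g : ℂ) + 1) / 2)) := by
    refine Finset.prod_congr rfl fun g _ => ?_
    rw [neg_mul, ← sub_eq_add_neg, ← Complex.cpow_add _ _ ht.ne_zero,
      ← Complex.cpow_add _ _ ht.ne_zero, brace]
    push_cast
    congr 2 <;> ring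
  rw [h1, h, ← Finset.Nat.sum_antidiagonal_eq_sum_range_succ (fun b a => qbinom t j b *
    (t ^ ((c : ℂ) / 2)) ^ b * (-t ^ (-(c : ℂ) / 2)) ^ a * t ^ (((j : ℂ) + 1) * (2 * b - j) / 4)) j,
    ← Finset.Nat.sum_antidiagonal_swap]
  refine Finset.sum_congr rfl fun y hy => ?_
  obtain ⟨a, b⟩ := y
  obtain rfl : a + b = j := by simpa using hy
  simp only [Prod.swap]
  rw [ht.qbinom_add, neg_pow, ← Complex.cpow_nat_mul, ← Complex.cpow_nat_mul]
  have : t ^ ((c : ℂ) * ((b : ℂ) - a) / 2 + (((a + b : ℕ) : ℂ) + 1) * ((b : ℂ) - a) / 4) =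
      t ^ ((b : ℂ) * ((c : ℂ) / 2)) * t ^ ((a : ℂ) * (-(c : ℂ) / 2)) *
        t ^ ((((a + b : ℕ) : ℂ) + 1) * (2 * b - ((a + b : ℕ) : ℂ)) / 4) := by
    simp only [← Complex.cpow_add _ _ ht.ne_zero]
    congr 1
    push_cast
    ring
  rw [this]
  ring

/-- The second Pascal recursion of the symmetric quantum binomial coefficients. -/
theorem qbinom_succ_succ' {t : ℂ} (ht : Generic t) (n k : ℕ) : qbinom t (n + 1) (k + 1) =
    t ^ (-((k : ℂ) + 1) / 2) * qbinom t n (k + 1) +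
        t ^ (((n : ℂ) - (k : ℂ)) / 2) * qbinom t n k := by
  rcases lt_trichotomy n k with h | rfl | h
  · simp [qbinom_of_lt t h, qbinom_of_lt t (show n < k + 1 by omega),
      qbinom_of_lt t (show n + 1 < k + 1 by omega)]
  · simp [qbinom_self, qbinom_of_lt t (Nat.lt_succ_self n)]
  · obtain ⟨d, rfl⟩ : ∃ d, n = d + (k + 1) := ⟨n - (k + 1), by omega⟩
    have h1 := ht.qbinom_add d (k + 1)
    have h2 := ht.qbinom_add (d + 1) k
    have h3 := ht.qbinom_add (d + 1) (k + 1)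
    rw [show d + 1 + k = d + (k + 1) by ring] at h2
    rw [show d + 1 + (k + 1) = d + (k + 1) + 1 by ring] at h3
    rw [h1, h2, h3, braceFac_succ, braceFac_succ t k, braceFac_succ t d]
    have h4 := brace_add ht.ne_zero (k + 1) (d + 1)
    rw [show k + 1 + (d + 1) = d + (k + 1) + 1 by ring] at h4
    rw [← h4, show (((d + (k + 1) : ℕ) : ℂ) - (k : ℂ)) / 2 = ((d + 1 : ℕ) : ℂ) / 2 by
      push_cast; ring, show -((k : ℂ) + 1) / 2 = -((k + 1 : ℕ) : ℂ) / 2 by push_cast; ring]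
    have hf := ht.braceFac_ne_zero
    have hk := ht.brace_ne_zero k
    have hd := ht.brace_ne_zero d
    field_simp
    ring

/-- The innermost sum of the rearranged state sum. The second Pascal recursion splits the case `M +
1` into `t^{k+1}` times the case `(M, k)` plus `1 - t^{k+1}` times the case `(M, k + 1)`, and both
cases equal `1` by induction. -/
theorem sum_qbinom_mul_braceRising {t : ℂ} (ht : Generic t) (M k : ℕ) :
    ∑ a ∈ Finset.range (M + 1), (-1) ^ a * qbinom t M a * braceRising t k a *
      t ^ ((M : ℂ) * (k + 1) + M * a / 2 - k * a / 2 - (a : ℂ) ^ 2 / 4 - 3 * a / 4) = 1 := by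
  induction M generalizing k with
  | zero => simp [qbinom_zero_right, braceRising_zero]
  | succ M ih =>
    have hU : ∑ a ∈ Finset.range (M + 1 + 1), (-1) ^ a *
        (t ^ (-(a : ℂ) / 2) * qbinom t M a) * braceRising t k a *
        t ^ (((M + 1 : ℕ) : ℂ) * (k + 1) + ((M + 1 : ℕ) : ℂ) * a / 2 - k * a / 2
          - (a : ℂ) ^ 2 / 4 - 3 * a / 4) = t ^ ((k : ℂ) + 1) := by
      rw [Finset.sum_range_succ, qbinom_of_lt t (Nat.lt_succ_self M)]
      simp only [mul_zero, zero_mul, add_zero]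
      have h0 := congrArg (t ^ ((k : ℂ) + 1) * ·) (ih k)
      simp only [mul_one] at h0
      rw [← h0, Finset.mul_sum]
      refine Finset.sum_congr rfl fun a _ => ?_
      have : t ^ (-(a : ℂ) / 2) * t ^ (((M + 1 : ℕ) : ℂ) * (k + 1) + ((M + 1 : ℕ) : ℂ) * a / 2 -
            k * a / 2 - (a : ℂ) ^ 2 / 4 - 3 * a / 4) = t ^ ((k : ℂ) + 1) *
          t ^ ((M : ℂ) * (k + 1) + M * a / 2 - k * a / 2 - (a : ℂ) ^ 2 / 4 - 3 * a / 4) := by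
        simp only [← Complex.cpow_add _ _ ht.ne_zero]
        congr 1
        push_cast
        ring
      linear_combination ((-1) ^ a * qbinom t M a * braceRising t k a) * this
    have hV : ∑ a ∈ Finset.range (M + 1), (-1) ^ (a + 1) *
        (t ^ (((M : ℂ) - a) / 2) * qbinom t M a) * braceRising t k (a + 1) *
        t ^ (((M + 1 : ℕ) : ℂ) * (k + 1) + ((M + 1 : ℕ) : ℂ) * ((a + 1 : ℕ) : ℂ) / 2
          - k * ((a + 1 : ℕ) : ℂ) / 2 - ((a + 1 : ℕ) : ℂ) ^ 2 / 4 - 3 * ((a + 1 : ℕ) : ℂ) / 4) =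
        1 - t ^ ((k : ℂ) + 1) := by
      have h0 := congrArg ((1 - t ^ ((k : ℂ) + 1)) * ·) (ih (k + 1))
      simp only [mul_one] at h0
      rw [← h0, Finset.mul_sum]
      refine Finset.sum_congr rfl fun a _ => ?_
      have : -(t ^ (((M : ℂ) - a) / 2) * brace t (k + 1) *
          t ^ (((M + 1 : ℕ) : ℂ) * (k + 1) + ((M + 1 : ℕ) : ℂ) * ((a + 1 : ℕ) : ℂ) / 2
          - k * ((a + 1 : ℕ) : ℂ) / 2 - ((a + 1 : ℕ) : ℂ) ^ 2 / 4 - 3 * ((a + 1 : ℕ) : ℂ) / 4)) =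
          (1 - t ^ ((k : ℂ) + 1)) * t ^ ((M : ℂ) * (((k + 1 : ℕ) : ℂ) + 1) + M * a / 2 -
            ((k + 1 : ℕ) : ℂ) * a / 2 - (a : ℂ) ^ 2 / 4 - 3 * a / 4) := by
        simp only [brace, mul_sub, sub_mul, one_mul, ← Complex.cpow_add _ _ ht.ne_zero]
        push_cast
        ring_nf
      rw [braceRising_succ_left, pow_succ]
      linear_combination ((-1) ^ a * qbinom t M a * braceRising t (k + 1) a) * this
    rw [Finset.sum_range_succ' _ (M + 1)] at hU ⊢
    simp only [qbinom_succ_succ' ht, mul_add, add_mul, Finset.sum_add_distrib]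
    simp only [mul_add] at hU hV
    push_cast at hU hV ⊢
    simp only [qbinom_zero_right] at hU ⊢
    simp at hU hV ⊢
    linear_combination hU + hV

/-- Expanding the rising product makes the state sum symmetric enough to be resummed: the new
indices satisfy `j = a + b`, and the quotient of factorials becomes a multinomial in `i`, `a`, `b`.
-/
theorem expand_state {t : ℂ} (ht : Generic t) (c i j : ℕ) (n : ℂ) :
    (-1) ^ i * (n / braceFac t c) *
        (braceFac t (i + j) / (braceFac t i * braceFac t j)) * braceRising t c j *
        t ^ (((c + (i + j) : ℕ) : ℂ) - ((c + (i + j) : ℕ) : ℂ) * i / 2 +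
          ((c + (i + j) : ℕ) : ℂ) * (i + j) - i * (i + j) / 2 -
            ((i : ℂ) + j) ^ 2 / 2 - (i : ℂ) ^ 2 / 4 - ((i : ℂ) + j) / 2 - 5 * i / 4) =
      ∑ y ∈ Finset.HasAntidiagonal.antidiagonal j,
        (-1) ^ (i + y.1) * (n / braceFac t c) *
          (braceFac t (i + (y.1 + y.2)) / (braceFac t i * braceFac t y.1 * braceFac t y.2)) *
        t ^ (((c : ℂ) + i + y.1 + y.2) - (c + i + y.1 + y.2) * i / 2 +
          (c + i + y.1 + y.2) * (i + y.1 + y.2) - i * (i + y.1 + y.2) / 2 -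
            ((i : ℂ) + y.1 + y.2) ^ 2 / 2 - (i : ℂ) ^ 2 / 4 - ((i : ℂ) + y.1 + y.2) / 2 - 5 * i / 4
            + (c : ℂ) * ((y.2 : ℂ) - y.1) / 2 + ((y.1 : ℂ) + y.2 + 1) * ((y.2 : ℂ) - y.1) / 4) := by
  rw [braceRising_eq_sum ht, Finset.mul_sum, Finset.sum_mul]
  refine Finset.sum_congr rfl fun y hy => ?_
  obtain ⟨a, b⟩ := y
  obtain rfl : a + b = j := by simpa using hy
  have hf := ht.braceFac_ne_zero
  dsimp only
  rw [pow_add, show (((c : ℂ) + i + a + b) - (c + i + a + b) * i / 2 +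
          (c + i + a + b) * (i + a + b) - i * (i + a + b) / 2 -
            ((i : ℂ) + a + b) ^ 2 / 2 - (i : ℂ) ^ 2 / 4 - ((i : ℂ) + a + b) / 2 - 5 * i / 4
            + (c : ℂ) * ((b : ℂ) - a) / 2 + ((a : ℂ) + b + 1) * ((b : ℂ) - a) / 4) =
      (((c + (i + (a + b)) : ℕ) : ℂ) - ((c + (i + (a + b)) : ℕ) : ℂ) * i / 2 +
          ((c + (i + (a + b)) : ℕ) : ℂ) * (i + ((a + b : ℕ) : ℂ)) - i * (i + ((a + b : ℕ) : ℂ)) / 2 -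
            ((i : ℂ) + ((a + b : ℕ) : ℂ)) ^ 2 / 2 - (i : ℂ) ^ 2 / 4 -
            ((i : ℂ) + ((a + b : ℕ) : ℂ)) / 2 - 5 * i / 4) +
        ((c : ℂ) * ((b : ℂ) - a) / 2 + (((a + b : ℕ) : ℂ) + 1) * ((b : ℂ) - a) / 4) by
      push_cast; ring, Complex.cpow_add _ ((c : ℂ) * ((b : ℂ) - a) / 2 +
        (((a + b : ℕ) : ℂ) + 1) * ((b : ℂ) - a) / 4) ht.ne_zero]
  have aux : ∀ s₁ s₂ f fc fp fi fj fa fb z₁ z₂ : ℂ, fc ≠ 0 → fi ≠ 0 → fj ≠ 0 → fa ≠ 0 → fb ≠ 0 →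
      s₁ * (f / fc) * (fp / (fi * fj)) * (s₂ * (fj / (fa * fb)) * z₂) * z₁ =
      s₁ * s₂ * (f / fc) * (fp / (fi * fa * fb)) * (z₁ * z₂) := by
    intros
    field_simp
  exact aux _ _ _ _ _ _ _ _ _ _ _ (hf _) (hf _) (hf _) (hf _) (hf _)

/-- The `q`-binomial theorem read backwards in the pair `(i, b)` with `i + b = k` fixed. When `c + a
+ k = n` the rising product obtained is `{N+1} ⋯ {N+k}` with `N = n + 1`, independent of `a` and
`c`. -/
theorem collect_state {t : ℂ} (ht : Generic t) (c a k : ℕ) (n : ℂ) :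
    ∑ z ∈ Finset.HasAntidiagonal.antidiagonal k,
        (-1) ^ (z.1 + a) * (n / braceFac t c) *
          (braceFac t (z.1 + (a + z.2)) / (braceFac t z.1 * braceFac t a * braceFac t z.2)) *
        t ^ (((c : ℂ) + z.1 + a + z.2) - (c + z.1 + a + z.2) * z.1 / 2 +
          (c + z.1 + a + z.2) * (z.1 + a + z.2) - z.1 * (z.1 + a + z.2) / 2 -
            ((z.1 : ℂ) + a + z.2) ^ 2 / 2 - (z.1 : ℂ) ^ 2 / 4 - ((z.1 : ℂ) + a + z.2) / 2 -
            5 * z.1 / 4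
            + (c : ℂ) * ((z.2 : ℂ) - a) / 2 + ((a : ℂ) + z.2 + 1) * ((z.2 : ℂ) - a) / 4) =
      (-1) ^ a * (n / braceFac t c) * (braceFac t (k + a) / (braceFac t k * braceFac t a)) *
        braceRising t (c + a + k + 1) k *
        t ^ (((c : ℂ) + a) * (k + 1) + (c + a) * a / 2 - k * a / 2 - (a : ℂ) ^ 2 / 4
          - 3 * a / 4) := by
  rw [braceRising_eq_sum ht, Finset.mul_sum, Finset.sum_mul]
  refine Finset.sum_congr rfl fun y hy => ?_
  obtain ⟨i, b⟩ := y
  obtain rfl : i + b = k := by simpa using hy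
  have hf := ht.braceFac_ne_zero
  dsimp only
  rw [pow_add, show (((c : ℂ) + i + a + b) - (c + i + a + b) * i / 2 +
          (c + i + a + b) * (i + a + b) - i * (i + a + b) / 2 -
            ((i : ℂ) + a + b) ^ 2 / 2 - (i : ℂ) ^ 2 / 4 - ((i : ℂ) + a + b) / 2 - 5 * i / 4
            + (c : ℂ) * ((b : ℂ) - a) / 2 + ((a : ℂ) + b + 1) * ((b : ℂ) - a) / 4) =
      (((c : ℂ) + a) * (((i + b : ℕ) : ℂ) + 1) + (c + a) * a / 2 - ((i + b : ℕ) : ℂ) * a / 2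
          - (a : ℂ) ^ 2 / 4 - 3 * a / 4) +
        (((c + a + (i + b) + 1 : ℕ) : ℂ) * ((b : ℂ) - i) / 2 +
          (((i + b : ℕ) : ℂ) + 1) * ((b : ℂ) - i) / 4) by
      push_cast; ring, Complex.cpow_add _ _ ht.ne_zero, show i + (a + b) = i + b + a by ring]
  have aux : ∀ s₁ s₂ f fc fp fi fj fa fb z₁ z₂ : ℂ, fc ≠ 0 → fi ≠ 0 → fj ≠ 0 → fa ≠ 0 → fb ≠ 0 →
      s₁ * s₂ * (f / fc) * (fp / (fi * fa * fb)) * (z₁ * z₂) =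
      s₂ * (f / fc) * (fp / (fj * fa)) * (s₁ * (fj / (fi * fb)) * z₂) * z₁ := by
    intros
    field_simp
  exact aux _ _ _ _ _ _ _ _ _ _ _ (hf _) (hf _) (hf _) (hf _) (hf _)

theorem braceFac_div_mul_braceRising {t : ℂ} (ht : Generic t) (k M : ℕ) :
    braceFac t (k + M) / braceFac t M * braceRising t (k + M + 1) k =
      ∏ s ∈ Finset.range k, brace t (k + M + 1 + (s + 1)) * brace t (k + M + 1 - (s + 1)) := by
  rw [Finset.prod_mul_distrib, mul_comm]
  congr 1
  rw [← Finset.prod_range_reflect, add_comm k M, ← ht.braceRising_eq, braceRising]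
  refine Finset.prod_congr rfl fun s hs => ?_
  have := Finset.mem_range.mp hs
  congr 1
  omega

/-- The cyclotomic expansion of the state sum, for generic `t`. -/
theorem longKnotMatrix_figureEight_last_eq {n : ℕ} {t : ℂ} (ht : Generic t) :
    longKnotMatrix (n + 1) t figureEight (Fin.last n) (Fin.last n) =
      ∑ k ∈ Finset.range (n + 1), ∏ s ∈ Finset.range k,
        brace t (n + 1 + (s + 1)) * brace t (n + 1 - (s + 1)) := by
  rw [longKnotMatrix_figureEight_last ht]
  let g : ℕ → ℕ → ℕ → ℕ → ℂ := fun c i a b =>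
    (-1) ^ (i + a) * (braceFac t n / braceFac t c) *
          (braceFac t (i + (a + b)) / (braceFac t i * braceFac t a * braceFac t b)) *
        t ^ (((c : ℂ) + i + a + b) - (c + i + a + b) * i / 2 +
          (c + i + a + b) * (i + a + b) - i * (i + a + b) / 2 -
            ((i : ℂ) + a + b) ^ 2 / 2 - (i : ℂ) ^ 2 / 4 - ((i : ℂ) + a + b) / 2 - 5 * i / 4
            + (c : ℂ) * ((b : ℂ) - a) / 2 + ((a : ℂ) + b + 1) * ((b : ℂ) - a) / 4)
  let h : ℕ → ℕ → ℕ → ℂ := fun c k a =>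
    (-1) ^ a * (braceFac t n / braceFac t c) *
        (braceFac t (k + a) / (braceFac t k * braceFac t a)) *
        braceRising t (n + 1) k *
        t ^ (((c : ℂ) + a) * (k + 1) + (c + a) * a / 2 - k * a / 2 - (a : ℂ) ^ 2 / 4
          - 3 * a / 4)
  trans ∑ x ∈ Finset.HasAntidiagonal.antidiagonal n,
      ∑ y ∈ Finset.HasAntidiagonal.antidiagonal x.2, h x.1 y.1 y.2
  · refine Finset.sum_congr rfl fun x hx => ?_
    obtain ⟨c, p⟩ := x
    have hcp : c + p = n := by simpa using hx
    dsimp only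
    trans ∑ y ∈ Finset.HasAntidiagonal.antidiagonal p,
        ∑ z ∈ Finset.HasAntidiagonal.antidiagonal y.2, g c y.1 z.1 z.2
    · refine Finset.sum_congr rfl fun y hy => ?_
      obtain ⟨i, j⟩ := y
      have hij : i + j = p := by simpa using hy
      have := expand_state ht c i j (braceFac t n)
      rw [hij, hcp] at this
      dsimp only
      rw [hij]
      exact this
    · rw [sum_antidiagonal_antidiagonal_comm p (g c), ← Finset.Nat.sum_antidiagonal_swap]
      refine Finset.sum_congr rfl fun y hy => ?_
      obtain ⟨k, a⟩ := y
      have hij : k + a = p := by simpa using hy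
      simp only [Prod.swap]
      have := collect_state ht c a k (braceFac t n)
      rw [show c + a + k + 1 = n + 1 by omega] at this
      exact this
  -- With `k` outermost, the sum over `a + c = M = n - k` is the one that equals `1`, leaving `{n}!
  -- / {M}!` times the rising product.
  · rw [sum_antidiagonal_antidiagonal_comm n h, ← Finset.Nat.sum_antidiagonal_eq_sum_range_succ
      (fun k _ => ∏ s ∈ Finset.range k,
        brace t (n + 1 + (s + 1)) * brace t (n + 1 - (s + 1))) n]
    refine Finset.sum_congr rfl fun x hx => ?_
    obtain ⟨k, M⟩ := x
    obtain rfl : k + M = n := by simpa using hx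
    dsimp only
    rw [← braceFac_div_mul_braceRising ht,
      ← mul_one (braceFac t (k + M) / braceFac t M * braceRising t (k + M + 1) k),
      ← sum_qbinom_mul_braceRising ht M k,
      ← Finset.Nat.sum_antidiagonal_eq_sum_range_succ (fun a _ => (-1) ^ a * qbinom t M a *
        braceRising t k a * t ^ ((M : ℂ) * (k + 1) + M * a / 2 - k * a / 2 - (a : ℂ) ^ 2 / 4 -
          3 * a / 4)) M, ← Finset.Nat.sum_antidiagonal_swap, Finset.mul_sum]
    refine Finset.sum_congr rfl fun y hy => ?_
    obtain ⟨a, c⟩ := y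
    obtain rfl : a + c = M := by simpa using hy
    have hf := ht.braceFac_ne_zero
    simp only [Prod.swap, h]
    rw [ht.qbinom_add', ht.braceRising_eq k a, Nat.cast_add a c, add_comm (a : ℂ) c]
    generalize braceRising t (k + (a + c) + 1) k = r
    generalize t ^ (((c : ℂ) + a) * (k + 1) + (c + a) * a / 2 - k * a / 2 - (a : ℂ) ^ 2 / 4
          - 3 * a / 4) = z
    have aux : ∀ s f fc fka fk fa fca r z : ℂ, fc ≠ 0 → fk ≠ 0 → fa ≠ 0 → fca ≠ 0 →
        s * (f / fc) * (fka / (fk * fa)) * r * z =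
        f / fca * r * (s * (fca / (fa * fc)) * (fka / fk) * z) := by
      intros
      field_simp
    exact aux _ _ _ _ _ _ _ _ _ (hf _) (hf _) (hf _) (hf _)

theorem coloredJones_figureEight_of_generic {t : ℂ} (ht : Generic t) (N : ℕ) :
    coloredJones N figureEight t = ∑ k ∈ Finset.range N, ∏ s ∈ Finset.range k,
        brace t (N + (s + 1)) * brace t (N - (s + 1)) := by
  rcases N with _ | n
  · simp [coloredJones]
  · rw [coloredJones, dif_pos n.succ_pos,
      ← longKnotMatrix_figureEight_apply ht n n.succ_pos n.lt_succ_self]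
    exact longKnotMatrix_figureEight_last_eq ht

/-! ### Extension from generic values to the slit plane -/

theorem continuousOn_brace (m : ℕ) : ContinuousOn (fun t => brace t m) Complex.slitPlane :=
  fun _ ht => ((continuousAt_cpow_const ht).sub (continuousAt_cpow_const ht)).continuousWithinAt

theorem continuousOn_cpow_const (z : ℂ) :
    ContinuousOn (fun t : ℂ => t ^ z) Complex.slitPlane :=
  fun _ ht => (continuousAt_cpow_const ht).continuousWithinAt

theorem continuousOn_braceRising (a m : ℕ) :
    ContinuousOn (fun t => braceRising t a m) Complex.slitPlane :=
  continuousOn_finsetProd _ fun _ _ => continuousOn_brace _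

theorem continuousOn_qbinom (n k : ℕ) :
    ContinuousOn (fun t => qbinom t n k) Complex.slitPlane := by
  induction n generalizing k with
  | zero => cases k with
    | zero => simpa [qbinom] using continuousOn_const
    | succ k => simpa [qbinom] using continuousOn_const
  | succ n ih => cases k with
    | zero => simpa [qbinom] using continuousOn_const
    | succ k =>
      simp only [qbinom_succ_succ]
      exact ((continuousOn_cpow_const _).mul (ih _)).add ((continuousOn_cpow_const _).mul (ih _))

theorem continuousOn_rMatrix (N : ℕ) (x y : Fin N × Fin N) :
    ContinuousOn (fun t => rMatrix N t x y) Complex.slitPlane := by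
  simp only [rMatrix]
  split_ifs
  · exact ((continuousOn_qbinom _ _).mul (continuousOn_braceRising _ _)).mul
      (continuousOn_cpow_const _)
  · exact continuousOn_const

theorem continuousOn_rMatrixInv (N : ℕ) (x y : Fin N × Fin N) :
    ContinuousOn (fun t => rMatrixInv N t x y) Complex.slitPlane := by
  simp only [rMatrixInv]
  split_ifs
  · exact ((continuousOn_const.mul (continuousOn_qbinom _ _)).mul
      (continuousOn_braceRising _ _)).mul (continuousOn_cpow_const _)
  · exact continuousOn_const

theorem continuousOn_mul_apply {m : Type*} [Fintype m] {A B : ℂ → Matrix m m ℂ} {s : Set ℂ}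
    (hA : ∀ x y, ContinuousOn (fun t => A t x y) s)
    (hB : ∀ x y, ContinuousOn (fun t => B t x y) s) (x y : m) :
    ContinuousOn (fun t => (A t * B t) x y) s := by
  simp only [Matrix.mul_apply]
  exact continuousOn_finsetSum _ fun z _ => (hA x z).mul (hB z y)

theorem continuousOn_figureEightMatrix (N : ℕ) (x y : (Fin N × Fin N) × Fin N) :
    ContinuousOn (fun t => figureEightMatrix N t x y) Complex.slitPlane := by
  have hL : ∀ x y, ContinuousOn (fun t => actLeft (rMatrix N t) x y) Complex.slitPlane :=
    fun x y => (continuousOn_rMatrix N _ _).mul continuousOn_const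
  have hR : ∀ x y, ContinuousOn (fun t => actRight (rMatrixInv N t) x y) Complex.slitPlane :=
    fun x y => continuousOn_const.mul (continuousOn_rMatrixInv N _ _)
  have h := continuousOn_mul_apply hL hR
  exact continuousOn_mul_apply h h x y

theorem continuousOn_coloredJones_figureEight (N : ℕ) :
    ContinuousOn (fun t => coloredJones N figureEight t) Complex.slitPlane := by
  simp only [coloredJones]
  split_ifs with h
  · simp only [longKnotMatrix_figureEight, partialTrace]
    exact continuousOn_finsetSum _ fun _ _ => (continuousOn_finsetSum _ fun _ _ =>
      (continuousOn_figureEightMatrix N _ _).mul (continuousOn_cpow_const _)).mul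
        (continuousOn_cpow_const _)
  · exact continuousOn_const

/-- For `t ≠ 0`, `{k+1} = 0` forces `t^{k+1} = 1`, so the exceptions are `0` and roots of unity. -/
theorem countable_not_generic : {t : ℂ | ¬ Generic t}.Countable := by
  have h : {t : ℂ | ¬ Generic t} ⊆ {0} ∪ ⋃ k : ℕ, {t : ℂ | t ^ (k + 1) = 1} := by
    intro t ht
    by_cases h0 : t = 0
    · exact Or.inl h0
    right
    by_contra hk
    simp only [Set.mem_iUnion, Set.mem_ofPred_eq, not_exists] at hk
    refine ht ⟨h0, fun k hb => hk k ?_⟩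
    have h1 : t ^ (((k + 1 : ℕ) : ℂ) / 2) = t ^ (-((k + 1 : ℕ) : ℂ) / 2) := sub_eq_zero.mp hb
    calc t ^ (k + 1) = t ^ (((k + 1 : ℕ) : ℂ) / 2 + ((k + 1 : ℕ) : ℂ) / 2) := by
          rw [add_halves, Complex.cpow_natCast]
      _ = t ^ (-((k + 1 : ℕ) : ℂ) / 2 + ((k + 1 : ℕ) : ℂ) / 2) := by
          rw [Complex.cpow_add _ _ h0, Complex.cpow_add _ _ h0, h1]
      _ = 1 := by
          rw [neg_div, neg_add_cancel, Complex.cpow_zero]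
  refine Set.Countable.mono h ((Set.countable_singleton 0).union (Set.countable_iUnion fun k => ?_))
  have : {t : ℂ | t ^ (k + 1) = 1} ⊆ ((Polynomial.nthRoots (k + 1) (1 : ℂ)).toFinset : Set ℂ) := by
    intro t ht
    simpa [Polynomial.mem_nthRoots (Nat.succ_pos k)] using ht
  exact (Finset.countable_toSet _).mono this

/-- The cyclotomic expansion of the colored Jones polynomial of the figure-eight knot. -/
theorem coloredJones_figureEight {t : ℂ} (ht : t ∈ Complex.slitPlane) (N : ℕ) :
    coloredJones N figureEight t = ∑ k ∈ Finset.range N, ∏ s ∈ Finset.range k,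
        brace t (N + (s + 1)) * brace t (N - (s + 1)) := by
  -- A countable set has dense complement. The identity therefore passes to the exceptional points
  -- by continuity, which the principal powers have on the slit plane.
  have hd : Dense {t : ℂ | ¬ Generic t}ᶜ := countable_not_generic.dense_compl ℝ
  have hne : (𝓝[{t : ℂ | ¬ Generic t}ᶜ] t).NeBot := mem_closure_iff_nhdsWithin_neBot.mp (hd t)
  have hs := Complex.isOpen_slitPlane.mem_nhds ht
  have h1 := ((continuousOn_coloredJones_figureEight N).continuousAt hs).tendsto.mono_left
    (nhdsWithin_le_nhds (s := {t : ℂ | ¬ Generic t}ᶜ))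
  have hc : ContinuousOn (fun t => ∑ k ∈ Finset.range N, ∏ s ∈ Finset.range k,
      brace t (N + (s + 1)) * brace t (N - (s + 1))) Complex.slitPlane :=
    continuousOn_finsetSum _ fun _ _ => continuousOn_finsetProd _ fun _ _ =>
      (continuousOn_brace _).mul (continuousOn_brace _)
  have h2 := (hc.continuousAt hs).tendsto.mono_left
    (nhdsWithin_le_nhds (s := {t : ℂ | ¬ Generic t}ᶜ))
  refine tendsto_nhds_unique h1 (h2.congr' ?_)
  filter_upwards [self_mem_nhdsWithin] with z hz
  exact (coloredJones_figureEight_of_generic (not_not.mp hz) N).symm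

/-! ### The cyclotomic sum on the unit circle -/

/-- The factor `{N + k} {N - k}` at `t = exp(2 π r √-1 / N)`. -/
def cycFactor (r : ℝ) (N k : ℕ) : ℝ :=
  4 * (Real.sin (Real.pi * r * (k / N)) ^ 2 - Real.sin (Real.pi * r) ^ 2)

/-- The product of the first `m` factors. -/
def cycProd (r : ℝ) (N m : ℕ) : ℝ := ∏ s ∈ Finset.range m, cycFactor r N (s + 1)

/-- The value of the colored Jones polynomial of the figure-eight knot at
`exp(2 π r √-1 / N)`. -/
def cycSum (r : ℝ) (N : ℕ) : ℝ := ∑ m ∈ Finset.range N, cycProd r N m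

theorem brace_exp {θ : ℝ} (h1 : -Real.pi < θ) (h2 : θ ≤ Real.pi) (m : ℕ) :
    brace (Complex.exp (θ * Complex.I)) m = 2 * Complex.I * (Real.sin (θ * m / 2) : ℂ) := by
  have h : ∀ z : ℂ, Complex.exp (θ * Complex.I) ^ z = Complex.exp (θ * Complex.I * z) := by
    intro z
    rw [Complex.cpow_def_of_ne_zero (Complex.exp_ne_zero _), Complex.log_exp] <;> simpa
  rw [brace, h, h, Complex.ofReal_sin, Complex.sin]
  push_cast
  rw [show (θ : ℂ) * Complex.I * ((m : ℂ) / 2) = (θ : ℂ) * m / 2 * Complex.I by ring,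
    show (θ : ℂ) * Complex.I * (-(m : ℂ) / 2) = -((θ : ℂ) * m / 2) * Complex.I by ring]
  linear_combination (Complex.exp ((θ : ℂ) * m / 2 * Complex.I) -
    Complex.exp (-((θ : ℂ) * m / 2) * Complex.I)) * Complex.I_sq

/-- The bound on `N` puts the angle `2πr/N` strictly between `-π` and `π`, where principal powers of
the exponential are the naive ones. The factors then come from `sin(A+B) sin(A-B) = sin²A - sin²B`.
-/
theorem coloredJones_figureEight_exp {r : ℝ} {N : ℕ} (hN : 2 * |r| < N) :
    coloredJones N figureEight
      (Complex.exp (2 * (Real.pi : ℂ) * (r : ℂ) * Complex.I / (N : ℂ))) = (cycSum r N : ℂ) := by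
  have hN0 : (0 : ℝ) < N := lt_of_le_of_lt (by positivity) hN
  set θ : ℝ := 2 * Real.pi * r / N with hθ
  have habs : |θ| < Real.pi := by
    rw [hθ, abs_div, abs_mul, abs_of_pos hN0, div_lt_iff₀ hN0, abs_of_pos Real.two_pi_pos]
    nlinarith [Real.pi_pos]
  obtain ⟨h1, h2⟩ := abs_lt.mp habs
  have ht : Complex.exp (2 * (Real.pi : ℂ) * (r : ℂ) * Complex.I / (N : ℂ)) =
      Complex.exp (θ * Complex.I) := by
    congr 1; rw [hθ]; push_cast; ring
  have hs : Complex.exp (θ * Complex.I) ∈ Complex.slitPlane := by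
    rw [Complex.mem_slitPlane_iff_arg, Complex.arg_exp_mul_I, toIocMod_eq_self _ |>.mpr]
    · exact ⟨h2.ne, Complex.exp_ne_zero _⟩
    · exact ⟨h1, by linarith⟩
  rw [ht, coloredJones_figureEight hs, cycSum]
  push_cast
  refine Finset.sum_congr rfl fun m hm => ?_
  rw [cycProd]
  push_cast
  refine Finset.prod_congr rfl fun s hs => ?_
  have hsN : s + 1 ≤ N := by
    have := Finset.mem_range.mp hm; have := Finset.mem_range.mp hs; omega
  rw [brace_exp h1 h2.le, brace_exp h1 h2.le]
  have e1 : Real.sin (θ * ((N + (s + 1) : ℕ) : ℝ) / 2) * Real.sin (θ * ((N - (s + 1) : ℕ) : ℝ) / 2)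
      = Real.sin (Real.pi * r) ^ 2 - Real.sin (Real.pi * r * ((s + 1 : ℕ) / N)) ^ 2 := by
    have a1 : θ * ((N + (s + 1) : ℕ) : ℝ) / 2 = Real.pi * r + Real.pi * r * ((s + 1 : ℕ) / N) := by
      rw [hθ]; push_cast; field_simp
    have a2 : θ * ((N - (s + 1) : ℕ) : ℝ) / 2 = Real.pi * r - Real.pi * r * ((s + 1 : ℕ) / N) := by
      rw [hθ, Nat.cast_sub hsN]; push_cast; field_simp
    rw [a1, a2, Real.sin_add, Real.sin_sub]
    linear_combination (-Real.sin (Real.pi * r * ((s + 1 : ℕ) / N)) ^ 2) *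
      Real.sin_sq_add_cos_sq (Real.pi * r) + Real.sin (Real.pi * r) ^ 2 *
      Real.sin_sq_add_cos_sq (Real.pi * r * ((s + 1 : ℕ) / N))
  have e2 := congrArg (fun x : ℝ => (x : ℂ)) e1
  simp only [Complex.ofReal_mul, Complex.ofReal_sub, Complex.ofReal_pow] at e2
  rw [cycFactor, Complex.ofReal_mul, Complex.ofReal_sub, Complex.ofReal_pow, Complex.ofReal_pow]
  push_cast at e2 ⊢
  linear_combination (4 * Complex.I ^ 2) * e2 + 4 * (Complex.sin (Real.pi * r) ^ 2 -
    Complex.sin (Real.pi * r * ((s + 1) / N)) ^ 2) * Complex.I_sq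

/-! ### Bounds for single factors -/

theorem abs_sin_sq_sub_le (x y : ℝ) : |Real.sin x ^ 2 - Real.sin y ^ 2| ≤ 2 * |x - y| := by
  have h1 : |Real.sin x - Real.sin y| ≤ |x - y| := by
    have := Real.lipschitzWith_sin.dist_le_mul x y
    simpa [Real.dist_eq] using this
  have h2 : |Real.sin x + Real.sin y| ≤ 2 :=
    (abs_add_le _ _).trans (by linarith [Real.abs_sin_le_one x, Real.abs_sin_le_one y])
  rw [sq_sub_sq, abs_mul]
  exact mul_le_mul h2 h1 (abs_nonneg _) zero_le_two

/-- The constant is `4 · (2 · 4 + 2 · 4)`, with `π` bounded by `4`. -/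
theorem abs_cycFactor_sub_le (r : ℝ) {N k : ℕ} (hk : k ≤ N) :
    |cycFactor r N k - cycFactor 1 N k| ≤ 64 * |r - 1| := by
  have hx0 : (0 : ℝ) ≤ (k : ℝ) / N := by positivity
  have hx1 : (k : ℝ) / N ≤ 1 := div_le_one_of_le₀ (by exact_mod_cast hk) (by positivity)
  have h1 := abs_sin_sq_sub_le (Real.pi * r * (k / N)) (Real.pi * 1 * (k / N))
  have h2 := abs_sin_sq_sub_le (Real.pi * r) (Real.pi * 1)
  have hpi := Real.pi_lt_four
  have hpi0 := Real.pi_pos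
  have e1 : |Real.pi * r * (k / N) - Real.pi * 1 * (k / N)| ≤ 4 * |r - 1| := by
    rw [show Real.pi * r * (k / N) - Real.pi * 1 * (k / N) = (Real.pi * (k / N)) * (r - 1) by ring,
      abs_mul, abs_of_nonneg (by positivity)]
    refine mul_le_mul_of_nonneg_right ?_ (abs_nonneg _)
    nlinarith
  have e2 : |Real.pi * r - Real.pi * 1| ≤ 4 * |r - 1| := by
    rw [← mul_sub, abs_mul, abs_of_pos hpi0]
    exact mul_le_mul_of_nonneg_right hpi.le (abs_nonneg _)
  have e3 : cycFactor r N k - cycFactor 1 N k =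
      4 * ((Real.sin (Real.pi * r * (k / N)) ^ 2 - Real.sin (Real.pi * 1 * (k / N)) ^ 2) -
        (Real.sin (Real.pi * r) ^ 2 - Real.sin (Real.pi * 1) ^ 2)) := by
    simp only [cycFactor]; ring
  rw [e3, abs_mul, abs_of_pos (by norm_num : (0 : ℝ) < 4)]
  have := abs_sub (Real.sin (Real.pi * r * (k / N)) ^ 2 - Real.sin (Real.pi * 1 * (k / N)) ^ 2)
    (Real.sin (Real.pi * r) ^ 2 - Real.sin (Real.pi * 1) ^ 2)
  linarith

theorem cycFactor_one (N k : ℕ) : cycFactor 1 N k = 4 * Real.sin (Real.pi * (k / N)) ^ 2 := by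
  simp [cycFactor]

theorem cycFactor_one_nonneg (N k : ℕ) : 0 ≤ cycFactor 1 N k := by
  rw [cycFactor_one]; positivity

theorem cycProd_one_nonneg (N m : ℕ) : 0 ≤ cycProd 1 N m :=
  Finset.prod_nonneg fun _ _ => cycFactor_one_nonneg _ _

/-- For `x ≤ 1/12`, `sin(πx) ≤ πx ≤ 1/3` and `4/9 < 9/20`; the other end follows from `sin(π - y) =
sin y`. The margin below `1/2` is what a perturbation by `64/1280 = 1/20` uses up. -/
theorem cycFactor_one_le_of_edge {N k : ℕ} (hN : 0 < N) (hk : k ≤ N)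
    (h : 12 * k ≤ N ∨ 11 * N ≤ 12 * k) : cycFactor 1 N k ≤ 9 / 20 := by
  have hN' : (0 : ℝ) < N := by exact_mod_cast hN
  have key : ∀ x : ℝ, 0 ≤ x → x ≤ 1 / 12 → 4 * Real.sin (Real.pi * x) ^ 2 ≤ 9 / 20 := by
    intro x h0 h1
    have hpi := Real.pi_lt_four
    have hpi0 := Real.pi_pos
    have a1 : Real.sin (Real.pi * x) ≤ Real.pi * x := Real.sin_le (by positivity)
    have a2 : 0 ≤ Real.sin (Real.pi * x) :=
      Real.sin_nonneg_of_nonneg_of_le_pi (by positivity) (by nlinarith)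
    have a3 : Real.pi * x ≤ 1 / 3 := by nlinarith
    nlinarith
  rw [cycFactor_one]
  rcases h with h | h
  · refine key _ (by positivity) ?_
    rw [div_le_div_iff₀ hN' (by norm_num)]
    have : (12 : ℝ) * k ≤ N := by exact_mod_cast h
    linarith
  · have h1 : (k : ℝ) ≤ N := by exact_mod_cast hk
    have h2 : (11 : ℝ) * N ≤ 12 * k := by exact_mod_cast h
    have := key (1 - k / N) (by rw [sub_nonneg]; exact div_le_one_of_le₀ h1 hN'.le)
      (by rw [sub_le_iff_le_add, ← sub_le_iff_le_add', le_div_iff₀ hN']; linarith)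
    rwa [mul_sub, mul_one, Real.sin_pi_sub] at this

theorem abs_cycFactor_le_half {r : ℝ} (hr : |r - 1| ≤ 1 / 1280) {N k : ℕ} (hN : 0 < N) (hk : k ≤ N)
    (h : 12 * k ≤ N ∨ 11 * N ≤ 12 * k) : |cycFactor r N k| ≤ 1 / 2 := by
  have h1 := abs_cycFactor_sub_le r hk
  have h2 := cycFactor_one_le_of_edge hN hk h
  have h3 := cycFactor_one_nonneg N k
  rw [abs_le] at h1 ⊢
  constructor <;> linarith [h1.1, h1.2]

theorem two_mul_le_sin_pi_mul {x : ℝ} (h0 : 0 ≤ x) (h1 : x ≤ 1 / 2) :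
    2 * x ≤ Real.sin (Real.pi * x) := by
  have hpi := Real.pi_pos
  have := Real.mul_le_sin (x := Real.pi * x) (by positivity) (by nlinarith)
  calc 2 * x = 2 / Real.pi * (Real.pi * x) := by field_simp
    _ ≤ _ := this

theorem cycFactor_one_ge_of_bulk {η : ℝ} (hη : 0 ≤ η) {N k : ℕ} (hN : 0 < N)
    (h1 : η * N ≤ k) (h2 : (k : ℝ) ≤ (1 - η) * N) : 16 * η ^ 2 ≤ cycFactor 1 N k := by
  have hN' : (0 : ℝ) < N := by exact_mod_cast hN
  have a1 : η ≤ (k : ℝ) / N := by rwa [le_div_iff₀ hN']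
  have a2 : (k : ℝ) / N ≤ 1 - η := by rwa [div_le_iff₀ hN']
  have key : 2 * η ≤ Real.sin (Real.pi * (k / N)) := by
    rcases le_total ((k : ℝ) / N) (1 / 2) with h | h
    · linarith [two_mul_le_sin_pi_mul (by linarith) h]
    · have := two_mul_le_sin_pi_mul (x := 1 - k / N) (by linarith) (by linarith)
      rw [mul_sub Real.pi, mul_one, Real.sin_pi_sub] at this
      linarith
  rw [cycFactor_one]
  nlinarith

/-! ### Lower bounds for the initial product -/

theorem prod_add_ge {γ x : ℝ} (h0 : 0 ≤ γ) (h1 : γ ≤ 1) (hx : γ ≤ x) (n : ℕ) :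
    γ * (n.factorial / 2 ^ n) ≤ ∏ s ∈ Finset.range n, ((s : ℝ) + x) := by
  induction n with
  | zero => simpa using h1
  | succ n ih =>
    rw [Finset.prod_range_succ, Nat.factorial_succ, pow_succ]
    rcases n with _ | n
    · simp; linarith
    · have hp : 0 ≤ γ * (((n + 1).factorial : ℝ) / 2 ^ (n + 1)) := by positivity
      calc γ * (((n + 1 + 1) * (n + 1).factorial : ℕ) / (2 ^ (n + 1) * 2) : ℝ)
          = γ * (((n + 1).factorial : ℝ) / 2 ^ (n + 1)) * (((n : ℝ) + 2) / 2) := by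
            push_cast; field_simp; ring
        _ ≤ (∏ s ∈ Finset.range (n + 1), ((s : ℝ) + x)) * (((n + 1 : ℕ) : ℝ) + x) := by
            refine mul_le_mul ih ?_ (by positivity) (hp.trans ih)
            push_cast
            have : (0 : ℝ) ≤ n := by positivity
            linarith

/-- The product is cut at `b = ⌊β⌋`. The distances to `β` are `s + x` on the left and `s + 1 - x` on
the right, with `x` the fractional part, so each side is at least `γ` times a factorial over a power
of two. The two factorials are recombined through `binom(b+d, d) ≤ 2^(b+d)`, whence the `4^K`. -/
theorem prod_abs_sub_ge {γ β : ℝ} (h0 : 0 ≤ γ) (hβ : 0 ≤ β) (h1 : γ ≤ Int.fract β)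
    (h2 : Int.fract β ≤ 1 - γ) {K : ℕ} (hK : β ≤ K) :
    γ ^ 2 * (K.factorial / 4 ^ K) ≤ ∏ s ∈ Finset.range K, |(((s + 1 : ℕ) : ℝ)) - β| := by
  obtain ⟨b, hb⟩ : ∃ b : ℕ, b = ⌊β⌋₊ := ⟨_, rfl⟩
  have hfr : Int.fract β = β - b := by
    rw [Int.fract, hb, ← natCast_floor_eq_intCast_floor hβ]
  have hbK : b ≤ K := by
    rw [hb]; exact_mod_cast (Nat.floor_le hβ).trans hK
  obtain ⟨d, rfl⟩ := Nat.exists_eq_add_of_le hbK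
  have hγ1 : γ ≤ 1 := by linarith [Int.fract_nonneg β]
  set x := Int.fract β with hx
  have hβx : β = b + x := by linarith
  have hx0 : 0 ≤ x := h0.trans h1
  have e1 : ∏ s ∈ Finset.range b, |(((s + 1 : ℕ) : ℝ)) - β| =
      ∏ s ∈ Finset.range b, ((s : ℝ) + x) := by
    rw [← Finset.prod_range_reflect]
    refine Finset.prod_congr rfl fun s hs => ?_
    have hs' := Finset.mem_range.mp hs
    rw [show b - 1 - s + 1 = b - s by omega, Nat.cast_sub hs'.le, hβx, abs_sub_comm, abs_of_nonneg]
    · ring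
    · have : (0 : ℝ) ≤ s := by positivity
      linarith
  have e2 : ∏ s ∈ Finset.range d, |(((b + s + 1 : ℕ) : ℝ)) - β| =
      ∏ s ∈ Finset.range d, ((s : ℝ) + (1 - x)) := by
    refine Finset.prod_congr rfl fun s _ => ?_
    have : (0 : ℝ) ≤ s := by positivity
    rw [hβx, abs_of_nonneg]
    · push_cast; ring
    · push_cast; linarith
  rw [Finset.prod_range_add, e1, e2]
  have p1 := prod_add_ge h0 hγ1 h1 b
  have p2 := prod_add_ge h0 hγ1 (show γ ≤ 1 - x by linarith) d
  refine le_trans ?_ (mul_le_mul p1 p2 (by positivity)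
    (le_trans (by positivity) p1))
  have hc : ((b + d).factorial : ℝ) ≤ 2 ^ (b + d) * (b.factorial * d.factorial) := by
    have h3 := Nat.add_choose_mul_factorial_mul_factorial b d
    have h4 : (b + d).choose d ≤ 2 ^ (b + d) := Nat.choose_le_two_pow _ _
    have : (b + d).factorial ≤ 2 ^ (b + d) * (b.factorial * d.factorial) := by
      rw [← h3, mul_assoc]
      exact Nat.mul_le_mul_right _ h4
    exact_mod_cast this
  have : γ * ((b.factorial : ℝ) / 2 ^ b) * (γ * ((d.factorial : ℝ) / 2 ^ d)) =
      γ ^ 2 * ((2 ^ (b + d) * (b.factorial * d.factorial)) / 4 ^ (b + d)) := by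
    rw [show (4 : ℝ) = 2 * 2 by norm_num, mul_pow, pow_add]
    field_simp
  rw [this]
  gcongr

/-- One term of the exponential series gives `(ηN)^K / K! ≤ e^{ηN}`, and `η^K ≥ η^{ηN}` because `η ≤
1`. The rate `η - η log η` tends to `0` with `η`, so the initial product costs only a small
exponential. -/
theorem factorial_div_pow_ge {η : ℝ} (h0 : 0 < η) (h1 : η ≤ 1) {N K : ℕ} (hN : 0 < N)
    (hK : (K : ℝ) ≤ η * N) :
    Real.exp (-(η + Real.negMulLog η) * N) ≤ K.factorial / (N : ℝ) ^ K := by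
  have hN' : (0 : ℝ) < N := by exact_mod_cast hN
  have a1 : (η * N) ^ K / K.factorial ≤ Real.exp (η * N) :=
    Real.pow_div_factorial_le_exp _ (by positivity) _
  have hl : Real.log η ≤ 0 := Real.log_nonpos h0.le h1
  have a2 : Real.exp (Real.log η * (η * N)) ≤ η ^ K := by
    rw [← Real.rpow_natCast, Real.rpow_def_of_pos h0]
    exact Real.exp_le_exp.mpr (mul_le_mul_of_nonpos_left hK hl)
  have hf : (0 : ℝ) < K.factorial := by positivity
  rw [div_le_iff₀ hf, mul_pow] at a1
  rw [le_div_iff₀ (by positivity)]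
  calc Real.exp (-(η + Real.negMulLog η) * N) * (N : ℝ) ^ K
      = Real.exp (-(η * N)) * (Real.exp (Real.log η * (η * N)) * (N : ℝ) ^ K) := by
        rw [← mul_assoc, ← Real.exp_add]
        congr 2
        simp only [Real.negMulLog]; ring
    _ ≤ Real.exp (-(η * N)) * (η ^ K * (N : ℝ) ^ K) := by gcongr
    _ ≤ Real.exp (-(η * N)) * (Real.exp (η * N) * K.factorial) := by gcongr
    _ = K.factorial := by rw [← mul_assoc, ← Real.exp_add]; simp

theorem prod_succ_div (N K : ℕ) :
    ∏ s ∈ Finset.range K, (((s + 1 : ℕ) : ℝ) / N) = K.factorial / (N : ℝ) ^ K := by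
  rw [Finset.prod_div_distrib, Finset.prod_const, Finset.card_range,
    ← Finset.prod_range_add_one_eq_factorial]
  push_cast
  rfl

theorem cycProd_one_ge {η : ℝ} (h0 : 0 < η) (h1 : η ≤ 1 / 2) {N K : ℕ} (hN : 0 < N)
    (hK : (K : ℝ) ≤ η * N) :
    Real.exp (-(2 * (η + Real.negMulLog η)) * N) ≤ cycProd 1 N K := by
  have hN' : (0 : ℝ) < N := by exact_mod_cast hN
  have a := factorial_div_pow_ge h0 (by linarith) hN hK
  calc Real.exp (-(2 * (η + Real.negMulLog η)) * N)
      = Real.exp (-(η + Real.negMulLog η) * N) ^ 2 := by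
        rw [← Real.exp_nat_mul]; congr 1; push_cast; ring
    _ ≤ (K.factorial / (N : ℝ) ^ K) ^ 2 := by gcongr
    _ = ∏ s ∈ Finset.range K, (((s + 1 : ℕ) : ℝ) / N) ^ 2 := by
        rw [← prod_succ_div, Finset.prod_pow]
    _ ≤ cycProd 1 N K := by
        refine Finset.prod_le_prod (fun _ _ => by positivity) fun s hs => ?_
        have hs' : ((s + 1 : ℕ) : ℝ) ≤ K := by exact_mod_cast Finset.mem_range.mp hs
        have b1 : ((s + 1 : ℕ) : ℝ) / N ≤ 1 / 2 := by
          rw [div_le_iff₀ hN']; nlinarith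
        have b2 := two_mul_le_sin_pi_mul (x := ((s + 1 : ℕ) : ℝ) / N) (by positivity) b1
        rw [cycFactor_one]
        have b3 : (0 : ℝ) ≤ ((s + 1 : ℕ) : ℝ) / N := by positivity
        nlinarith

theorem two_mul_abs_le_abs_sin {x : ℝ} (h : |x| ≤ 1 / 2) : 2 * |x| ≤ |Real.sin (Real.pi * x)| := by
  have h1 := two_mul_le_sin_pi_mul (abs_nonneg x) h
  refine h1.trans ?_
  rcases abs_cases x with ⟨hx, -⟩ | ⟨hx, -⟩
  · rw [hx]; exact le_abs_self _
  · rw [hx, mul_neg, Real.sin_neg]; exact neg_le_abs _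

/-- With `x = k/N` the factor is `4 sin(π(rx + (r-1))) sin(π(rx - (r-1)))`. Both arguments stay
within `π/2`, where `|sin(πy)| ≥ 2|y|`; one of them vanishes at `k = |r-1|N/r`, which produces the
distance on the left. The `4` is kept to offset the `4^K` lost in `prod_abs_sub_ge`. -/
theorem abs_cycFactor_ge {r : ℝ} (hr : |r - 1| ≤ 1 / 4) {N k : ℕ} (hN : 0 < N)
    (hk : 12 * k ≤ N) :
    (k : ℝ) / N * (4 * |(k : ℝ) - |r - 1| / r * N| / N) ≤ |cycFactor r N k| := by
  have hN' : (0 : ℝ) < N := by exact_mod_cast hN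
  obtain ⟨hr1, hr2⟩ := abs_le.mp hr
  have hr0 : 0 < r := by linarith
  have hk' : (k : ℝ) / N ≤ 1 / 12 := by
    rw [div_le_div_iff₀ hN' (by norm_num)]
    have : (12 : ℝ) * k ≤ N := by exact_mod_cast hk
    linarith
  have hk0 : 0 ≤ (k : ℝ) / N := by positivity
  set x := (k : ℝ) / N with hx
  have hs : Real.sin (Real.pi * r) ^ 2 = Real.sin (Real.pi * (r - 1)) ^ 2 := by
    rw [mul_sub, mul_one, Real.sin_sub_pi, neg_sq]
  have e1 : cycFactor r N k =
      4 * (Real.sin (Real.pi * (r * x + (r - 1))) * Real.sin (Real.pi * (r * x - (r - 1)))) := by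
    rw [cycFactor, hs, ← hx, mul_add, mul_sub Real.pi (r * x), Real.sin_add, Real.sin_sub,
      ← mul_assoc Real.pi r x]
    linear_combination (-4 * Real.sin (Real.pi * r * x) ^ 2) *
      Real.sin_sq_add_cos_sq (Real.pi * (r - 1)) + 4 * Real.sin (Real.pi * (r - 1)) ^ 2 *
      Real.sin_sq_add_cos_sq (Real.pi * r * x)
  have hrx : 0 ≤ r * x := by positivity
  have hrx' : r * x ≤ 1 / 4 := by nlinarith
  have b1 := two_mul_abs_le_abs_sin (x := r * x + (r - 1)) (abs_le.mpr ⟨by linarith, by linarith⟩)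
  have b2 := two_mul_abs_le_abs_sin (x := r * x - (r - 1)) (abs_le.mpr ⟨by linarith, by linarith⟩)
  have b3 := mul_le_mul b1 b2 (by positivity) (abs_nonneg _)
  rw [e1, abs_mul, abs_mul, abs_of_pos (by norm_num : (0 : ℝ) < 4)]
  have e2 : |r * x + (r - 1)| * |r * x - (r - 1)| = (r * x + |r - 1|) * |r * x - (|r - 1|)| := by
    rw [← abs_mul]
    have : r * x + |r - 1| = |r * x + (|r - 1|)| := (abs_of_nonneg (by positivity)).symm
    rw [this, ← abs_mul]
    congr 1
    have := sq_abs (r - 1)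
    linear_combination this
  have e3 : |r * x - (|r - 1|)| = r * (|(k : ℝ) - |r - 1| / r * N| / N) := by
    rw [show r * x - |r - 1| = r / N * ((k : ℝ) - |r - 1| / r * N) by rw [hx]; field_simp,
      abs_mul, abs_of_pos (by positivity)]
    ring
  set w := |(k : ℝ) - |r - 1| / r * N| / N with hw
  have hw0 : 0 ≤ w := by positivity
  have e4 : 4 * |(k : ℝ) - |r - 1| / r * N| / N = 4 * w := by rw [hw]; ring
  rw [e4]
  have e5 : x * w ≤ 4 * ((r * x + |r - 1|) * (r * w)) := by
    have : x * w ≤ 4 * (r * x * (r * w)) := by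
      have h4 : 1 ≤ 4 * (r * r) := by nlinarith
      have h5 : 0 ≤ x * w := by positivity
      nlinarith
    have h6 : 0 ≤ |r - 1| * (r * w) := by positivity
    nlinarith
  rw [← e3, ← e2] at e5
  nlinarith

theorem abs_cycProd_ge {r γ η : ℝ} (hr : |r - 1| ≤ 1 / 4) (h0 : 0 < η) (h1 : η ≤ 1 / 12)
    (hγ : 0 ≤ γ) {N K : ℕ} (hN : 0 < N) (hK : (K : ℝ) ≤ η * N)
    (hβK : |r - 1| / r * N ≤ K) (hf1 : γ ≤ Int.fract (|r - 1| / r * N))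
    (hf2 : Int.fract (|r - 1| / r * N) ≤ 1 - γ) :
    γ ^ 2 * Real.exp (-(2 * (η + Real.negMulLog η)) * N) ≤ |cycProd r N K| := by
  have hN' : (0 : ℝ) < N := by exact_mod_cast hN
  have hr0 : 0 < r := by linarith [(abs_le.mp hr).1]
  have a := factorial_div_pow_ge h0 (by linarith) hN hK
  have hp := prod_abs_sub_ge hγ (by positivity) hf1 hf2 hβK
  calc γ ^ 2 * Real.exp (-(2 * (η + Real.negMulLog η)) * N)
      = γ ^ 2 * Real.exp (-(η + Real.negMulLog η) * N) ^ 2 := by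
        rw [← Real.exp_nat_mul]; congr 2; push_cast; ring
    _ ≤ γ ^ 2 * (K.factorial / (N : ℝ) ^ K) ^ 2 := by gcongr
    _ = (K.factorial / (N : ℝ) ^ K) *
        (4 ^ K * (γ ^ 2 * (K.factorial / 4 ^ K)) / (N : ℝ) ^ K) := by field_simp
    _ ≤ (K.factorial / (N : ℝ) ^ K) *
        (4 ^ K * (∏ s ∈ Finset.range K, |(((s + 1 : ℕ) : ℝ)) - |r - 1| / r * N|) / (N : ℝ) ^ K) := by
        gcongr
    _ = ∏ s ∈ Finset.range K, (((s + 1 : ℕ) : ℝ) / N *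
          (4 * |(((s + 1 : ℕ) : ℝ)) - |r - 1| / r * N| / N)) := by
        rw [Finset.prod_mul_distrib, prod_succ_div, Finset.prod_div_distrib,
          Finset.prod_mul_distrib]
        simp
    _ ≤ |cycProd r N K| := by
        rw [cycProd, Finset.abs_prod]
        refine Finset.prod_le_prod (fun _ _ => by positivity) fun s hs => ?_
        have hs' : ((s + 1 : ℕ) : ℝ) ≤ K := by exact_mod_cast Finset.mem_range.mp hs
        refine abs_cycFactor_ge hr hN ?_
        have : (12 : ℝ) * ((s + 1 : ℕ) : ℝ) ≤ N := by nlinarith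
        exact_mod_cast this

/-! ### Separation of the bulk -/

/-- The product of the factors with index in `(K, m]`. -/
def bulkProd (r : ℝ) (N K m : ℕ) : ℝ := ∏ s ∈ Finset.Ico K m, cycFactor r N (s + 1)

/-- The sum of the bulk products. -/
def bulkSum (r : ℝ) (N K L : ℕ) : ℝ := ∑ m ∈ Finset.Ico K (L + 1), bulkProd r N K m

theorem cycProd_mul_bulkProd (r : ℝ) (N : ℕ) {K m : ℕ} (h : K ≤ m) :
    cycProd r N K * bulkProd r N K m = cycProd r N m :=
  Finset.prod_range_mul_prod_Ico _ h

theorem abs_cycProd_le_one {r : ℝ} (hr : |r - 1| ≤ 1 / 1280) {N m : ℕ} (hm : 12 * m ≤ N) :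
    |cycProd r N m| ≤ 1 := by
  rw [cycProd, Finset.abs_prod]
  refine Finset.prod_le_one (fun _ _ => abs_nonneg _) fun s hs => ?_
  have := Finset.mem_range.mp hs
  exact (abs_cycFactor_le_half hr (by omega) (by omega) (Or.inl (by omega))).trans (by norm_num)

theorem abs_cycProd_le_pow_mul {r : ℝ} (hr : |r - 1| ≤ 1 / 1280) {N m m' : ℕ}
    (hm : 11 * N < 12 * (m + 1)) (hmm : m ≤ m') (hm' : m' ≤ N) :
    |cycProd r N m'| ≤ |cycProd r N m| * (1 / 2) ^ (m' - m) := by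
  rw [← cycProd_mul_bulkProd r N hmm, abs_mul]
  refine mul_le_mul_of_nonneg_left ?_ (abs_nonneg _)
  rw [bulkProd, Finset.abs_prod, ← Nat.card_Ico, ← Finset.prod_const]
  refine Finset.prod_le_prod (fun _ _ => abs_nonneg _) fun s hs => ?_
  have := Finset.mem_Ico.mp hs
  exact abs_cycFactor_le_half hr (by omega) (by omega) (Or.inr (by omega))

/-- The lower and upper ends of the bulk, and a point between them. -/
structure IsBulk (η : ℝ) (N K m₁ L : ℕ) : Prop where
  pos : 0 < N
  K_le : (K : ℝ) ≤ η * N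
  lt_K : η * N < K + 1
  L_le : (L : ℝ) ≤ (1 - η) * N
  lt_L : (1 - η) * N < L + 1
  le_m : 12 * m₁ ≤ 11 * N
  lt_m : 11 * N < 12 * (m₁ + 1)

theorem isBulk_floor {η : ℝ} (h0 : 0 ≤ η) (h1 : η ≤ 1) {N : ℕ} (hN : 0 < N) :
    IsBulk η N ⌊η * N⌋₊ (11 * N / 12) ⌊(1 - η) * N⌋₊ where
  pos := hN
  K_le := Nat.floor_le (by positivity)
  lt_K := Nat.lt_floor_add_one _
  L_le := Nat.floor_le (mul_nonneg (by linarith) (by positivity))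
  lt_L := Nat.lt_floor_add_one _
  le_m := Nat.mul_div_le _ _
  lt_m := Nat.lt_mul_div_succ _ (by norm_num)

/-- The additive error `64|r-1|` becomes relative because the factor at `r = 1` is at least `16η²`.
-/
theorem cycFactor_bulk_bounds {η : ℝ} (h0 : 0 < η) (r : ℝ) {N k : ℕ} (hN : 0 < N) (hk : k ≤ N)
    (h1 : η * N ≤ k) (h2 : (k : ℝ) ≤ (1 - η) * N) :
    (1 - 4 * |r - 1| / η ^ 2) * cycFactor 1 N k ≤ cycFactor r N k ∧
      cycFactor r N k ≤ (1 + 4 * |r - 1| / η ^ 2) * cycFactor 1 N k := by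
  have a := abs_le.mp (abs_cycFactor_sub_le r hk)
  have b := cycFactor_one_ge_of_bulk h0.le hN h1 h2
  have c : 64 * |r - 1| ≤ 4 * |r - 1| / η ^ 2 * cycFactor 1 N k := by
    calc 64 * |r - 1| = 4 * |r - 1| / η ^ 2 * (16 * η ^ 2) := by field_simp; ring
      _ ≤ _ := by gcongr
  constructor <;> linarith [a.1, a.2]

theorem bulkProd_bounds {η : ℝ} (h0 : 0 < η) {r : ℝ} (hr : 4 * |r - 1| / η ^ 2 ≤ 1)
    {N K m₁ L m : ℕ} (hb : IsBulk η N K m₁ L) (hm : m ≤ L) :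
    (1 - 4 * |r - 1| / η ^ 2) ^ N * bulkProd 1 N K m ≤ bulkProd r N K m ∧
      bulkProd r N K m ≤ (1 + 4 * |r - 1| / η ^ 2) ^ N * bulkProd 1 N K m := by
  have hN' : (0 : ℝ) < N := by exact_mod_cast hb.pos
  have hLN : L ≤ N := by
    have : (L : ℝ) ≤ N := by nlinarith [hb.L_le]
    exact_mod_cast this
  have hκ : 0 ≤ 4 * |r - 1| / η ^ 2 := by positivity
  have key : ∀ s ∈ Finset.Ico K m, (1 - 4 * |r - 1| / η ^ 2) * cycFactor 1 N (s + 1) ≤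
      cycFactor r N (s + 1) ∧
      cycFactor r N (s + 1) ≤ (1 + 4 * |r - 1| / η ^ 2) * cycFactor 1 N (s + 1) := by
    intro s hs
    have hs' := Finset.mem_Ico.mp hs
    refine cycFactor_bulk_bounds h0 r hb.pos (by omega) ?_ ?_
    · have : (K : ℝ) + 1 ≤ ((s + 1 : ℕ) : ℝ) := by exact_mod_cast Nat.succ_le_succ hs'.1
      linarith [hb.lt_K]
    · have : ((s + 1 : ℕ) : ℝ) ≤ L := by exact_mod_cast (show s + 1 ≤ L by omega)
      linarith [hb.L_le]
  have hq : 0 ≤ bulkProd 1 N K m := Finset.prod_nonneg fun _ _ => cycFactor_one_nonneg _ _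
  constructor
  · calc (1 - 4 * |r - 1| / η ^ 2) ^ N * bulkProd 1 N K m
        ≤ (1 - 4 * |r - 1| / η ^ 2) ^ (m - K) * bulkProd 1 N K m := by
          refine mul_le_mul_of_nonneg_right ?_ hq
          exact pow_le_pow_of_le_one (by linarith) (by linarith) (by omega)
      _ = ∏ s ∈ Finset.Ico K m, (1 - 4 * |r - 1| / η ^ 2) * cycFactor 1 N (s + 1) := by
          rw [Finset.prod_mul_distrib, Finset.prod_const, Nat.card_Ico, bulkProd]
      _ ≤ bulkProd r N K m := Finset.prod_le_prod
          (fun s _ => mul_nonneg (by linarith) (cycFactor_one_nonneg _ _)) fun s hs => (key s hs).1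
  · calc bulkProd r N K m
        ≤ ∏ s ∈ Finset.Ico K m, (1 + 4 * |r - 1| / η ^ 2) * cycFactor 1 N (s + 1) :=
          Finset.prod_le_prod (fun s hs => le_trans
            (mul_nonneg (by linarith) (cycFactor_one_nonneg _ _)) (key s hs).1)
            fun s hs => (key s hs).2
      _ = (1 + 4 * |r - 1| / η ^ 2) ^ (m - K) * bulkProd 1 N K m := by
          rw [Finset.prod_mul_distrib, Finset.prod_const, Nat.card_Ico, bulkProd]
      _ ≤ _ := by
          refine mul_le_mul_of_nonneg_right ?_ hq
          exact pow_le_pow_right₀ (by linarith) (by omega)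

theorem bulkSum_bounds {η : ℝ} (h0 : 0 < η) {r : ℝ} (hr : 4 * |r - 1| / η ^ 2 ≤ 1)
    {N K m₁ L : ℕ} (hb : IsBulk η N K m₁ L) :
    (1 - 4 * |r - 1| / η ^ 2) ^ N * bulkSum 1 N K L ≤ bulkSum r N K L ∧
      bulkSum r N K L ≤ (1 + 4 * |r - 1| / η ^ 2) ^ N * bulkSum 1 N K L := by
  rw [bulkSum, Finset.mul_sum, Finset.mul_sum, bulkSum]
  exact ⟨Finset.sum_le_sum fun m hm => (bulkProd_bounds h0 hr hb
      (Nat.lt_succ_iff.mp (Finset.mem_Ico.mp hm).2)).1,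
    Finset.sum_le_sum fun m hm => (bulkProd_bounds h0 hr hb
      (Nat.lt_succ_iff.mp (Finset.mem_Ico.mp hm).2)).2⟩

theorem bulkSum_one_nonneg (N K L : ℕ) : 0 ≤ bulkSum 1 N K L :=
  Finset.sum_nonneg fun _ _ => Finset.prod_nonneg fun _ _ => cycFactor_one_nonneg _ _

/-- Outside the bulk, the terms of the cyclotomic sum contribute little. -/
theorem abs_cycSum_sub_le {η : ℝ} (h0 : 0 < η) (h1 : η ≤ 1 / 24) {r : ℝ}
    (hr : |r - 1| ≤ 1 / 1280) (hr' : 4 * |r - 1| / η ^ 2 ≤ 1)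
    {N K m₁ L : ℕ} (hb : IsBulk η N K m₁ L) (hN : 24 ≤ N)
    (hlarge : (N : ℝ) * (1 / 2) ^ (L - m₁) ≤ 1 / 4) :
    |cycSum r N - cycProd r N K * bulkSum r N K L| ≤
      N + 1 / 4 * |cycProd r N K * bulkSum r N K L| := by
  have hN' : (0 : ℝ) < N := by exact_mod_cast hb.pos
  have hN24 : (24 : ℝ) ≤ N := by exact_mod_cast hN
  have hLN : L < N := by
    have : (L : ℝ) < N := by nlinarith [hb.L_le]
    exact_mod_cast this
  have hmL : m₁ ≤ L := by
    have h2 : (12 : ℝ) * m₁ ≤ 11 * N := by exact_mod_cast hb.le_m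
    have : (m₁ : ℝ) < L + 1 := by nlinarith [hb.lt_L]
    exact Nat.lt_succ_iff.mp (by exact_mod_cast this)
  have hK12 : 12 * K ≤ N := by
    have : (12 : ℝ) * K ≤ N := by nlinarith [hb.K_le]
    exact_mod_cast this
  have hKm : K ≤ m₁ := by
    have := hb.lt_m
    omega
  -- Bulk products at `r` inherit nonnegativity from `r = 1`, so the bulk sum dominates each of its
  -- terms.
  have hpos : ∀ m ≤ L, 0 ≤ bulkProd r N K m := fun m hm =>
    le_trans (mul_nonneg (pow_nonneg (by linarith) _)
      (Finset.prod_nonneg fun _ _ => cycFactor_one_nonneg _ _)) (bulkProd_bounds h0 hr' hb hm).1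
  have hsplit : cycSum r N = ∑ m ∈ Finset.range K, cycProd r N m +
      cycProd r N K * bulkSum r N K L + ∑ m ∈ Finset.Ico (L + 1) N, cycProd r N m := by
    rw [cycSum, ← Finset.sum_range_add_sum_Ico _ (show K ≤ N by omega),
      ← Finset.sum_Ico_consecutive _ (show K ≤ L + 1 by omega) (show L + 1 ≤ N by omega),
      ← add_assoc, bulkSum, Finset.mul_sum]
    congr 2
    exact Finset.sum_congr rfl fun m hm =>
      (cycProd_mul_bulkProd r N (Finset.mem_Ico.mp hm).1).symm
  have hinit : |∑ m ∈ Finset.range K, cycProd r N m| ≤ N := by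
    calc _ ≤ ∑ m ∈ Finset.range K, |cycProd r N m| := Finset.abs_sum_le_sum_abs _ _
      _ ≤ ∑ m ∈ Finset.range K, (1 : ℝ) := Finset.sum_le_sum fun m hm => by
          have := Finset.mem_range.mp hm
          exact abs_cycProd_le_one hr (by omega)
      _ = K := by simp
      _ ≤ N := by exact_mod_cast (show K ≤ N by omega)
  have hmid : |cycProd r N m₁| ≤ |cycProd r N K * bulkSum r N K L| := by
    rw [← cycProd_mul_bulkProd r N hKm, abs_mul, abs_mul]
    refine mul_le_mul_of_nonneg_left (abs_le_abs_of_nonneg (hpos _ hmL) ?_) (abs_nonneg _)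
    exact Finset.single_le_sum (f := fun m => bulkProd r N K m)
      (fun m hm => hpos m (Nat.lt_succ_iff.mp (Finset.mem_Ico.mp hm).2))
      (Finset.mem_Ico.mpr ⟨hKm, by omega⟩)
  -- Beyond `m₁` each factor at least halves the product, so every term past `L` is at most
  -- `(1/2)^(L - m₁)` times the term at `m₁`, which lies in the bulk.
  have hend : |∑ m ∈ Finset.Ico (L + 1) N, cycProd r N m| ≤
      1 / 4 * |cycProd r N K * bulkSum r N K L| := by
    calc _ ≤ ∑ m ∈ Finset.Ico (L + 1) N, |cycProd r N m| := Finset.abs_sum_le_sum_abs _ _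
      _ ≤ ∑ m ∈ Finset.Ico (L + 1) N, |cycProd r N m₁| * (1 / 2) ^ (L - m₁) :=
          Finset.sum_le_sum fun m hm => by
            have := Finset.mem_Ico.mp hm
            refine (abs_cycProd_le_pow_mul hr hb.lt_m (show m₁ ≤ m by omega) (by omega)).trans ?_
            refine mul_le_mul_of_nonneg_left ?_ (abs_nonneg _)
            exact pow_le_pow_of_le_one (by norm_num) (by norm_num) (by omega)
      _ = ((N - (L + 1) : ℕ) : ℝ) * (|cycProd r N m₁| * (1 / 2) ^ (L - m₁)) := by simp
      _ ≤ N * (|cycProd r N m₁| * (1 / 2) ^ (L - m₁)) := by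
          refine mul_le_mul_of_nonneg_right ?_ (by positivity)
          exact_mod_cast Nat.sub_le _ _
      _ = |cycProd r N m₁| * (N * (1 / 2) ^ (L - m₁)) := by ring
      _ ≤ |cycProd r N K * bulkSum r N K L| * (1 / 4) := by gcongr
      _ = _ := mul_comm _ _
  rw [hsplit, show ∑ m ∈ Finset.range K, cycProd r N m + cycProd r N K * bulkSum r N K L +
    ∑ m ∈ Finset.Ico (L + 1) N, cycProd r N m - cycProd r N K * bulkSum r N K L =
    ∑ m ∈ Finset.range K, cycProd r N m + ∑ m ∈ Finset.Ico (L + 1) N, cycProd r N m by ring]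
  exact (abs_add_le _ _).trans (add_le_add hinit hend)

/-! ### The cyclotomic sum at `r = 1` -/

theorem mul_sin_le_sin_mul {l x : ℝ} (h0 : 0 ≤ l) (h1 : l ≤ 1) (hx0 : 0 ≤ x) (hx : x ≤ Real.pi) :
    l * Real.sin x ≤ Real.sin (l * x) := by
  have := strictConcaveOn_sin_Icc.concaveOn.2 (x := 0) (y := x) ⟨le_rfl, Real.pi_pos.le⟩
    ⟨hx0, hx⟩ (show 0 ≤ 1 - l by linarith) h0 (by ring)
  simpa using this

/-- By concavity of the sine on `[0, π]`, each factor loses at most `(N/(N+1))²` when `N` becomes `N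
+ 1`, and `(N/(N+1))^N ≥ e^{-1}`. -/
theorem cycSum_one_succ_ge {N : ℕ} (hN : 0 < N) :
    Real.exp (-2) * cycSum 1 N ≤ cycSum 1 (N + 1) := by
  have hN' : (0 : ℝ) < N := by exact_mod_cast hN
  set l : ℝ := N / (N + 1) with hl
  have hl0 : 0 < l := by positivity
  have hl1 : l ≤ 1 := div_le_one_of_le₀ (by linarith) (by positivity)
  have hle : Real.exp (-1) ≤ l ^ N := by
    have h1 : Real.exp (-(1 / N)) ≤ l := by
      have h2 : (1 : ℝ) / N + 1 ≤ Real.exp (1 / N) := Real.add_one_le_exp _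
      rw [Real.exp_neg, hl, inv_le_comm₀ (Real.exp_pos _) (by positivity), inv_div]
      refine le_trans (le_of_eq ?_) h2
      field_simp
      ring
    calc Real.exp (-1) = Real.exp (-(1 / N)) ^ N := by
          rw [← Real.exp_nat_mul]; congr 1; field_simp
      _ ≤ l ^ N := by gcongr
  have key : ∀ m ∈ Finset.range N, Real.exp (-2) * cycProd 1 N m ≤ cycProd 1 (N + 1) m := by
    intro m hm
    have hm' := Finset.mem_range.mp hm
    calc Real.exp (-2) * cycProd 1 N m ≤ (l ^ 2) ^ m * cycProd 1 N m := by
          refine mul_le_mul_of_nonneg_right ?_ (cycProd_one_nonneg _ _)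
          calc Real.exp (-2) = Real.exp (-1) ^ 2 := by rw [← Real.exp_nat_mul]; norm_num
            _ ≤ (l ^ N) ^ 2 := by gcongr
            _ ≤ (l ^ m) ^ 2 := by
                have := pow_le_pow_of_le_one hl0.le hl1 hm'.le
                gcongr
            _ = (l ^ 2) ^ m := by rw [← pow_mul, ← pow_mul, mul_comm]
      _ = ∏ s ∈ Finset.range m, l ^ 2 * cycFactor 1 N (s + 1) := by
          rw [Finset.prod_mul_distrib, Finset.prod_const, Finset.card_range, cycProd]
      _ ≤ cycProd 1 (N + 1) m := by
          refine Finset.prod_le_prod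
            (fun s _ => mul_nonneg (by positivity) (cycFactor_one_nonneg _ _)) fun s hs => ?_
          have hs' : ((s + 1 : ℕ) : ℝ) ≤ N := by
            have := Finset.mem_range.mp hs
            exact_mod_cast (show s + 1 ≤ N by omega)
          have hx1 : ((s + 1 : ℕ) : ℝ) / N ≤ 1 := div_le_one_of_le₀ hs' hN'.le
          have hx0 : 0 ≤ ((s + 1 : ℕ) : ℝ) / N := by positivity
          have hpi := Real.pi_pos
          have h3 := mul_sin_le_sin_mul hl0.le hl1 (x := Real.pi * (((s + 1 : ℕ) : ℝ) / N))
            (by positivity) (by nlinarith)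
          have h4 : l * (Real.pi * (((s + 1 : ℕ) : ℝ) / N)) =
              Real.pi * (((s + 1 : ℕ) : ℝ) / ((N + 1 : ℕ) : ℝ)) := by
            rw [hl]; push_cast; field_simp
          have h5 : 0 ≤ Real.sin (Real.pi * (((s + 1 : ℕ) : ℝ) / N)) :=
            Real.sin_nonneg_of_nonneg_of_le_pi (by positivity) (by nlinarith)
          rw [h4] at h3
          rw [cycFactor_one, cycFactor_one]
          have h6 := pow_le_pow_left₀ (mul_nonneg hl0.le h5) h3 2
          nlinarith
  calc Real.exp (-2) * cycSum 1 N ≤ ∑ m ∈ Finset.range N, cycProd 1 (N + 1) m := by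
        rw [cycSum, Finset.mul_sum]; exact Finset.sum_le_sum key
    _ ≤ cycSum 1 (N + 1) := by
        rw [cycSum, Finset.sum_range_succ]
        linarith [cycProd_one_nonneg (N + 1) N]

/-- The factors are `|1 - ζ^k|²` for a primitive root of unity `ζ` of order `n + 1`, and the product
of the `1 - ζ^k` is `n + 1`. -/
theorem cycProd_one_last (n : ℕ) : cycProd 1 (n + 1) n = ((n : ℝ) + 1) ^ 2 := by
  have hμ := Complex.isPrimitiveRoot_exp (n + 1) n.succ_ne_zero
  have h := congrArg (fun z : ℂ => ‖z‖ ^ 2) hμ.prod_one_sub_pow_eq_order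
  have h1 : ‖(n : ℂ) + 1‖ = (n : ℝ) + 1 := by
    have := Complex.norm_natCast (n + 1)
    push_cast at this
    exact this
  simp only [h1, norm_prod, ← Finset.prod_pow] at h
  rw [← h, cycProd]
  refine Finset.prod_congr rfl fun s _ => ?_
  have h2 : Complex.exp (2 * Real.pi * Complex.I / ((n + 1 : ℕ) : ℂ)) ^ (s + 1) =
      Complex.exp (Complex.I * ((2 * (Real.pi * (((s + 1 : ℕ) : ℝ) / ((n + 1 : ℕ) : ℝ))) : ℝ) : ℂ)) := by
    rw [← Complex.exp_nat_mul]
    congr 1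
    push_cast
    ring
  rw [h2, norm_sub_rev, Complex.norm_exp_I_mul_ofReal_sub_one, cycFactor_one, Real.norm_eq_abs,
    sq_abs, mul_div_cancel_left₀ _ (two_ne_zero' ℝ)]
  ring

theorem one_le_cycSum_one {N : ℕ} (hN : 0 < N) : 1 ≤ cycSum 1 N := by
  have h := Finset.single_le_sum (f := fun m => cycProd 1 N m)
    (fun m _ => cycProd_one_nonneg N m) (Finset.mem_range.mpr hN)
  exact le_of_eq_of_le (by simp [cycProd]) h

/-- The last product is `N²`, although its final twelfth of factors are at most `1/2`; hence the
product at `11N/12` is already exponentially large. This growth is what makes the error `N` in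
`abs_cycSum_sub_le` negligible in the lower estimate. -/
theorem exp_le_cycSum_one {N : ℕ} (hN : 2 ≤ N) :
    Real.exp (Real.log 2 / 12 * N) ≤ cycSum 1 N := by
  obtain ⟨n, rfl⟩ : ∃ n, N = n + 1 := ⟨N - 1, by omega⟩
  set m₁ := 11 * (n + 1) / 12 with hm₁
  have hm₁' : m₁ ≤ n := by omega
  have h1 := abs_cycProd_le_pow_mul (r := 1) (by simp) (N := n + 1) (m := m₁) (m' := n)
    (Nat.lt_mul_div_succ _ (by norm_num)) hm₁' (by omega)
  rw [abs_of_nonneg (cycProd_one_nonneg _ _), abs_of_nonneg (cycProd_one_nonneg _ _),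
    cycProd_one_last] at h1
  have h2 : cycProd 1 (n + 1) m₁ ≤ cycSum 1 (n + 1) :=
    Finset.single_le_sum (f := fun m => cycProd 1 (n + 1) m)
      (fun m _ => cycProd_one_nonneg (n + 1) m) (Finset.mem_range.mpr (by omega))
  refine le_trans ?_ h2
  rw [one_div, inv_pow, ← div_eq_mul_inv, le_div_iff₀ (by positivity)] at h1
  refine le_trans ?_ h1
  have hn : (1 : ℝ) ≤ n := by exact_mod_cast (show 1 ≤ n by omega)
  have h3 : Real.exp (Real.log 2 / 12 * ((n + 1 : ℕ) : ℝ)) ≤ 2 * 2 ^ (n - m₁) := by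
    have h4 : (2 : ℝ) * 2 ^ (n - m₁) = Real.exp (Real.log 2 * ((n - m₁ + 1 : ℕ) : ℝ)) := by
      rw [← Real.rpow_def_of_pos two_pos, Real.rpow_natCast, pow_succ, mul_comm]
    rw [h4, Real.exp_le_exp]
    have h5 : ((n + 1 : ℕ) : ℝ) ≤ 12 * ((n - m₁ + 1 : ℕ) : ℝ) := by
      exact_mod_cast (show n + 1 ≤ 12 * (n - m₁ + 1) by omega)
    have := Real.log_pos one_lt_two
    nlinarith
  refine h3.trans (mul_le_mul_of_nonneg_right ?_ (by positivity))
  nlinarith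

/-! ### Comparison of `r` near `1` with `r = 1` -/

theorem eventually_mul_half_pow_le {η : ℝ} (h0 : 0 < η) (h1 : η ≤ 1 / 24) :
    ∀ᶠ N : ℕ in atTop, (N : ℝ) * (1 / 2) ^ (⌊(1 - η) * N⌋₊ - 11 * N / 12) ≤ 1 / 4 := by
  have ht : Tendsto (fun q : ℕ => 24 * ((q : ℝ) * (1 / 2) ^ q) + 23 * (1 / 2) ^ q) atTop
      (𝓝 (24 * 0 + 23 * 0)) :=
    ((tendsto_self_mul_const_pow_of_lt_one (by norm_num) (by norm_num)).const_mul 24).add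
      ((tendsto_pow_atTop_nhds_zero_of_lt_one (by norm_num) (by norm_num)).const_mul 23)
  have hev := ht.eventually (gt_mem_nhds (show (24 * 0 + 23 * 0 : ℝ) < 1 / 4 by norm_num))
  obtain ⟨q₀, hq₀⟩ := eventually_atTop.mp hev
  filter_upwards [eventually_ge_atTop (24 * q₀ + 1)] with N hN
  have hb := isBulk_floor h0.le (by linarith : η ≤ 1) (show 0 < N by omega)
  set L := ⌊(1 - η) * N⌋₊
  set m₁ := 11 * N / 12
  have hL := hb.lt_L
  have hm := hb.le_m
  have h23 : 23 * N < 24 * (L + 1) := by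
    have : (23 : ℝ) * N < 24 * (L + 1) := by
      have : (0 : ℝ) ≤ N := by positivity
      nlinarith
    exact_mod_cast this
  -- Since `η ≤ 1/24`, the gap between `11N/12` and the end of the bulk is at least about `N/24`.
  have hq : N / 24 ≤ L - m₁ := by omega
  have hNq : (N : ℝ) ≤ 24 * ((N / 24 : ℕ) : ℝ) + 23 := by
    exact_mod_cast (show N ≤ 24 * (N / 24) + 23 by omega)
  have := hq₀ (N / 24) (by omega)
  calc (N : ℝ) * (1 / 2) ^ (L - m₁) ≤ (24 * ((N / 24 : ℕ) : ℝ) + 23) * (1 / 2) ^ (N / 24) := by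
        refine mul_le_mul hNq (pow_le_pow_of_le_one (by norm_num) (by norm_num) hq)
          (by positivity) (by positivity)
    _ ≤ 1 / 4 := by linarith

theorem exists_small_eta {δ : ℝ} (hδ : 0 < δ) :
    ∃ η : ℝ, 0 < η ∧ η ≤ 1 / 24 ∧ 2 * (η + Real.negMulLog η) ≤ δ := by
  have h : ContinuousAt (fun η : ℝ => 2 * (η + Real.negMulLog η)) 0 :=
    (continuous_const.mul (continuous_id.add Real.continuous_negMulLog)).continuousAt
  have h1 : ∀ᶠ η : ℝ in 𝓝 0, 2 * (η + Real.negMulLog η) < δ :=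
    h.tendsto.eventually (gt_mem_nhds (by simpa using hδ))
  have h2 : ∀ᶠ η : ℝ in 𝓝[>] 0, 2 * (η + Real.negMulLog η) < δ ∧ η < 1 / 24 ∧ 0 < η :=
    (h1.filter_mono nhdsWithin_le_nhds).and
      (((gt_mem_nhds (by norm_num)).filter_mono nhdsWithin_le_nhds).and self_mem_nhdsWithin)
  obtain ⟨η, ha, hb, hc⟩ := h2.exists
  exact ⟨η, hc, hb.le, ha.le⟩

theorem eventually_abs_sub_one_le {ρ : ℝ} (hρ : 0 < ρ) : ∀ᶠ r : ℝ in 𝓝 1, |r - 1| ≤ ρ := by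
  filter_upwards [Metric.closedBall_mem_nhds (1 : ℝ) hρ] with r hr
  simpa [Real.dist_eq] using hr

theorem eventually_le_exp_mul {δ : ℝ} (hδ : 0 < δ) (A B : ℝ) :
    ∀ᶠ N : ℕ in atTop, A * N + B ≤ Real.exp (δ * N) := by
  have h1 : (fun x : ℝ => A * x + B) =o[atTop] fun x => Real.exp (δ * x) := by
    have ha := (isLittleO_pow_exp_pos_mul_atTop 1 hδ).const_mul_left A
    have hb := (isLittleO_pow_exp_pos_mul_atTop 0 hδ).const_mul_left B
    simpa using ha.add hb
  have h2 := (h1.bound one_pos).filter_mono (tendsto_natCast_atTop_atTop (R := ℝ))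
  filter_upwards [h2] with N hN
  simp only [one_mul, Real.norm_eq_abs, abs_of_pos (Real.exp_pos _)] at hN
  exact (le_abs_self _).trans hN

theorem le_sq_mul_of_le {n z C b x : ℝ} (hn : 0 ≤ n) (hz : 1 ≤ z) (hC : 1 ≤ C)
    (hb : b ≤ z * (4 / 3 * (C + n))) (hx : x ≤ n + 5 / 4 * b) (hnz : 3 * n + 2 ≤ z) :
    x ≤ z * z * C := by
  have h1 : 1 ≤ z * C := one_le_mul_of_one_le_of_one_le hz hC
  have d1 : n ≤ (z * C) * n := le_mul_of_one_le_left hn h1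
  have d2 : z * n ≤ z * C * n :=
    mul_le_mul_of_nonneg_right (le_mul_of_one_le_right (by linarith) hC) hn
  calc x ≤ n + 5 / 4 * (z * (4 / 3 * (C + n))) := by linarith
    _ ≤ (z * C) * (3 * n + 2) := by linarith
    _ ≤ (z * C) * z := mul_le_mul_of_nonneg_left hnz (by linarith)
    _ = z * z * C := by ring

theorem exp_neg_le_one_sub_pow {κ δ : ℝ} (h0 : 0 ≤ κ) (h1 : κ ≤ 1 / 2) (hδ : κ ≤ δ) (N : ℕ) :
    Real.exp (-(2 * δ * N)) ≤ (1 - κ) ^ N := by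
  calc Real.exp (-(2 * δ * N)) = Real.exp (-(2 * δ)) ^ N := by
        rw [← Real.exp_nat_mul]; congr 1; ring
    _ ≤ (1 - κ) ^ N := by
        refine pow_le_pow_left₀ (Real.exp_pos _).le ?_ _
        have c1 : 1 - (1 - κ)⁻¹ ≤ Real.log (1 - κ) :=
          Real.one_sub_inv_le_log_of_pos (by linarith)
        have c2 : (1 - κ)⁻¹ ≤ 1 + 2 * κ := by
          rw [inv_le_iff_one_le_mul₀ (by linarith)]; nlinarith
        rw [← Real.exp_log (show 0 < 1 - κ by linarith), Real.exp_le_exp]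
        linarith

/-- The upper estimate of the cyclotomic sum near `r = 1`. -/
theorem eventually_abs_cycSum_le {ε : ℝ} (hε : 0 < ε) :
    ∀ᶠ r : ℝ in 𝓝 1, ∀ᶠ N : ℕ in atTop, |cycSum r N| ≤ Real.exp (ε * N) * cycSum 1 N := by
  -- One `e^{δN}` pays for dividing by the initial product at `r = 1`, one for the change of bulk
  -- sum, and two for the polynomial factor `3N + 2`.
  set δ := ε / 4 with hδ
  have hδ0 : 0 < δ := by positivity
  obtain ⟨η, h0, h1, hη⟩ := exists_small_eta hδ0
  filter_upwards [eventually_abs_sub_one_le (show (0 : ℝ) < 1 / 1280 by norm_num),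
    eventually_abs_sub_one_le (show 0 < η ^ 2 / 4 by positivity),
    eventually_abs_sub_one_le (show 0 < η ^ 2 / 4 * δ by positivity)] with r hr1 hr2 hr3
  have hκ1 : 4 * |r - 1| / η ^ 2 ≤ 1 := by
    rw [div_le_one (by positivity)]; linarith
  have hκδ : 4 * |r - 1| / η ^ 2 ≤ δ := by
    rw [div_le_iff₀ (by positivity)]; linarith
  have hκ0 : 0 ≤ 4 * |r - 1| / η ^ 2 := by positivity
  filter_upwards [eventually_ge_atTop 24, eventually_mul_half_pow_le h0 h1,
    eventually_le_exp_mul (show 0 < 2 * δ by positivity) 3 2] with N hN hl hexp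
  have hN0 : 0 < N := by omega
  have hb := isBulk_floor h0.le (by linarith : η ≤ 1) hN0
  set K := ⌊η * N⌋₊
  set L := ⌊(1 - η) * N⌋₊
  have hNr : (24 : ℝ) ≤ N := by exact_mod_cast hN
  have hK12 : 12 * K ≤ N := by
    have : (12 : ℝ) * K ≤ N := by nlinarith [hb.K_le]
    exact_mod_cast this
  have a1 := abs_cycSum_sub_le h0 h1 hr1 hκ1 hb hN hl
  have a2 := abs_cycSum_sub_le h0 h1 (r := 1) (by simp) (by simp) hb hN hl
  have hS := bulkSum_bounds h0 hκ1 hb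
  have hS1 := bulkSum_one_nonneg N K L
  have hSr : 0 ≤ bulkSum r N K L := le_trans (mul_nonneg (pow_nonneg (by linarith) _) hS1) hS.1
  have hP1 := cycProd_one_ge h0 (by linarith) hN0 hb.K_le
  have hC := one_le_cycSum_one hN0
  have hpow : (1 + 4 * |r - 1| / η ^ 2) ^ N ≤ Real.exp (δ * N) := by
    calc (1 + 4 * |r - 1| / η ^ 2) ^ N ≤ Real.exp δ ^ N := by
          refine pow_le_pow_left₀ (by linarith) ?_ _
          linarith [Real.add_one_le_exp δ]
      _ = _ := by rw [← Real.exp_nat_mul]; congr 1; ring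
  have hPS : 0 ≤ cycProd 1 N K * bulkSum 1 N K L := mul_nonneg (cycProd_one_nonneg _ _) hS1
  rw [abs_of_nonneg hPS] at a2
  have b1 : cycProd 1 N K * bulkSum 1 N K L ≤ 4 / 3 * (cycSum 1 N + N) := by
    have := (abs_le.mp a2).1
    linarith
  have b2 : bulkSum 1 N K L ≤ Real.exp (δ * N) * (4 / 3 * (cycSum 1 N + N)) := by
    have c1 : Real.exp (-(δ * N)) ≤ cycProd 1 N K := by
      refine le_trans (Real.exp_le_exp.mpr ?_) hP1
      have : (0 : ℝ) ≤ N := by positivity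
      nlinarith
    calc bulkSum 1 N K L = Real.exp (δ * N) * (Real.exp (-(δ * N)) * bulkSum 1 N K L) := by
          rw [← mul_assoc, ← Real.exp_add]; simp
      _ ≤ Real.exp (δ * N) * (cycProd 1 N K * bulkSum 1 N K L) := by gcongr
      _ ≤ _ := by gcongr
  have b3 : |cycProd r N K * bulkSum r N K L| ≤
      Real.exp (δ * N) * (Real.exp (δ * N) * (4 / 3 * (cycSum 1 N + N))) := by
    rw [abs_mul, abs_of_nonneg hSr]
    calc |cycProd r N K| * bulkSum r N K L ≤ 1 * bulkSum r N K L :=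
          mul_le_mul_of_nonneg_right (abs_cycProd_le_one hr1 hK12) hSr
      _ ≤ (1 + 4 * |r - 1| / η ^ 2) ^ N * bulkSum 1 N K L := by rw [one_mul]; exact hS.2
      _ ≤ _ := by gcongr
  have e2 : Real.exp (δ * N) * Real.exp (δ * N) = Real.exp (2 * δ * N) := by
    rw [← Real.exp_add]; congr 1; ring
  have e4 : Real.exp (ε * N) = Real.exp (2 * δ * N) * Real.exp (2 * δ * N) := by
    rw [← Real.exp_add]; congr 1; rw [hδ]; ring
  rw [← mul_assoc, e2] at b3
  have hz : 1 ≤ Real.exp (2 * δ * N) := Real.one_le_exp (by positivity)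
  set z := Real.exp (2 * δ * N) with hzdef
  set C := cycSum 1 N with hCdef
  have b4 : |cycSum r N| ≤ N + 5 / 4 * |cycProd r N K * bulkSum r N K L| := by
    have := abs_sub_abs_le_abs_sub (cycSum r N) (cycProd r N K * bulkSum r N K L)
    linarith
  rw [e4]
  exact le_sq_mul_of_le (by positivity) hz hC b3 b4 hexp

/-- Put `w = C / z^4`. Then `3b/4 ≥ (3/10) γ² z w ≥ 2w`, while the error satisfies `n ≤ z ≤ w`. -/
theorem inv_pow_mul_le_of_le {n z C γ b x : ℝ} (hz : 1 ≤ z) (hγ : 20 ≤ 3 * γ ^ 2 * z)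
    (hC : z ^ 5 ≤ C) (hn : n ≤ z) (hb : γ ^ 2 * z⁻¹ * ((z ^ 2)⁻¹ * (2 / 5 * C)) ≤ b)
    (hx : 3 / 4 * b - n ≤ x) : (z ^ 4)⁻¹ * C ≤ x := by
  have hz0 : 0 < z := by linarith
  obtain ⟨w, rfl⟩ : ∃ w, C = z ^ 4 * w := ⟨C / z ^ 4, by field_simp⟩
  have hw : z ≤ w := by
    refine le_of_mul_le_mul_left ?_ (pow_pos hz0 4)
    linarith [pow_succ z 4]
  have e1 : γ ^ 2 * z⁻¹ * ((z ^ 2)⁻¹ * (2 / 5 * (z ^ 4 * w))) = 2 / 5 * (γ ^ 2 * z * w) := by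
    field_simp
  have e2 : (z ^ 4)⁻¹ * (z ^ 4 * w) = w := by field_simp
  rw [e1] at hb
  rw [e2]
  have : 20 * w ≤ 3 * γ ^ 2 * z * w := mul_le_mul_of_nonneg_right hγ (by linarith)
  linarith

set_option maxHeartbeats 800000 in
/-- The lower estimate of the cyclotomic sum near `r = 1`, for those `N` for which no factor of
the cyclotomic products is too small. -/
theorem eventually_le_abs_cycSum {ε : ℝ} (hε : 0 < ε) :
    ∀ᶠ r : ℝ in 𝓝[≠] 1, ∀ᶠ N : ℕ in atTop,
      |r - 1| / r / 4 ≤ Int.fract (|r - 1| / r * N) →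
      Int.fract (|r - 1| / r * N) ≤ 1 - |r - 1| / r / 4 →
      Real.exp (-(ε * N)) * cycSum 1 N ≤ |cycSum r N| := by
  -- With `z = e^{δN}`, the initial product costs `γ² z⁻¹` and the bulk `z⁻²`; a further `z⁻¹`
  -- absorbs `γ²` and the constants, whence `4δ ≤ ε`. The second bound gives `z^5 ≤ 2^(N/12) ≤
  -- J_N(1)`.
  set δ := min (ε / 4) (Real.log 2 / 60) with hδ
  have hlog := Real.log_pos one_lt_two
  have hδ0 : 0 < δ := lt_min (by positivity) (by positivity)
  have hδε : 4 * δ ≤ ε := by linarith [min_le_left (ε / 4) (Real.log 2 / 60)]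
  have hδl : 5 * δ ≤ Real.log 2 / 12 := by linarith [min_le_right (ε / 4) (Real.log 2 / 60)]
  obtain ⟨η, h0, h1, hη⟩ := exists_small_eta hδ0
  filter_upwards [(eventually_abs_sub_one_le (show (0 : ℝ) < 1 / 1280 by norm_num)).filter_mono
      nhdsWithin_le_nhds,
    (eventually_abs_sub_one_le (show 0 < η ^ 2 / 8 by positivity)).filter_mono nhdsWithin_le_nhds,
    (eventually_abs_sub_one_le (show 0 < η ^ 2 / 4 * δ by positivity)).filter_mono
      nhdsWithin_le_nhds,
    (eventually_abs_sub_one_le (show 0 < η / 4 by positivity)).filter_mono nhdsWithin_le_nhds,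
    self_mem_nhdsWithin] with r hr1 hr2 hr3 hr4 hrne
  have hκ1 : 4 * |r - 1| / η ^ 2 ≤ 1 / 2 := by
    rw [div_le_iff₀ (by positivity)]; linarith
  have hκδ : 4 * |r - 1| / η ^ 2 ≤ δ := by
    rw [div_le_iff₀ (by positivity)]; linarith
  have hκ0 : 0 ≤ 4 * |r - 1| / η ^ 2 := by positivity
  have hr12 : 1 / 2 ≤ r := by linarith [(abs_le.mp hr1).1]
  have hr0 : 0 < r := by linarith
  have ha0 : 0 < |r - 1| / r := div_pos (abs_pos.mpr (sub_ne_zero.mpr hrne)) hr0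
  have haη : |r - 1| / r ≤ η / 2 := by
    rw [div_le_iff₀ hr0]; nlinarith
  set γ := |r - 1| / r / 4 with hγ
  have hγ0 : 0 < γ := by positivity
  filter_upwards [eventually_ge_atTop 24, eventually_mul_half_pow_le h0 h1,
    eventually_le_exp_mul hδ0 0 (20 / (3 * γ ^ 2)), eventually_le_exp_mul hδ0 2 0,
    eventually_le_exp_mul (show 0 < Real.log 2 / 12 by positivity) 2 0,
    eventually_ge_atTop ⌈2 / η⌉₊] with N hN hl hγN hN2 hNl hNη hf1 hf2
  have hN0 : 0 < N := by omega
  have hb := isBulk_floor h0.le (by linarith : η ≤ 1) hN0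
  set K := ⌊η * N⌋₊
  set L := ⌊(1 - η) * N⌋₊
  have hNr : (24 : ℝ) ≤ N := by exact_mod_cast hN
  -- The sign change lies in the initial stretch: `|r-1|N/r ≤ ηN/2 ≤ ηN - 1 < K` once `N ≥ 2/η`.
  have hβK : |r - 1| / r * N ≤ K := by
    have h2 : 2 / η ≤ N := (Nat.le_ceil _).trans (by exact_mod_cast hNη)
    rw [div_le_iff₀ h0] at h2
    have := hb.lt_K
    nlinarith
  have hP := abs_cycProd_ge (hr1.trans (by norm_num)) h0 (by linarith) hγ0.le hN0 hb.K_le hβK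
    hf1 hf2
  have hK12 : 12 * K ≤ N := by
    have : (12 : ℝ) * K ≤ N := by nlinarith [hb.K_le]
    exact_mod_cast this
  have a1 := abs_cycSum_sub_le h0 h1 hr1 (by linarith) hb hN hl
  have a2 := abs_cycSum_sub_le h0 h1 (r := 1) (by simp) (by simp) hb hN hl
  have hS := (bulkSum_bounds h0 (by linarith) hb (r := r)).1
  have hS1 := bulkSum_one_nonneg N K L
  have hSr : 0 ≤ bulkSum r N K L := le_trans (mul_nonneg (pow_nonneg (by linarith) _) hS1) hS
  have hC := exp_le_cycSum_one (show 2 ≤ N by omega)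
  have hpow := exp_neg_le_one_sub_pow hκ0 hκ1 hκδ N
  have hPS : 0 ≤ cycProd 1 N K * bulkSum 1 N K L := mul_nonneg (cycProd_one_nonneg _ _) hS1
  rw [abs_of_nonneg hPS] at a2
  set C := cycSum 1 N with hCdef
  have b1 : 4 / 5 * (C - N) ≤ bulkSum 1 N K L := by
    have c1 := (abs_le.mp a2).2
    have c2 : cycProd 1 N K * bulkSum 1 N K L ≤ 1 * bulkSum 1 N K L :=
      mul_le_mul_of_nonneg_right ((le_abs_self _).trans (abs_cycProd_le_one (by simp) hK12)) hS1
    linarith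
  have hCN : C / 2 ≤ C - N := by linarith
  have hC0 : 0 < C := lt_of_lt_of_le (Real.exp_pos _) hC
  have b2 : 2 / 5 * C ≤ bulkSum 1 N K L := by linarith
  have hPδ : γ ^ 2 * Real.exp (-(δ * N)) ≤ |cycProd r N K| := by
    refine le_trans (mul_le_mul_of_nonneg_left (Real.exp_le_exp.mpr ?_) (by positivity)) hP
    have : (0 : ℝ) ≤ N := by positivity
    nlinarith
  have b3 : γ ^ 2 * Real.exp (-(δ * N)) * (Real.exp (-(2 * δ * N)) * (2 / 5 * C)) ≤
      |cycProd r N K * bulkSum r N K L| := by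
    rw [abs_mul, abs_of_nonneg hSr]
    refine mul_le_mul hPδ (le_trans ?_ hS) (by positivity) (abs_nonneg _)
    exact mul_le_mul hpow b2 (by positivity) (pow_nonneg (by linarith) _)
  have b4 : 3 / 4 * |cycProd r N K * bulkSum r N K L| - N ≤ |cycSum r N| := by
    have := abs_sub_abs_le_abs_sub (cycProd r N K * bulkSum r N K L) (cycSum r N)
    rw [abs_sub_comm] at this
    linarith
  set z := Real.exp (δ * N) with hz
  have hz1 : 1 ≤ z := Real.one_le_exp (by positivity)
  have hz0 : 0 < z := by linarith
  have e1 : Real.exp (-(δ * N)) = z⁻¹ := Real.exp_neg _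
  have e2 : Real.exp (-(2 * δ * N)) = (z ^ 2)⁻¹ := by
    rw [hz, ← Real.exp_nat_mul, ← Real.exp_neg]; congr 1; push_cast; ring
  have e3 : z ^ 5 ≤ C := by
    refine le_trans ?_ hC
    rw [hz, ← Real.exp_nat_mul, Real.exp_le_exp]
    have : (0 : ℝ) ≤ N := by positivity
    push_cast
    nlinarith
  have e4 : Real.exp (-(ε * N)) ≤ (z ^ 4)⁻¹ := by
    rw [hz, ← Real.exp_nat_mul, ← Real.exp_neg, Real.exp_le_exp]
    have : (0 : ℝ) ≤ N := by positivity
    push_cast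
    nlinarith
  rw [e1, e2] at b3
  have hγz : 20 ≤ 3 * γ ^ 2 * z := by
    rw [zero_mul, zero_add, div_le_iff₀ (by positivity)] at hγN
    linarith
  calc Real.exp (-(ε * N)) * C ≤ (z ^ 4)⁻¹ * C := mul_le_mul_of_nonneg_right e4 hC0.le
    _ ≤ |cycSum r N| := inv_pow_mul_le_of_le hz1 hγz e3 (by linarith) b3 b4

/-- A point within `a/4` of an integer is moved by a step `a` to distance at least `3a/4` beyond it,
and `a ≤ 1/4` keeps it from reaching the next integer. Applied with `x = aN`, so that the step is
the passage from `N` to `N + 1`. -/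
theorem fract_mem_or_fract_succ_mem {a : ℝ} (h0 : 0 < a) (h1 : a ≤ 1 / 4) (x : ℝ) :
    (a / 4 ≤ Int.fract x ∧ Int.fract x ≤ 1 - a / 4) ∨
      (a / 4 ≤ Int.fract (x + a) ∧ Int.fract (x + a) ≤ 1 - a / 4) := by
  have hf0 := Int.fract_nonneg x
  have hf1 := Int.fract_lt_one x
  have hx := Int.floor_add_fract x
  rcases lt_or_ge (Int.fract x) (a / 4) with h | h
  · right
    have : Int.fract (x + a) = Int.fract x + a := by
      rw [Int.fract_eq_iff]
      refine ⟨by linarith, by linarith, ⌊x⌋, ?_⟩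
      linarith
    rw [this]
    constructor <;> linarith
  rcases le_or_gt (Int.fract x) (1 - a / 4) with h' | h'
  · exact Or.inl ⟨h, h'⟩
  · right
    have : Int.fract (x + a) = Int.fract x + a - 1 := by
      rw [Int.fract_eq_iff]
      refine ⟨by linarith, by linarith, ⌊x⌋ + 1, ?_⟩
      push_cast
      linarith
    rw [this]
    constructor <;> linarith

/-! ### Growth rates and the limit -/

/-- The sequence whose limsup is the growth rate. -/
def logTerm (r : ℝ) (N : ℕ) : EReal :=
  ENNReal.log ‖coloredJones N figureEight
    (Complex.exp (2 * (Real.pi : ℂ) * (r : ℂ) * Complex.I / (N : ℂ)))‖ₑ / (N : EReal)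

theorem enorm_ofReal_complex (x : ℝ) : ‖(x : ℂ)‖ₑ = ENNReal.ofReal |x| := by
  rw [← ofReal_norm, Complex.norm_real, Real.norm_eq_abs]

theorem log_ofReal_exp (c : ℝ) : ENNReal.log (ENNReal.ofReal (Real.exp c)) = (c : EReal) := by
  rw [ENNReal.log_ofReal_of_pos (Real.exp_pos c), Real.log_exp]

theorem logTerm_le_iff {r c : ℝ} {N : ℕ} (hN : 2 * |r| < N) :
    logTerm r N ≤ c ↔ |cycSum r N| ≤ Real.exp (c * N) := by
  have hN0 : (0 : ℝ) < N := lt_of_le_of_lt (by positivity) hN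
  have h1 : (0 : EReal) < (N : EReal) := by exact_mod_cast hN0
  have h3 : ((N : EReal) * (c : EReal)) = ((c * N : ℝ) : EReal) := by
    rw [mul_comm, EReal.coe_mul]; rfl
  rw [logTerm, coloredJones_figureEight_exp hN, EReal.div_le_iff_le_mul h1 (EReal.natCast_ne_top N),
    enorm_ofReal_complex, h3, ← log_ofReal_exp, ENNReal.log_le_log_iff,
    ENNReal.ofReal_le_ofReal_iff (Real.exp_pos _).le]

theorem le_logTerm_iff {r c : ℝ} {N : ℕ} (hN : 2 * |r| < N) :
    c ≤ logTerm r N ↔ Real.exp (c * N) ≤ |cycSum r N| := by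
  have hN0 : (0 : ℝ) < N := lt_of_le_of_lt (by positivity) hN
  have h1 : (0 : EReal) < (N : EReal) := by exact_mod_cast hN0
  have h3 : ((c : EReal) * (N : EReal)) = ((c * N : ℝ) : EReal) := by
    rw [EReal.coe_mul]; rfl
  rw [logTerm, coloredJones_figureEight_exp hN, EReal.le_div_iff_mul_le h1 (EReal.natCast_ne_top N),
    enorm_ofReal_complex, h3, ← log_ofReal_exp, ENNReal.log_le_log_iff,
    ENNReal.ofReal_le_ofReal_iff (abs_nonneg _)]

theorem eventually_two_mul_abs_lt (r : ℝ) : ∀ᶠ N : ℕ in atTop, 2 * |r| < N :=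
  tendsto_natCast_atTop_atTop.eventually_gt_atTop _

theorem growthRate_le {r c : ℝ} (h : ∀ᶠ N : ℕ in atTop, |cycSum r N| ≤ Real.exp (c * N)) :
    growthRate r ≤ c := by
  refine limsup_le_of_le (f := atTop) (u := logTerm r) (by isBoundedDefault) ?_
  filter_upwards [h, eventually_two_mul_abs_lt r] with N hN hr
  exact (logTerm_le_iff hr).mpr hN

theorem le_growthRate {r c : ℝ} (h : ∃ᶠ N : ℕ in atTop, Real.exp (c * N) ≤ |cycSum r N|) :
    c ≤ growthRate r := by
  refine le_limsup_of_frequently_le (f := atTop) (u := logTerm r) ?_ (by isBoundedDefault)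
  refine (h.and_eventually (eventually_two_mul_abs_lt r)).mono ?_
  rintro N ⟨hN, hr⟩
  exact (le_logTerm_iff hr).mpr hN

theorem eventually_le_of_growthRate_lt {r c : ℝ} (h : growthRate r < c) :
    ∀ᶠ N : ℕ in atTop, |cycSum r N| ≤ Real.exp (c * N) := by
  have h1 : ∀ᶠ N : ℕ in atTop, logTerm r N < c :=
    eventually_lt_of_limsup_lt (f := atTop) (u := logTerm r) h (by isBoundedDefault)
  filter_upwards [h1, eventually_two_mul_abs_lt r] with N hN hr
  exact (logTerm_le_iff hr).mp hN.le

theorem frequently_le_of_lt_growthRate {r c : ℝ} (h : c < growthRate r) :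
    ∃ᶠ N : ℕ in atTop, Real.exp (c * N) ≤ |cycSum r N| := by
  have h1 : ∃ᶠ N : ℕ in atTop, c < logTerm r N :=
    frequently_lt_of_lt_limsup (f := atTop) (u := logTerm r) (by isBoundedDefault) h
  refine (h1.and_eventually (eventually_two_mul_abs_lt r)).mono ?_
  rintro N ⟨hN, hr⟩
  exact (le_logTerm_iff hr).mp hN.le

theorem cycProd_one_le (N m : ℕ) : cycProd 1 N m ≤ 4 ^ m := by
  have := Finset.prod_le_prod (s := Finset.range m) (f := fun s => cycFactor 1 N (s + 1))
    (g := fun _ => (4 : ℝ)) (fun s _ => cycFactor_one_nonneg _ _) (fun s _ => by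
      rw [cycFactor_one]; nlinarith [Real.sin_sq_le_one (Real.pi * (((s + 1 : ℕ) : ℝ) / N))])
  simpa [cycProd] using this

theorem cycSum_one_le (N : ℕ) : cycSum 1 N ≤ N * 4 ^ N := by
  calc cycSum 1 N ≤ ∑ _m ∈ Finset.range N, (4 : ℝ) ^ N :=
        Finset.sum_le_sum fun m hm => (cycProd_one_le N m).trans
          (pow_le_pow_right₀ (by norm_num) (Finset.mem_range.mp hm).le)
    _ = N * 4 ^ N := by simp

theorem growthRate_one_nonneg : 0 ≤ growthRate 1 := by
  refine le_growthRate (c := 0) (Eventually.frequently ?_)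
  filter_upwards [eventually_gt_atTop 0] with N hN
  simpa using (one_le_cycSum_one hN).trans (le_abs_self _)

theorem growthRate_one_le : growthRate 1 ≤ ((1 + Real.log 4 : ℝ) : EReal) := by
  refine growthRate_le ?_
  filter_upwards [eventually_gt_atTop 0] with N hN
  rw [abs_of_nonneg (zero_le_one.trans (one_le_cycSum_one hN))]
  refine (cycSum_one_le N).trans ?_
  have h : Real.exp ((1 + Real.log 4) * N) = Real.exp N * 4 ^ N := by
    rw [add_mul, one_mul, Real.exp_add, ← Real.rpow_def_of_pos (by norm_num), Real.rpow_natCast]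
  rw [h]
  gcongr
  linarith [Real.add_one_le_exp (N : ℝ)]

/-- Two reals `c < d` are inserted between `growthRate 1` and `b`; the gap `d - c` is the
exponential loss allowed in the upper estimate. -/
theorem eventually_growthRate_lt {b : EReal} (hb : growthRate 1 < b) :
    ∀ᶠ r in 𝓝[≠] (1 : ℝ), growthRate r < b := by
  obtain ⟨c, hc1, hc2⟩ := EReal.lt_iff_exists_real_btwn.mp hb
  obtain ⟨d, hd1, hd2⟩ := EReal.lt_iff_exists_real_btwn.mp hc2
  have hcd : 0 < d - c := sub_pos.mpr (EReal.coe_lt_coe_iff.mp hd1)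
  filter_upwards [(eventually_abs_cycSum_le hcd).filter_mono nhdsWithin_le_nhds] with r hr
  refine lt_of_le_of_lt (growthRate_le ?_) hd2
  filter_upwards [hr, eventually_le_of_growthRate_lt hc1] with N h1 h2
  calc |cycSum r N| ≤ Real.exp ((d - c) * N) * cycSum 1 N := h1
    _ ≤ Real.exp ((d - c) * N) * Real.exp (c * N) := by
        gcongr
        exact (le_abs_self _).trans h2
    _ = Real.exp (d * N) := by rw [← Real.exp_add]; congr 1; ring

theorem eventually_lt_growthRate {a : EReal} (ha : a < growthRate 1) :
    ∀ᶠ r in 𝓝[≠] (1 : ℝ), a < growthRate r := by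
  obtain ⟨d, hd1, hd2⟩ := EReal.lt_iff_exists_real_btwn.mp ha
  obtain ⟨c, hc1, hc2⟩ := EReal.lt_iff_exists_real_btwn.mp hd2
  have hdc : d < c := EReal.coe_lt_coe_iff.mp hc1
  -- Half of the gap is lost in the lower estimate; the other half must pay for the possible shift
  -- to `N + 1`, which costs `2 + |c|` in the exponent. This is why `N₁` exceeds `(2 + |c|)/ε`.
  set ε := (c - d) / 2 with hε
  have hε0 : 0 < ε := by linarith
  filter_upwards [eventually_le_abs_cycSum hε0,
    (eventually_abs_sub_one_le (show (0 : ℝ) < 1 / 8 by norm_num)).filter_mono nhdsWithin_le_nhds,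
    self_mem_nhdsWithin] with r hr hr1 hrne
  refine lt_of_lt_of_le hd1 (le_growthRate ?_)
  have hr12 : 1 / 2 ≤ r := by linarith [(abs_le.mp hr1).1]
  have hr0 : 0 < r := by linarith
  have ha0 : 0 < |r - 1| / r := div_pos (abs_pos.mpr (sub_ne_zero.mpr hrne)) hr0
  have ha1 : |r - 1| / r ≤ 1 / 4 := by rw [div_le_iff₀ hr0]; linarith
  set α := |r - 1| / r
  obtain ⟨N₀, hN₀⟩ := eventually_atTop.mp hr
  obtain ⟨N₁, hN₁⟩ := exists_nat_gt ((2 + |c|) / ε)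
  rw [frequently_atTop]
  intro n
  obtain ⟨N, hNge, hN⟩ := frequently_atTop.mp (frequently_le_of_lt_growthRate hc2)
    (n + N₀ + N₁ + 1)
  have hN0 : 0 < N := by omega
  rw [abs_of_nonneg (zero_le_one.trans (one_le_cycSum_one hN0))] at hN
  have hNr : (N₁ : ℝ) ≤ N := by exact_mod_cast (show N₁ ≤ N by omega)
  rw [div_lt_iff₀ hε0] at hN₁
  have hNpos : (0 : ℝ) ≤ N := by positivity
  have hεN : 2 + |c| ≤ ε * N := by nlinarith
  have hcd : d = c - 2 * ε := by rw [hε]; ring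
  -- The `N` with large `J_N(1)` may be resonant for this `r`; in that case `N + 1` is not, and
  -- serves instead.
  rcases fract_mem_or_fract_succ_mem ha0 ha1 (α * N) with h | h
  · refine ⟨N, by omega, le_trans ?_ (hN₀ N (by omega) h.1 h.2)⟩
    calc Real.exp (d * N) ≤ Real.exp (-(ε * N)) * Real.exp (c * N) := by
          rw [← Real.exp_add, Real.exp_le_exp, hcd]
          nlinarith
      _ ≤ _ := by gcongr
  · have hs : α * N + α = α * ((N + 1 : ℕ) : ℝ) := by push_cast; ring
    rw [hs] at h
    refine ⟨N + 1, by omega, le_trans ?_ (hN₀ (N + 1) (by omega) h.1 h.2)⟩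
    calc Real.exp (d * ((N + 1 : ℕ) : ℝ))
        ≤ Real.exp (-(ε * ((N + 1 : ℕ) : ℝ))) * (Real.exp (-2) * Real.exp (c * N)) := by
          rw [← Real.exp_add, ← Real.exp_add, Real.exp_le_exp, hcd]
          push_cast
          linarith [le_abs_self c]
      _ ≤ Real.exp (-(ε * ((N + 1 : ℕ) : ℝ))) * (Real.exp (-2) * cycSum 1 N) := by gcongr
      _ ≤ _ := by
          gcongr
          exact cycSum_one_succ_ge hN0

end ColoredJones

end

/-- The limsup growth rate of the colored Jones polynomials of the figure-eight knot at
`exp(2 π r √-1 / N)` is finite at `r = 1`, and its limit as `r → 1` is its value at `r = 1`. -/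
theorem mainTheorem2 :
    ColoredJones.growthRate 1 ≠ ⊥ ∧ ColoredJones.growthRate 1 ≠ ⊤ ∧
      Tendsto ColoredJones.growthRate (𝓝[≠] (1 : ℝ)) (𝓝 (ColoredJones.growthRate 1)) := by
  refine ⟨?_, ?_, ?_⟩
  · exact (lt_of_lt_of_le (EReal.bot_lt_zero) ColoredJones.growthRate_one_nonneg).ne'
  · exact (lt_of_le_of_lt ColoredJones.growthRate_one_le (EReal.coe_lt_top _)).ne
  · exact tendsto_order.mpr ⟨fun _ ha => ColoredJones.eventually_lt_growthRate ha,
      fun _ hb => ColoredJones.eventually_growthRate_lt hb⟩
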